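/- Let $K\ge 2$ and let $\mathsf F=N_K(0,I)$ be the law of $K$ independent $N(0,1)$ sources. The vectors $X_1,X_2,\dots\in\mathbb R^K$ are independent, with $X_n\sim\mathsf F$ for $n\le\nu$ and $X_n\sim\mathsf G$ for $n>\nu$, where $\nu\in\{0,1,2,\dots\}$ is unknown and $\mathsf G$ is an unknown element of a family $\mathcal G$ of laws on $\mathbb R^K$; write $\mathsf P_\nu^{\mathsf G}$ for the resulting law and $\mathsf P_\infty$ for the law without change. For $E\subseteq\{1,\dots,K\}$ let $X_n^E$ be the sub-vector with index set $E$ and let $\mathsf F^E,\mathsf G^E$ be its laws under $\mathsf F,\mathsf G$. A policy $(S,T)$ consists of random pairs of sources $S_1,S_2,\dots$ and a positive, possibly infinite, integer-valued time $T$. With $\mathcal F_0^S$ a $\sigma$-algebra independent of all $X_n$ (external randomization) and $\mathcal F_n^S=\sigma(\mathcal F_{n-1}^S,X_n^{S_n})$, it is required that $S_n$ is $\mathcal F_{n-1}^S$-measurable and $\{T=n\}\in\mathcal F_n^S$ for all $n\ge1$. For $\gamma>1$ let $\Delta(\gamma)$ be the set of policies with $\mathsf E_\infty[T]\ge\gamma$.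 Let $\mathcal A(\mathsf G)$ be the set of pairs $E$ with $\mathsf G^E\ne\mathsf F^E$, and let $$D^{\mathsf G}(S,T)=\sup_{\nu\ge0}\ \operatorname{ess\,sup}\ \mathsf E_\nu^{\mathsf G}\big[T-\nu\,\big|\,\mathcal F_\nu^S(\mathsf G),\,T>\nu\big],\qquad \mathcal F_\nu^S(\mathsf G)=\sigma\big(S_t,X_t^{S_t}: t\le\nu,\ S_t\in\mathcal A(\mathsf G)\big).$$ Round Robin CUSUM policy: let $U$ be a non-empty set of pairs, listed in an arbitrary fixed order $E_1,\dots,E_L$ without repetition. For $E\in U$ let $\mathcal G^E=\{\mathsf G^E:\mathsf G\in\mathcal G,\ \mathsf G^E\neq\mathsf F^E\}$, let $\mathsf H^E$ be the uniform mixture of the members of $\mathcal G^E$, and let $\xi_n^E=\log\frac{d\mathsf H^E}{d\mathsf F^E}(X_n^E)$. Put $Y_0=0$, $\tilde S_1=E_1$ and $Y_n=\max\{Y_{n-1},0\}+\xi_n^{\tilde S_n}$. If $Y_n\le0$, then $\tilde S_{n+1}$ is the unit after $\tilde S_n$ in cyclic order; otherwise $\tilde S_{n+1}=\tilde S_n$.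 The alarm is raised at $\tilde T=\inf\{n\ge1:Y_n\ge A\}$, with $A=\log\gamma$. The policy $(\tilde S,\tilde T)$ is called asymptotically optimal if, for every $\mathsf G\in\mathcal G$, it belongs to $\Delta(\gamma)$ for every $\gamma>1$ and $$\lim_{\gamma\to\infty}\frac{D^{\mathsf G}(\tilde S,\tilde T)}{\inf\{D^{\mathsf G}(S,T):(S,T)\in\Delta(\gamma)\}}=1 .$$ Let $\rho\in(0,1)$, and let $\mathcal C_\rho$ be the set of positive semidefinite matrices $R\in\mathbb R^{K\times K}$ with $R\ne I$, $R_{ii}=1$ for all $i$ and $R_{ij}\in\{0,\rho\}$ for all $i<j$. (i) If $\mathcal G=\{N_K(0,R):R\in\mathcal C_\rho\}$, then $(\tilde S,\tilde T)$ with $U$ the set of all pairs of sources is asymptotically optimal. (ii) If $\mathcal G=\{N_K(0,R):R\in\mathcal C_\rho,\ R_{i,i+1}=\rho\text{ for some }1\le i\le K-1\}$, then $(\tilde S,\tilde T)$ is asymptotically optimal both with $U$ the set of all pairs of sources and with $U=\{\{i,i+1\}:1\le i\le K-1\}$. -/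

import Mathlib

open MeasureTheory ProbabilityTheory Filter Topology
open scoped ENNReal

namespace ActiveDetection

noncomputable section

/-! ### The change-point model

There are `K` sources with real values. An outcome consists of a randomization variable, with values
in an arbitrary probability space `Ξ`, and of the sequence of all observations. Times are `1, 2, …`
in the mathematics; the entry with index `i` of a sequence belongs to time `i + 1`. Thus `ω.2 i` is
the vector of all sources at time `i + 1`, and there are `ν` entries with index below `ν`. -/

/-- The sample space: randomization together with the path of all sources. -/
abbrev Outcome (Ξ : Type*) (K : ℕ) : Type _ := Ξ × (ℕ → Fin K → ℝ)

/-- A sampling rule: `S i ω` is the set of sources sampled at time `i + 1`. -/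
abbrev SamplingRule (Ξ : Type*) (K : ℕ) : Type _ := ℕ → Outcome Ξ K → Finset (Fin K)

/-- A time at which an alarm is raised; `⊤` means never. -/
abbrev AlarmTime (Ξ : Type*) (K : ℕ) : Type _ := Outcome Ξ K → ℕ∞

section Model

variable {Ξ : Type*} [MeasurableSpace Ξ] {K : ℕ}

/-- The law when there is no change: all observations are i.i.d. with law `F`. -/
def noChangeLaw (π : Measure Ξ) (F : Measure (Fin K → ℝ)) : Measure (Outcome Ξ K) :=
  π.prod (Measure.infinitePi fun _ : ℕ => F)

/-- The law when the global distribution changes from `F` to `G` after time `ν`. -/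
def changeLaw (π : Measure Ξ) (F G : Measure (Fin K → ℝ)) (ν : ℕ) : Measure (Outcome Ξ K) :=
  π.prod (Measure.infinitePi fun i : ℕ => if i < ν then F else G)

/-- The local distribution of the subset `E` of sources under the global distribution `P`. -/
def localLaw (P : Measure (Fin K → ℝ)) (E : Finset (Fin K)) : Measure (E → ℝ) :=
  P.map E.restrict

/-- The family of all size-`m` subsets of sources. -/
def subsetsOfSize (K m : ℕ) : Set (Finset (Fin K)) := {E | E.card = m}

/-- The size-`m` subsets whose local distribution is affected by the change from `F` to `G`. -/
def affected (m : ℕ) (F G : Measure (Fin K → ℝ)) : Set (Finset (Fin K)) :=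
  {E | E ∈ subsetsOfSize K m ∧ localLaw G E ≠ localLaw F E}

/-! ### Policies -/

/-- The σ-algebra generated by the set `S i` sampled at time `i + 1` and the values seen there, as
far as `S i ∈ 𝒜`: it is generated by the events "`S i = E` and the values of the sources in `E` lie
in `B`" with `E ∈ 𝒜` and `B` a Borel set. -/
def sampleAlgebra (S : SamplingRule Ξ K) (𝒜 : Set (Finset (Fin K))) (i : ℕ) :
    MeasurableSpace (Outcome Ξ K) :=
  MeasurableSpace.generateFrom
    {s | ∃ E ∈ 𝒜, ∃ B : Set (E → ℝ), MeasurableSet B ∧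
      s = {ω | S i ω = E ∧ E.restrict (ω.2 i) ∈ B}}

/-- The information available at time `n` under the sampling rule `S`: the randomization and the
collected observations up to time `n`. -/
def history (S : SamplingRule Ξ K) : ℕ → MeasurableSpace (Outcome Ξ K)
  | 0 => MeasurableSpace.comap Prod.fst inferInstance
  | n + 1 => history S n ⊔ sampleAlgebra S Set.univ n

/-- `(S, T)` is a joint sequential sampling rule and change-detection policy: exactly `m` sources
are sampled at every time, the set sampled at time `n + 1` is determined by the information at time
`n`, and `T` is a positive stopping time of the filtration of collected observations. -/
structure IsPolicy (m : ℕ) (S : SamplingRule Ξ K) (T : AlarmTime Ξ K) : Prop where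
  size : ∀ n ω, S n ω ∈ subsetsOfSize K m
  predictable : ∀ n E, MeasurableSet[history S n] {ω | S n ω = E}
  pos : ∀ ω, 1 ≤ T ω
  stopping : ∀ n : ℕ, MeasurableSet[history S n] {ω | T ω = n}

/-- The policies whose expected time to a false alarm is at least `γ`. -/
def falseAlarmClass (π : Measure Ξ) (m : ℕ) (F : Measure (Fin K → ℝ)) (γ : ℝ) :
    Set (SamplingRule Ξ K × AlarmTime Ξ K) :=
  {p | IsPolicy m p.1 p.2 ∧
    ENNReal.ofReal γ ≤ ∫⁻ ω, (p.2 ω : ℝ≥0∞) ∂(noChangeLaw π F)}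

/-- The information up to time `ν` that comes from the affected subsets only. -/
def affectedHistory (m : ℕ) (F G : Measure (Fin K → ℝ)) (S : SamplingRule Ξ K) (ν : ℕ) :
    MeasurableSpace (Outcome Ξ K) :=
  ⨆ i : ℕ, ⨆ _ : i < ν, sampleAlgebra S (affected m F G) i

/-- The worst-case conditional expected detection delay: the supremum over the change-point `ν` of
the essential supremum of the conditional expectation of `T - ν` given the event `T > ν` and the
history of the affected subsets up to time `ν`. -/
def delay (π : Measure Ξ) (m : ℕ) (F G : Measure (Fin K → ℝ))
    (p : SamplingRule Ξ K × AlarmTime Ξ K) : ℝ≥0∞ :=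
  ⨆ ν : ℕ,
    essSup
      (condLExp (affectedHistory m F G p.1 ν)
        (cond (changeLaw π F G ν) {ω | (ν : ℕ∞) < p.2 ω})
        (fun ω => (p.2 ω : ℝ≥0∞) - (ν : ℝ≥0∞)))
      (cond (changeLaw π F G ν) {ω | (ν : ℕ∞) < p.2 ω})

/-- A family of policies indexed by the false alarm level `γ` is asymptotically optimal under `G`:
it meets every false alarm constraint, and its delay is asymptotically equivalent, as `γ → ∞`, to
the smallest delay of all policies that meet the constraint. -/
def AsymptoticallyOptimal (π : Measure Ξ) (m : ℕ) (F G : Measure (Fin K → ℝ))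
    (p : ℝ → SamplingRule Ξ K × AlarmTime Ξ K) : Prop :=
  (∀ γ : ℝ, 1 < γ → p γ ∈ falseAlarmClass π m F γ) ∧
    Tendsto
      (fun γ : ℝ => delay π m F G (p γ) / ⨅ q ∈ falseAlarmClass π m F γ, delay π m F G q)
      atTop (𝓝 1)

end Model

/-! ### The Round Robin CUSUM policy -/

section RoundRobin

variable {K : ℕ}

/-- The plausible post-change local distributions of `E`. -/
def postChangeLaws (F : Measure (Fin K → ℝ)) (𝒢 : Set (Measure (Fin K → ℝ)))
    (E : Finset (Fin K)) : Set (Measure (E → ℝ)) :=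
  {P | ∃ G ∈ 𝒢, localLaw G E = P ∧ P ≠ localLaw F E}

/-- The uniform mixture of the plausible post-change local distributions of `E`. -/
def mixtureLaw (F : Measure (Fin K → ℝ)) (𝒢 : Set (Measure (Fin K → ℝ)))
    (E : Finset (Fin K)) : Measure (E → ℝ) :=
  ((postChangeLaws F 𝒢 E).ncard : ℝ≥0∞)⁻¹ •
    Measure.sum fun P : postChangeLaws F 𝒢 E => (P : Measure (E → ℝ))

/-- The log-likelihood ratio of the mixture against the pre-change local distribution of `E`, at the
values of the sources in `E`. -/
def increment (F : Measure (Fin K → ℝ)) (𝒢 : Set (Measure (Fin K → ℝ)))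
    (E : Finset (Fin K)) (x : Fin K → ℝ) : ℝ :=
  llr (mixtureLaw F 𝒢 E) (localLaw F E) (E.restrict x)

/-- The units are the members of `U`, listed without repetition as `unit 0, …, unit (L - 1)`. -/
def Enumerates {L : ℕ} (unit : Fin L → Finset (Fin K)) (U : Set (Finset (Fin K))) : Prop :=
  Function.Injective unit ∧ Set.range unit = U

/-- The CUSUM-like statistic after `n` observations and the index of the unit that is sampled next.
After a nonpositive value of the statistic the next unit in cyclic order is sampled (addition in
`Fin L` is modulo `L`), otherwise the same unit again. -/
def roundRobinState (F : Measure (Fin K → ℝ)) (𝒢 : Set (Measure (Fin K → ℝ)))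
    {L : ℕ} [NeZero L] (unit : Fin L → Finset (Fin K)) (x : ℕ → Fin K → ℝ) : ℕ → ℝ × Fin L
  | 0 => (0, 0)
  | n + 1 =>
    let s := roundRobinState F 𝒢 unit x n
    let y := max s.1 0 + increment F 𝒢 (unit s.2) (x n)
    (y, if y ≤ 0 then s.2 + 1 else s.2)

/-- The Round Robin CUSUM policy with threshold `A`: the alarm is raised at the first time at which
the statistic is at least `A`. (What is sampled after the alarm is irrelevant.) -/
def roundRobin (Ξ : Type*) (F : Measure (Fin K → ℝ)) (𝒢 : Set (Measure (Fin K → ℝ)))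
    {L : ℕ} [NeZero L] (unit : Fin L → Finset (Fin K)) (A : ℝ) :
    SamplingRule Ξ K × AlarmTime Ξ K :=
  (fun n ω => unit (roundRobinState F 𝒢 unit ω.2 n).2,
   fun ω => ⨅ n : ℕ, ⨅ _ : 1 ≤ n ∧ A ≤ (roundRobinState F 𝒢 unit ω.2 n).1, (n : ℕ∞))

end RoundRobin

/-! ### Change in the correlation of Gaussian sources -/

/-- The centered Gaussian law on `ℝ^K` with covariance matrix `R`. -/
def gaussianLaw {K : ℕ} (R : Matrix (Fin K) (Fin K) ℝ) : Measure (Fin K → ℝ) :=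
  (multivariateGaussian 0 R).map WithLp.ofLp

/-- The correlation matrices other than the identity whose off-diagonal entries lie in `ℛ ∪ {0}`. -/
def correlationMatrices (K : ℕ) (ℛ : Set ℝ) : Set (Matrix (Fin K) (Fin K) ℝ) :=
  {R | R.PosSemidef ∧ (∀ i, R i i = 1) ∧ (∀ i j, i < j → R i j ∈ ℛ ∪ {0}) ∧ R ≠ 1}

/-- The post-change distributions without prior topological information. -/
def gaussianFamily (K : ℕ) (ℛ : Set ℝ) : Set (Measure (Fin K → ℝ)) :=
  gaussianLaw '' correlationMatrices K ℛ

/-- The post-change distributions when it is known that some pair of consecutive sources has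
correlation `ρ` after the change. -/
def consecutiveGaussianFamily (K : ℕ) (ρ : ℝ) : Set (Measure (Fin K → ℝ)) :=
  gaussianLaw ''
    {R | R ∈ correlationMatrices K {ρ} ∧ ∃ i j : Fin K, (i : ℕ) + 1 = j ∧ R i j = ρ}

/-- The pairs of consecutive sources. -/
def consecutivePairs (K : ℕ) : Set (Finset (Fin K)) :=
  {E | ∃ i j : Fin K, (i : ℕ) + 1 = j ∧ E = {i, j}}

end

end ActiveDetection

/-! For centred Gaussian sources with unit variances the law of a pair depends only on its
correlation, which here is `0` or `ρ`. Hence every pair is either unaffected or has one and the same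
post-change law, up to relabelling. The mixture is that single law, and all log-likelihood ratios
share one law `μ` before the change. With `I₀ = ∫ z e^z dμ`, the drift under the alternative, both
the optimal delay and the delay of the round robin policy are equivalent to `log γ / I₀`.

Lower bound (`eventually_le_delay`). If the mean time to a false alarm is at least `γ`, some window
of length `m ≈ c' log γ` has conditional false alarm probability at most `2m/γ` (`exists_window`).
Passing to the post-change law one observation at a time by Hölder's inequality
(`lintegral_le_of_observable`) costs a factor governed by `∫ e^{(1+s)z} dμ ≤ 1 + sI`, with `I`
slightly above `I₀`, whichever pair is sampled. When `c' I < 1`, an alarm in the window stays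
unlikely after a change at its beginning, so the delay is close to `m`.

False alarms (`roundRobin_mem_falseAlarmClass`). The exponential of an increment has mean one before
the change, whatever the unit. So `exp Y` grows in mean by at most the probability of no alarm at
each step, and the threshold `log γ` gives mean at least `γ`.

Upper bound (`eventually_delay_roundRobin_le`). A potential (`exists_potential`) bounds the
remaining time after the change by about `A / I₀`, plus a constant, plus a multiple of the statistic
if an unaffected unit is being sampled. A large statistic on an affected unit only helps, but on an
unaffected unit it must first be worked off. The delay is the worst case over the affected history,
which may say that no affected unit was sampled for an arbitrarily long time, and there is also
conditioning on no alarm. So the statistic must be shown to be `o(A)` in conditional mean, uniformly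
over such idle stretches.

This is the core of the proof (`eventually_iterate_idleOp_le`). Let `θ` minimize the moment
generating function of `μ` and let `m < 1` be the minimum. A Lyapunov function built on `e^{θY}`
shows that staying idle for `n` steps and ending above `εA/2` has probability at most about `m^n
e^{-θεA/2}` times the initial exponential. Conversely, a walk started at `x` survives in the strip
`(0, A)` for `k ≈ HA` steps with probability at least `m^k e^{θx - κA}`, with `κ` arbitrarily small
(`exists_le_stripSurvival`). The ratio tends to zero, and only the last `k` steps of a longer
stretch need to be compared. `setLIntegral_excess_le` transfers this to the affected history by
splitting at the last time an affected unit was sampled. -/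

namespace ActiveDetection

/-! ### The law of a log-likelihood ratio -/

/-- The law under the reference measure of a nondegenerate log-likelihood ratio between equivalent
probability measures, whose moment generating function is finite on a neighbourhood of `[0, 1]`. -/
structure IsLLRLaw (μ : Measure ℝ) : Prop where
  prob : IsProbabilityMeasure μ
  integral_exp : ∫ z, Real.exp z ∂μ = 1
  zero_mem : 0 ∈ interior (integrableExpSet id μ)
  one_mem : 1 ∈ interior (integrableExpSet id μ)
  nondegenerate : μ ≠ Measure.dirac 0

/-- The law of the log-likelihood ratio under the alternative measure. -/
noncomputable def expWeighted (μ : Measure ℝ) : Measure ℝ :=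
  μ.withDensity fun z => ENNReal.ofReal (Real.exp z)

namespace IsLLRLaw

variable {μ : Measure ℝ} (h : IsLLRLaw μ)
include h

lemma mem_interior {t : ℝ} (h0 : 0 ≤ t) (h1 : t ≤ 1) : t ∈ interior (integrableExpSet id μ) :=
  (convex_integrableExpSet.interior.ordConnected).out h.zero_mem h.one_mem ⟨h0, h1⟩

lemma integrable_pow_mul_exp {t : ℝ} (h0 : 0 ≤ t) (h1 : t ≤ 1) (n : ℕ) :
    Integrable (fun z => z ^ n * Real.exp (t * z)) μ := by
  simpa using integrable_pow_mul_exp_of_mem_interior_integrableExpSet (h.mem_interior h0 h1) n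

lemma integrable_exp_mul {t : ℝ} (h0 : 0 ≤ t) (h1 : t ≤ 1) :
    Integrable (fun z => Real.exp (t * z)) μ := by
  simpa using h.integrable_pow_mul_exp h0 h1 0

lemma integrable_mul_exp {t : ℝ} (h0 : 0 ≤ t) (h1 : t ≤ 1) :
    Integrable (fun z => z * Real.exp (t * z)) μ := by
  simpa using h.integrable_pow_mul_exp h0 h1 1

lemma integrable_id : Integrable (fun z : ℝ => z) μ := by
  simpa using h.integrable_mul_exp le_rfl zero_le_one

lemma integrable_exp : Integrable Real.exp μ := by
  simpa using h.integrable_exp_mul zero_le_one le_rfl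

lemma not_ae_eq_zero : ¬ ∀ᵐ z ∂μ, z = 0 := by
  intro h0
  have := h.prob
  apply h.nondegenerate
  have : μ.map id = μ.map (fun _ => (0 : ℝ)) := Measure.map_congr h0
  rwa [Measure.map_id, Measure.map_const, measure_univ, one_smul] at this

lemma integral_pos_of_nonneg {f : ℝ → ℝ} (hf : Integrable f μ) (h0 : ∀ z, 0 ≤ f z)
    (h1 : ∀ z, f z = 0 → z = 0) : 0 < ∫ z, f z ∂μ := by
  rw [lt_iff_le_and_ne]
  refine ⟨integral_nonneg h0, fun he => h.not_ae_eq_zero ?_⟩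
  have := (integral_eq_zero_iff_of_nonneg h0 hf).1 he.symm
  filter_upwards [this] with z hz using h1 z hz

lemma hasDerivAt_mgf {t : ℝ} (h0 : 0 ≤ t) (h1 : t ≤ 1) :
    HasDerivAt (mgf id μ) (∫ z, z * Real.exp (t * z) ∂μ) t := by
  simpa using ProbabilityTheory.hasDerivAt_mgf (h.mem_interior h0 h1)

lemma mgf_zero : mgf id μ 0 = 1 := by
  have := h.prob
  simp

lemma mgf_one : mgf id μ 1 = 1 := by
  simpa [mgf] using h.integral_exp

lemma mgf_pos (t : ℝ) (h0 : 0 ≤ t) (h1 : t ≤ 1) : 0 < mgf id μ t := by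
  have := h.prob
  have := h.integrable_exp_mul h0 h1
  exact ProbabilityTheory.mgf_pos this

/-- The function `e^z - 1 - z` is nonnegative and vanishes only at `0`, while `e^z` has mean one. -/
lemma integral_id_neg : ∫ z, z ∂μ < 0 := by
  have hp := h.prob
  have h1 : 0 < ∫ z, (Real.exp z - 1 - z) ∂μ := by
    apply h.integral_pos_of_nonneg
    · exact (h.integrable_exp.sub (integrable_const _)).sub h.integrable_id
    · intro z; linarith [Real.add_one_le_exp z]
    · intro z hz
      by_contra hne
      have := Real.add_one_lt_exp hne
      linarith
  have h2 : Integrable (fun z => Real.exp z - 1) μ := h.integrable_exp.sub (integrable_const _)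
  rw [integral_sub h2 h.integrable_id, integral_sub h.integrable_exp (integrable_const _),
    h.integral_exp] at h1
  simpa using h1

/-- Positivity of the information number: `1 - e^z + z e^z` is nonnegative and vanishes only at `0`.
-/
lemma integral_mul_exp_pos : 0 < ∫ z, z * Real.exp z ∂μ := by
  have hp := h.prob
  have hi : Integrable (fun z => z * Real.exp z) μ := by
    simpa using h.integrable_mul_exp zero_le_one le_rfl
  have h1 : 0 < ∫ z, (1 - Real.exp z + z * Real.exp z) ∂μ := by
    apply h.integral_pos_of_nonneg
    · exact ((integrable_const _).sub h.integrable_exp).add hi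
    · intro z
      have := mul_le_mul_of_nonneg_right (Real.add_one_le_exp (-z)) (Real.exp_pos z).le
      rw [← Real.exp_add] at this
      simp at this
      linarith
    · intro z hz
      by_contra hne
      have := mul_lt_mul_of_pos_right (Real.add_one_lt_exp (neg_ne_zero.2 hne)) (Real.exp_pos z)
      rw [← Real.exp_add] at this
      simp at this
      linarith
  have h2 : Integrable (fun z => 1 - Real.exp z) μ := (integrable_const _).sub h.integrable_exp
  rw [integral_add h2 hi, integral_sub (integrable_const _) h.integrable_exp,
    h.integral_exp] at h1
  simpa using h1

lemma strictMonoOn_integral_mul_exp :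
    StrictMonoOn (fun t => ∫ z, z * Real.exp (t * z) ∂μ) (Set.Icc 0 1) := by
  have hd : ∀ t ∈ Set.Icc (0 : ℝ) 1, HasDerivAt (fun t => ∫ z, z * Real.exp (t * z) ∂μ)
      (∫ z, z ^ 2 * Real.exp (t * z) ∂μ) t := by
    intro t ht
    simpa using hasDerivAt_integral_pow_mul_exp_real (h.mem_interior ht.1 ht.2) 1
  apply strictMonoOn_of_deriv_pos (convex_Icc 0 1)
  · exact fun t ht => (hd t ht).continuousAt.continuousWithinAt
  · intro t ht
    have ht' := interior_subset ht
    rw [(hd t ht').deriv]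
    apply h.integral_pos_of_nonneg (h.integrable_pow_mul_exp ht'.1 ht'.2 2)
    · intro z; positivity
    · intro z hz; simpa [(Real.exp_pos _).ne'] using hz

/-- The minimizer of the moment generating function. -/
lemma exists_minimizer : ∃ θ : ℝ, 0 < θ ∧ θ < 1 ∧ mgf id μ θ < 1 ∧
    (∫ z, z * Real.exp (θ * z) ∂μ = 0) ∧ (∀ t ∈ Set.Icc (0 : ℝ) 1, mgf id μ θ ≤ mgf id μ t) ∧
    ∀ t, 0 ≤ t → t < θ → ∫ z, z * Real.exp (t * z) ∂μ < 0 := by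
  have hcont : ContinuousOn (fun t => ∫ z, z * Real.exp (t * z) ∂μ) (Set.Icc 0 1) := by
    intro t ht
    have := (hasDerivAt_integral_pow_mul_exp_real (h.mem_interior ht.1 ht.2) 1)
    exact ContinuousAt.continuousWithinAt (by simpa using this.continuousAt)
  have h0 : ∫ z, z * Real.exp (0 * z) ∂μ < 0 := by simpa using h.integral_id_neg
  have h1 : 0 < ∫ z, z * Real.exp (1 * z) ∂μ := by simpa using h.integral_mul_exp_pos
  -- The derivative of the moment generating function is strictly increasing, negative at `0` and
  -- positive at `1`, so it has a unique zero `θ` strictly between.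
  obtain ⟨θ, hθ, hz⟩ := intermediate_value_Icc zero_le_one hcont ⟨h0.le, h1.le⟩
  simp only at hz
  have hθ0 : 0 < θ := by
    rcases hθ.1.eq_or_lt with he | hl
    · rw [← he] at hz; linarith
    · exact hl
  have hθ1 : θ < 1 := by
    rcases hθ.2.eq_or_lt with he | hl
    · rw [he] at hz; linarith
    · exact hl
  have hneg : ∀ t, 0 ≤ t → t < θ → ∫ z, z * Real.exp (t * z) ∂μ < 0 := by
    intro t ht htθ
    have := h.strictMonoOn_integral_mul_exp ⟨ht, (htθ.trans hθ1).le⟩ hθ htθ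
    simp only at this
    linarith
  have hpos : ∀ t, θ < t → t ≤ 1 → 0 < ∫ z, z * Real.exp (t * z) ∂μ := by
    intro t ht htθ
    have := h.strictMonoOn_integral_mul_exp hθ ⟨(hθ0.trans ht).le, htθ⟩ ht
    simp only at this
    linarith
  have hcm : ∀ t ∈ Set.Icc (0 : ℝ) 1, ContinuousAt (mgf id μ) t := fun t ht =>
    (h.hasDerivAt_mgf ht.1 ht.2).continuousAt
  have hanti : StrictAntiOn (mgf id μ) (Set.Icc 0 θ) := by
    apply strictAntiOn_of_deriv_neg (convex_Icc 0 θ)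
    · exact fun t ht => (hcm t ⟨ht.1, ht.2.trans hθ1.le⟩).continuousWithinAt
    · intro t ht
      rw [interior_Icc] at ht
      rw [(h.hasDerivAt_mgf ht.1.le (ht.2.trans hθ1).le).deriv]
      exact hneg t ht.1.le ht.2
  have hmono : StrictMonoOn (mgf id μ) (Set.Icc θ 1) := by
    apply strictMonoOn_of_deriv_pos (convex_Icc θ 1)
    · exact fun t ht => (hcm t ⟨hθ0.le.trans ht.1, ht.2⟩).continuousWithinAt
    · intro t ht
      rw [interior_Icc] at ht
      rw [(h.hasDerivAt_mgf (hθ0.trans ht.1).le ht.2.le).deriv]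
      exact hpos t ht.1 ht.2.le
  refine ⟨θ, hθ0, hθ1, ?_, hz, ?_, hneg⟩
  · rw [← h.mgf_zero]
    exact hanti ⟨le_rfl, hθ0.le⟩ ⟨hθ0.le, le_rfl⟩ hθ0
  · intro t ht
    rcases le_total t θ with hl | hl
    · exact hanti.antitoneOn ⟨ht.1, hl⟩ ⟨hθ0.le, le_rfl⟩ hl
    · exact hmono.monotoneOn ⟨le_rfl, hθ1.le⟩ ⟨hl, ht.2⟩ hl

/-- Both signs have positive mass at distances between `c` and `C` from `0`. -/
lemma exists_mass : ∃ c C q : ℝ, 0 < c ∧ c ≤ C ∧ 0 < q ∧ q ≤ 1 ∧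
    ENNReal.ofReal q ≤ μ (Set.Icc c C) ∧ ENNReal.ofReal q ≤ μ (Set.Icc (-C) (-c)) := by
  have hp := h.prob
  have hU : (⋃ n : ℕ, Set.Icc (1 / ((n : ℝ) + 1)) ((n : ℝ) + 1)) = Set.Ioi 0 := by
    ext x
    simp only [Set.mem_iUnion, Set.mem_Icc, Set.mem_Ioi]
    constructor
    · rintro ⟨n, h1, -⟩
      exact lt_of_lt_of_le (by positivity) h1
    · intro hx
      obtain ⟨n, hn⟩ := exists_nat_ge (max x (1 / x))
      refine ⟨n, ?_, by linarith [le_max_left x (1 / x)]⟩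
      rw [one_div_le (by positivity) hx]
      linarith [le_max_right x (1 / x)]
  have hU' : (⋃ n : ℕ, Set.Icc (-((n : ℝ) + 1)) (-(1 / ((n : ℝ) + 1)))) = Set.Iio 0 := by
    ext x
    have := Set.ext_iff.1 hU (-x)
    simp only [Set.mem_iUnion, Set.mem_Icc, Set.mem_Ioi, Set.mem_Iio] at this ⊢
    rw [← neg_pos, ← this]
    exact exists_congr fun n => ⟨fun ⟨a, b⟩ => ⟨by linarith, by linarith⟩,
      fun ⟨a, b⟩ => ⟨by linarith, by linarith⟩⟩
  -- Without mass on the positive half-line the drift under the alternative could not be positive.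
  -- Likewise the negative drift under the reference measure needs negative mass.
  have hpos : μ (Set.Ioi 0) ≠ 0 := by
    intro h0
    have h1 : ∀ᵐ z ∂μ, ¬ (0 < z) := measure_eq_zero_iff_ae_notMem.1 h0
    have h2 : ∫ z, z * Real.exp z ∂μ ≤ 0 := by
      apply integral_nonpos_of_ae
      filter_upwards [h1] with z hz
      exact mul_nonpos_of_nonpos_of_nonneg (not_lt.1 hz) (Real.exp_pos z).le
    linarith [h.integral_mul_exp_pos]
  have hneg : μ (Set.Iio 0) ≠ 0 := by
    intro h0
    have h1 : ∀ᵐ z ∂μ, ¬ (z < 0) := measure_eq_zero_iff_ae_notMem.1 h0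
    have h2 : 0 ≤ ∫ z, z ∂μ := by
      apply integral_nonneg_of_ae
      filter_upwards [h1] with z hz using not_lt.1 hz
    linarith [h.integral_id_neg]
  rw [← hU, Ne, measure_iUnion_null_iff, not_forall] at hpos
  rw [← hU', Ne, measure_iUnion_null_iff, not_forall] at hneg
  obtain ⟨n, hn⟩ := hpos
  obtain ⟨k, hk⟩ := hneg
  rw [← Ne, ← pos_iff_ne_zero] at hn hk
  set c : ℝ := min (1 / ((n : ℝ) + 1)) (1 / ((k : ℝ) + 1))
  set C : ℝ := max ((n : ℝ) + 1) ((k : ℝ) + 1)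
  have hc1 : c ≤ 1 := (min_le_left _ _).trans (by
    rw [div_le_one (by positivity)]; linarith [Nat.cast_nonneg (α := ℝ) n])
  have hC1 : 1 ≤ C := le_trans (by linarith [Nat.cast_nonneg (α := ℝ) n]) (le_max_left _ _)
  have h1 : μ (Set.Icc (1 / ((n : ℝ) + 1)) ((n : ℝ) + 1)) ≤ μ (Set.Icc c C) :=
    measure_mono (Set.Icc_subset_Icc (min_le_left _ _) (le_max_left _ _))
  have h2 : μ (Set.Icc (-((k : ℝ) + 1)) (-(1 / ((k : ℝ) + 1)))) ≤ μ (Set.Icc (-C) (-c)) :=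
    measure_mono (Set.Icc_subset_Icc (neg_le_neg (le_max_right _ _))
      (neg_le_neg (min_le_right _ _)))
  have h1' := hn.trans_le h1
  have h2' := hk.trans_le h2
  refine ⟨c, C, min (μ (Set.Icc c C)).toReal (μ (Set.Icc (-C) (-c))).toReal, by positivity,
    hc1.trans hC1, ?_, ?_, ?_, ?_⟩
  · exact lt_min (ENNReal.toReal_pos h1'.ne' (measure_ne_top _ _))
      (ENNReal.toReal_pos h2'.ne' (measure_ne_top _ _))
  · exact (min_le_left _ _).trans (ENNReal.toReal_le_of_le_ofReal zero_le_one
      (by simpa using prob_le_one))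
  · exact ENNReal.ofReal_le_of_le_toReal (min_le_left _ _)
  · exact ENNReal.ofReal_le_of_le_toReal (min_le_right _ _)

/-- The drift under the alternative is approximated by truncation from above. -/
lemma exists_truncation_mul_exp {I : ℝ} (hI : I < ∫ z, z * Real.exp z ∂μ) :
    ∃ c : ℝ, 0 < c ∧ I < ∫ z, min z c * Real.exp z ∂μ := by
  have hi : Integrable (fun z => z * Real.exp z) μ := by
    simpa using h.integrable_mul_exp zero_le_one le_rfl
  have : Tendsto (fun n : ℕ => ∫ z, min z n * Real.exp z ∂μ) atTop
      (𝓝 (∫ z, z * Real.exp z ∂μ)) := by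
    apply tendsto_integral_of_dominated_convergence _ _ hi.abs
    · intro n
      filter_upwards with z
      rw [Real.norm_eq_abs, abs_mul, abs_mul]
      refine mul_le_mul_of_nonneg_right ?_ (abs_nonneg _)
      rw [abs_le]
      constructor
      · exact le_min (neg_abs_le z) ((neg_nonpos.2 (abs_nonneg z)).trans (Nat.cast_nonneg n))
      · exact (min_le_left _ _).trans (le_abs_self z)
    · filter_upwards with z
      apply tendsto_const_nhds.congr'
      obtain ⟨N, hN⟩ := exists_nat_ge z
      filter_upwards [eventually_ge_atTop N] with n hn
      rw [min_eq_left (hN.trans (by exact_mod_cast hn))]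
    · intro n; fun_prop
  obtain ⟨n, hn, hn'⟩ := ((this.eventually (lt_mem_nhds hI)).and (eventually_gt_atTop 0)).exists
  exact ⟨n, by exact_mod_cast hn', hn⟩

/-- The drift under the reference measure is approximated by truncation from below. -/
lemma exists_truncation_neg : ∃ c : ℝ, 0 < c ∧ ∫ z, max z (-c) ∂μ < 0 := by
  have : Tendsto (fun n : ℕ => ∫ z, max z (-(n : ℝ)) ∂μ) atTop (𝓝 (∫ z, z ∂μ)) := by
    apply tendsto_integral_of_dominated_convergence _ _ h.integrable_id.abs
    · intro n
      filter_upwards with z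
      rw [Real.norm_eq_abs, abs_le]
      constructor
      · exact (neg_abs_le z).trans (le_max_left _ _)
      · exact max_le (le_abs_self z)
          ((neg_nonpos.2 (Nat.cast_nonneg n)).trans (abs_nonneg z))
    · filter_upwards with z
      apply tendsto_const_nhds.congr'
      obtain ⟨N, hN⟩ := exists_nat_ge (-z)
      filter_upwards [eventually_ge_atTop N] with n hn
      rw [max_eq_left]
      have : (N : ℝ) ≤ n := by exact_mod_cast hn
      linarith
    · intro n; fun_prop
  obtain ⟨n, hn, hn'⟩ := ((this.eventually (gt_mem_nhds h.integral_id_neg)).and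
    (eventually_gt_atTop 0)).exists
  exact ⟨n, by exact_mod_cast hn', hn⟩

/-- The moment generating function just beyond `1`. -/
lemma exists_mgf_le {I : ℝ} (hI : ∫ z, z * Real.exp z ∂μ < I) :
    ∃ s : ℝ, 0 < s ∧ mgf id μ (1 + s) ≤ 1 + s * I ∧
      Integrable (fun z => Real.exp ((1 + s) * z)) μ := by
  have hd := h.hasDerivAt_mgf zero_le_one le_rfl
  simp only [one_mul] at hd
  have h1 := hd.tendsto_slope_zero_right
  have h2 := h1.eventually (gt_mem_nhds hI)
  have h3 : ∀ᶠ t in 𝓝 (1 : ℝ), t ∈ interior (integrableExpSet id μ) :=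
    isOpen_interior.eventually_mem h.one_mem
  have h4 : Tendsto (fun s : ℝ => 1 + s) (𝓝[>] 0) (𝓝 1) := by
    have : Tendsto (fun s : ℝ => 1 + s) (𝓝 0) (𝓝 (1 + 0)) :=
      (continuous_const.add continuous_id).tendsto 0
    rw [add_zero] at this
    exact this.mono_left nhdsWithin_le_nhds
  obtain ⟨s, ⟨hs1, hs2⟩, hs3⟩ := ((h2.and (h4.eventually h3)).and self_mem_nhdsWithin).exists
  have hs : 0 < s := hs3
  refine ⟨s, hs, ?_, ?_⟩
  · rw [smul_eq_mul, h.mgf_one, inv_mul_lt_iff₀ hs] at hs1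
    linarith
  · simpa [integrableExpSet] using interior_subset hs2

end IsLLRLaw


/-! ### Survival of a random walk in a strip -/

/-- The probability that the random walk with step law `μ` started at `x` stays in `(0, A)` during
the next `n` steps. -/
noncomputable def stripSurvival (μ : Measure ℝ) (A : ℝ) : ℕ → ℝ → ℝ≥0∞
  | 0, _ => 1
  | n + 1, x => ∫⁻ z, (if 0 < x + z ∧ x + z < A then stripSurvival μ A n (x + z) else 0) ∂μ

lemma ofReal_integral_le_lintegral {α : Type*} [MeasurableSpace α] {μ : Measure α} {f : α → ℝ}
    (hf : Integrable f μ) : ENNReal.ofReal (∫ x, f x ∂μ) ≤ ∫⁻ x, ENNReal.ofReal (f x) ∂μ := by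
  rw [integral_eq_lintegral_pos_part_sub_lintegral_neg_part hf]
  refine (ENNReal.ofReal_le_ofReal (sub_le_self _ ENNReal.toReal_nonneg)).trans ?_
  exact ENNReal.ofReal_toReal_le

/-- Forcing `n` consecutive steps into `[c, C]` costs `q ^ n` and moves the walk up by an amount
between `n c` and `n C`. This steers a start near `0` into the interior of the strip. -/
lemma mul_pow_le_stripSurvival_of_mass_pos {μ : Measure ℝ} {A c C q β : ℝ} (hc : 0 < c)
    (hq : 0 ≤ q) (hβ : 0 ≤ β) (hμ : ENNReal.ofReal q ≤ μ (Set.Icc c C)) (k n : ℕ) :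
    ∀ x, 0 ≤ x → x + n * C < A →
      (∀ y, x + n * c ≤ y → y ≤ x + n * C → ENNReal.ofReal β ≤ stripSurvival μ A k y) →
      ENNReal.ofReal (q ^ n * β) ≤ stripSurvival μ A (n + k) x := by
  induction n with
  | zero =>
    intro x hx _ h
    simpa using h x (by simp) (by simp)
  | succ n ih =>
    intro x hx hA h
    push_cast at hA h
    rw [show n + 1 + k = (n + k) + 1 by omega, stripSurvival]
    calc ENNReal.ofReal (q ^ (n + 1) * β)
        = ENNReal.ofReal (q ^ n * β) * ENNReal.ofReal q := by
          rw [← ENNReal.ofReal_mul (by positivity)]; congr 1; ring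
      _ ≤ ENNReal.ofReal (q ^ n * β) * μ (Set.Icc c C) := by gcongr
      _ = ∫⁻ z in Set.Icc c C, ENNReal.ofReal (q ^ n * β) ∂μ := by rw [setLIntegral_const]
      _ ≤ ∫⁻ z in Set.Icc c C, (if 0 < x + z ∧ x + z < A then stripSurvival μ A (n + k) (x + z)
            else 0) ∂μ := by
          refine setLIntegral_mono' measurableSet_Icc fun z hz => ?_
          have h1 : x + z + n * C < A := by linarith [hz.2]
          have hC : 0 ≤ C := hc.le.trans (hz.1.trans hz.2)
          have h2 : 0 ≤ n * C := by positivity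
          rw [if_pos ⟨by linarith [hz.1], by linarith⟩]
          refine ih (x + z) (by linarith [hz.1]) h1 fun y hy1 hy2 => h y ?_ ?_
          · linarith [hz.1]
          · linarith [hz.2]
      _ ≤ _ := setLIntegral_le_lintegral _ _

/-- The downward counterpart, for starts near the upper boundary. -/
lemma mul_pow_le_stripSurvival_of_mass_neg {μ : Measure ℝ} {A c C q β : ℝ} (hc : 0 < c)
    (hq : 0 ≤ q) (hβ : 0 ≤ β) (hμ : ENNReal.ofReal q ≤ μ (Set.Icc (-C) (-c))) (k n : ℕ) :
    ∀ x, x < A → 0 < x - n * C →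
      (∀ y, x - n * C ≤ y → y ≤ x - n * c → ENNReal.ofReal β ≤ stripSurvival μ A k y) →
      ENNReal.ofReal (q ^ n * β) ≤ stripSurvival μ A (n + k) x := by
  induction n with
  | zero =>
    intro x hx _ h
    simpa using h x (by simp) (by simp)
  | succ n ih =>
    intro x hx hA h
    push_cast at hA h
    rw [show n + 1 + k = (n + k) + 1 by omega, stripSurvival]
    calc ENNReal.ofReal (q ^ (n + 1) * β)
        = ENNReal.ofReal (q ^ n * β) * ENNReal.ofReal q := by
          rw [← ENNReal.ofReal_mul (by positivity)]; congr 1; ring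
      _ ≤ ENNReal.ofReal (q ^ n * β) * μ (Set.Icc (-C) (-c)) := by gcongr
      _ = ∫⁻ z in Set.Icc (-C) (-c), ENNReal.ofReal (q ^ n * β) ∂μ := by rw [setLIntegral_const]
      _ ≤ ∫⁻ z in Set.Icc (-C) (-c), (if 0 < x + z ∧ x + z < A then
            stripSurvival μ A (n + k) (x + z) else 0) ∂μ := by
          refine setLIntegral_mono' measurableSet_Icc fun z hz => ?_
          have h1 : 0 < x + z - n * C := by linarith [hz.1]
          have hC : 0 ≤ C := by linarith [hz.1, hz.2]
          have h2 : 0 ≤ n * C := by positivity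
          rw [if_pos ⟨by linarith [hz.1], by linarith [hz.2]⟩]
          refine ih (x + z) (by linarith [hz.2]) h1 fun y hy1 hy2 => h y ?_ ?_
          · linarith [hz.1]
          · linarith [hz.2]
      _ ≤ _ := setLIntegral_le_lintegral _ _

/-- The exponentially tilted walk follows its drift line up to distance `w`. -/
lemma parabola_le_stripSurvival {μ : Measure ℝ} {A t v s w β : ℝ} (ht : 0 ≤ t) (hw : 0 < w)
    (hs : 0 ≤ s) (hβ : 0 ≤ β) (hi : ∀ n : ℕ, Integrable (fun z => z ^ n * Real.exp (t * z)) μ)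
    (hv : ∫ z, z * Real.exp (t * z) ∂μ = v * mgf id μ t)
    (hsv : ∫ z, z ^ 2 * Real.exp (t * z) ∂μ = (s + v ^ 2) * mgf id μ t) (k n : ℕ) :
    ∀ l x, (∀ y, |y - (l + n * v)| < w → ENNReal.ofReal β ≤ stripSurvival μ A k y) →
      (∀ i : ℕ, 1 ≤ i → i ≤ n → 0 ≤ l + i * v - w ∧ l + i * v + w ≤ A) →
      ENNReal.ofReal (β * mgf id μ t ^ n * Real.exp (t * (x - (l + n * v) - w)) *
        (1 - ((x - l) / w) ^ 2 - n * s / w ^ 2)) ≤ stripSurvival μ A (n + k) x := by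
  induction n with
  | zero =>
    intro l x h _
    simp only [Nat.cast_zero, zero_mul, add_zero, pow_zero, mul_one, zero_div, sub_zero,
      zero_add] at h ⊢
    rcases lt_or_ge |x - l| w with hx | hx
    · refine le_trans (ENNReal.ofReal_le_ofReal ?_) (h x hx)
      have h1 : Real.exp (t * (x - l - w)) ≤ 1 := by
        rw [Real.exp_le_one_iff]
        exact mul_nonpos_of_nonneg_of_nonpos ht (by linarith [(abs_lt.1 hx).2])
      have h2 : 1 - ((x - l) / w) ^ 2 ≤ 1 := by linarith [sq_nonneg ((x - l) / w)]
      calc β * Real.exp (t * (x - l - w)) * (1 - ((x - l) / w) ^ 2)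
          ≤ β * Real.exp (t * (x - l - w)) * 1 := by gcongr
        _ ≤ β * 1 * 1 := by gcongr
        _ = β := by ring
    · rw [ENNReal.ofReal_of_nonpos]
      · simp
      · apply mul_nonpos_of_nonneg_of_nonpos (by positivity)
        have : 1 ≤ ((x - l) / w) ^ 2 := by
          rw [div_pow, one_le_div (by positivity), ← sq_abs (x - l)]
          gcongr
        linarith
  | succ n ih =>
    intro l x h hb
    have hM : 0 ≤ mgf id μ t := mgf_nonneg
    rw [show n + 1 + k = (n + k) + 1 by omega, stripSurvival]
    set D : ℝ := β * mgf id μ t ^ n * Real.exp (t * (x - (l + (n + 1) * v) - w)) with hD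
    set d : ℝ := x - l - v with hd
    have hi0 : Integrable (fun z => Real.exp (t * z)) μ := by simpa using hi 0
    have hi1 : Integrable (fun z => z * Real.exp (t * z)) μ := by simpa using hi 1
    have hint : Integrable (fun z => D * ((1 - d ^ 2 / w ^ 2 - n * s / w ^ 2) * Real.exp (t * z)
        - 2 * d / w ^ 2 * (z * Real.exp (t * z)) - 1 / w ^ 2 * (z ^ 2 * Real.exp (t * z)))) μ :=
      ((((hi0.const_mul _).sub (hi1.const_mul _)).sub ((hi 2).const_mul _)).const_mul _)
    have heq : β * mgf id μ t ^ (n + 1) * Real.exp (t * (x - (l + (n + 1 : ℕ) * v) - w)) *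
        (1 - ((x - l) / w) ^ 2 - (n + 1 : ℕ) * s / w ^ 2) =
        ∫ z, D * ((1 - d ^ 2 / w ^ 2 - n * s / w ^ 2) * Real.exp (t * z)
        - 2 * d / w ^ 2 * (z * Real.exp (t * z)) - 1 / w ^ 2 * (z ^ 2 * Real.exp (t * z))) ∂μ := by
      have hi01 : Integrable (fun z => (1 - d ^ 2 / w ^ 2 - n * s / w ^ 2) * Real.exp (t * z)
        - 2 * d / w ^ 2 * (z * Real.exp (t * z))) μ := (hi0.const_mul _).sub (hi1.const_mul _)
      rw [integral_const_mul, integral_sub hi01 ((hi 2).const_mul _),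
        integral_sub (hi0.const_mul _) (hi1.const_mul _), integral_const_mul, integral_const_mul,
        integral_const_mul, hv, hsv, show ∫ z, Real.exp (t * z) ∂μ = mgf id μ t from rfl, hD, hd]
      push_cast
      field_simp
      ring
    rw [heq]
    refine (ofReal_integral_le_lintegral hint).trans (lintegral_mono fun z => ?_)
    have hz : D * ((1 - d ^ 2 / w ^ 2 - n * s / w ^ 2) * Real.exp (t * z)
        - 2 * d / w ^ 2 * (z * Real.exp (t * z)) - 1 / w ^ 2 * (z ^ 2 * Real.exp (t * z))) =
        β * mgf id μ t ^ n * Real.exp (t * (x + z - (l + v + n * v) - w)) *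
        (1 - ((x + z - (l + v)) / w) ^ 2 - n * s / w ^ 2) := by
      rw [hD, hd, show t * (x + z - (l + v + n * v) - w) =
        t * (x - (l + (n + 1) * v) - w) + t * z by ring, Real.exp_add]
      field_simp
      ring
    rw [hz]
    -- Inside the tube of radius `w` the strip condition holds and the induction applies. Outside it
    -- the parabola is nonpositive, so nothing has to be proved about those paths.
    rcases lt_or_ge |x + z - (l + v)| w with hx | hx
    · have hb1 := hb 1 le_rfl (by omega)
      rw [abs_lt] at hx
      push_cast at hb1
      rw [if_pos ⟨by linarith, by linarith⟩]
      refine ih (l + v) (x + z) (fun y hy => h y ?_) fun i hi1 hi2 => ?_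
      · convert hy using 2
        push_cast
        ring
      · have := hb (i + 1) (by omega) (by omega)
        push_cast at this
        constructor <;> linarith
    · rw [ENNReal.ofReal_of_nonpos]
      · exact zero_le
      · apply mul_nonpos_of_nonneg_of_nonpos (by positivity)
        have : 1 ≤ ((x + z - (l + v)) / w) ^ 2 := by
          rw [div_pow, one_le_div (by positivity), ← sq_abs (x + z - (l + v))]
          gcongr
        have : 0 ≤ n * s / w ^ 2 := by positivity
        linarith


/-- Here `v` and `s` are the mean and the variance of the tilted law with density proportional to
`e^{tz}`; nonnegativity of `s` is that of a centred second moment. -/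
lemma IsLLRLaw.exists_tilted_moments {μ : Measure ℝ} (h : IsLLRLaw μ) {t : ℝ} (h0 : 0 ≤ t)
    (h1 : t ≤ 1) : ∃ v s : ℝ, 0 ≤ s ∧ ∫ z, z * Real.exp (t * z) ∂μ = v * mgf id μ t ∧
      ∫ z, z ^ 2 * Real.exp (t * z) ∂μ = (s + v ^ 2) * mgf id μ t := by
  have hM := h.mgf_pos t h0 h1
  have hi0 := h.integrable_exp_mul h0 h1
  have hi1 := h.integrable_mul_exp h0 h1
  have hi2 := h.integrable_pow_mul_exp h0 h1 2
  set M := mgf id μ t with hMdef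
  set a := ∫ z, z * Real.exp (t * z) ∂μ with ha
  set b := ∫ z, z ^ 2 * Real.exp (t * z) ∂μ with hb
  refine ⟨a / M, b / M - (a / M) ^ 2, ?_, by field_simp, by field_simp; ring⟩
  have hn : 0 ≤ ∫ z, (z - a / M) ^ 2 * Real.exp (t * z) ∂μ :=
    integral_nonneg fun z => by positivity
  have he : ∀ p : ℝ, ∫ z, (z - p) ^ 2 * Real.exp (t * z) ∂μ = b - 2 * p * a + p ^ 2 * M := by
    intro p
    have hi01 : Integrable (fun z => z ^ 2 * Real.exp (t * z) - 2 * p *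
      (z * Real.exp (t * z))) μ := hi2.sub (hi1.const_mul _)
    rw [hMdef, hb, ha, show mgf id μ t = ∫ z, Real.exp (t * z) ∂μ from rfl, ← integral_const_mul,
      ← integral_const_mul, ← integral_sub hi2 (hi1.const_mul _),
      ← integral_add hi01 (hi0.const_mul _)]
    congr 1
    ext z
    ring
  rw [he] at hn
  have : b / M - (a / M) ^ 2 = (b - 2 * (a / M) * a + (a / M) ^ 2 * M) / M := by
    field_simp; ring
  rw [this]
  positivity

/-! ### Holding, descending and steering a walk inside the strip -/

section Phases

variable {μ : Measure ℝ} (h : IsLLRLaw μ)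
include h

/-- A walk without tilted drift can be held in a strip. -/
lemma hold_le_stripSurvival {θ s : ℝ} (h0 : 0 ≤ θ) (h1 : θ ≤ 1)
    (hz : ∫ z, z * Real.exp (θ * z) ∂μ = 0) (hs : 0 ≤ s)
    (hsv : ∫ z, z ^ 2 * Real.exp (θ * z) ∂μ = s * mgf id μ θ) {A b r : ℝ} (hb : 0 < b)
    (hA : 4 * b ≤ A) (hr : 0 < r) (n : ℕ) (hn : n * s ≤ r / 2 * (2 * b) ^ 2) {x : ℝ}
    (hx1 : r * (2 * b) ≤ x) (hx2 : x ≤ 2 * b) :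
    ENNReal.ofReal (mgf id μ θ ^ n * Real.exp (-(4 * θ * b)) * (r / 2)) ≤
      stripSurvival μ A n x := by
  have hM := h.mgf_pos θ h0 h1
  -- With zero drift the centre stays at `2b`, and the tube of radius `2b` is `(0, 4b)`.
  have := parabola_le_stripSurvival (A := A) (w := 2 * b) (β := 1) (v := 0) h0 (by linarith) hs
    zero_le_one (h.integrable_pow_mul_exp h0 h1) (by simpa using hz) (by simpa using hsv) 0 n
    (2 * b) x (fun y _ => by simp [stripSurvival])
    (fun i _ _ => ⟨by simp, by linarith⟩)
  refine le_trans (ENNReal.ofReal_le_ofReal ?_) this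
  have hx : 0 ≤ x := le_trans (by positivity) hx1
  rw [one_mul]
  have hu : r ≤ x / (2 * b) := by rwa [le_div_iff₀ (by linarith)]
  have hu' : x / (2 * b) ≤ 1 := by rwa [div_le_one (by linarith)]
  have e1 : (x - 2 * b) / (2 * b) = x / (2 * b) - 1 := by field_simp
  have e2 : n * s / (2 * b) ^ 2 ≤ r / 2 := by rwa [div_le_iff₀ (by positivity)]
  -- With `u = x / (2b)` in `[r, 1]`, `1 - (u - 1)² = u (2 - u) ≥ r`; the accumulated variance takes
  -- away at most `r / 2`.
  have e3 : r / 2 ≤ 1 - ((x - 2 * b) / (2 * b)) ^ 2 - n * s / (2 * b) ^ 2 := by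
    rw [e1]
    nlinarith
  have e4 : Real.exp (-(4 * θ * b)) ≤ Real.exp (θ * (x - (2 * b + n * 0) - 2 * b)) := by
    rw [Real.exp_le_exp]
    nlinarith
  gcongr

/-- A walk with negative tilted drift descends to a low level. -/
lemma descend_le_stripSurvival {t v s : ℝ} (h0 : 0 ≤ t) (h1 : t ≤ 1) (hv0 : 0 < v)
    (hv : ∫ z, z * Real.exp (t * z) ∂μ = -v * mgf id μ t) (hs : 0 ≤ s)
    (hsv : ∫ z, z ^ 2 * Real.exp (t * z) ∂μ = (s + v ^ 2) * mgf id μ t) {A a β : ℝ} (ha : 0 < a)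
    (hva : v ≤ a / 2) (hβ : 0 ≤ β) (k : ℕ) {x : ℝ} (hx1 : a ≤ x) (hx2 : x ≤ A - a)
    (hn : (A / v) * s ≤ 1 / 2 * (a / 2) ^ 2)
    (hk : ∀ y, a / 2 ≤ y → y ≤ 2 * a → ENNReal.ofReal β ≤ stripSurvival μ A k y) :
    ENNReal.ofReal (β * mgf id μ t ^ ⌊(x - a) / v⌋₊ * Real.exp (t * (x - 2 * a)) * (1 / 2)) ≤
      stripSurvival μ A (⌊(x - a) / v⌋₊ + k) x := by
  have hM := h.mgf_pos t h0 h1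
  set n := ⌊(x - a) / v⌋₊ with hndef
  have hnl : (n : ℝ) * v ≤ x - a := by
    rw [← le_div_iff₀ hv0]
    exact Nat.floor_le (div_nonneg (by linarith) hv0.le)
  have hnu : x - a < (n + 1) * v := by
    rw [← div_lt_iff₀ hv0]
    exact Nat.lt_floor_add_one _
  -- The tube is centred at the start itself, so only the variance term reduces the parabola. After
  -- `n` steps its centre lies in `[a, a + v)`, hence the walk ends within `[a/2, 2a]`.
  have := parabola_le_stripSurvival (A := A) (w := a / 2) (β := β) (v := -v) h0 (by linarith) hs
    hβ (h.integrable_pow_mul_exp h0 h1) hv (by rw [hsv]; ring) k n x x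
    (fun y hy => by
      rw [abs_lt] at hy
      exact hk y (by linarith) (by linarith))
    (fun i _ hin => by
      have : (i : ℝ) * v ≤ n * v := by gcongr
      have : 0 ≤ (i : ℝ) * v := by positivity
      constructor <;> linarith)
  refine le_trans (ENNReal.ofReal_le_ofReal ?_) this
  have e1 : (n : ℝ) ≤ A / v := by
    rw [le_div_iff₀ hv0]; linarith
  have e2 : n * s / (a / 2) ^ 2 ≤ 1 / 2 := by
    rw [div_le_iff₀ (by positivity)]
    exact le_trans (by gcongr) hn
  have e3 : 1 / 2 ≤ 1 - ((x - x) / (a / 2)) ^ 2 - n * s / (a / 2) ^ 2 := by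
    rw [sub_self, zero_div]; linarith
  have e4 : Real.exp (t * (x - 2 * a)) ≤ Real.exp (t * (x - (x + n * -v) - a / 2)) := by
    rw [Real.exp_le_exp]
    apply mul_le_mul_of_nonneg_left _ h0
    linarith
  gcongr

set_option maxHeartbeats 800000 in
/-- The decay rate of the survival probability, up to an exponentially small correction. -/
lemma exists_le_stripSurvival {θ : ℝ} (h0 : 0 < θ) (h1 : θ < 1)
    (hz : ∫ z, z * Real.exp (θ * z) ∂μ = 0)
    (hmin : ∀ t ∈ Set.Icc (0 : ℝ) 1, mgf id μ θ ≤ mgf id μ t) (hlt : mgf id μ θ < 1)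
    (hneg : ∀ t, 0 ≤ t → t < θ → ∫ z, z * Real.exp (t * z) ∂μ < 0) {κ : ℝ} (hκ : 0 < κ) :
    ∃ H : ℝ, 0 < H ∧ ∀ᶠ A in atTop,
      (∀ x, 0 ≤ x → x < A → ENNReal.ofReal (mgf id μ θ ^ ⌈H * A⌉₊ * Real.exp (θ * x - κ * A)) ≤
        stripSurvival μ A ⌈H * A⌉₊ x) ∧
      ∀ n ≤ ⌈H * A⌉₊, ENNReal.ofReal (mgf id μ θ ^ n * Real.exp (-(κ * A))) ≤
        stripSurvival μ A n 0 := by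
  obtain ⟨c, C, q, hc, hcC, hq, hq1, hqp, hqn⟩ := h.exists_mass
  have hC : 0 < C := hc.trans_le hcC
  set m := mgf id μ θ with hm
  have hm0 : 0 < m := h.mgf_pos θ h0.le h1.le
  obtain ⟨v, s, hs, hv, hsv⟩ := h.exists_tilted_moments h0.le h1.le
  have hv0 : v = 0 := by
    rw [hz] at hv
    exact (mul_eq_zero.1 hv.symm).resolve_right hm0.ne'
  subst hv0
  simp only [ne_eq, OfNat.ofNat_ne_zero, not_false_eq_true, zero_pow, add_zero] at hsv
  -- A tilt slightly below `θ` has negative drift and carries the walk down from any height in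
  -- linear time. Using `t` in place of `θ` loses at most `(θ - t) A ≤ κA/4` in the exponent.
  obtain ⟨t, ht0, htθ, htκ⟩ : ∃ t, 0 ≤ t ∧ t < θ ∧ θ - t ≤ κ / 4 := by
    refine ⟨max 0 (θ - κ / 4), le_max_left _ _, max_lt h0 (by linarith), ?_⟩
    linarith [le_max_right 0 (θ - κ / 4)]
  have ht1 : t ≤ 1 := (htθ.trans h1).le
  obtain ⟨v', s', hs', hv', hsv'⟩ := h.exists_tilted_moments ht0 ht1
  have hMt := h.mgf_pos t ht0 ht1
  have hmt : m ≤ mgf id μ t := hmin t ⟨ht0, ht1⟩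
  have hv'0 : 0 < -v' := by
    have := hneg t ht0 htθ
    rw [hv'] at this
    nlinarith
  obtain ⟨v, rfl⟩ : ∃ v, v' = -v := ⟨-v', by ring⟩
  rw [neg_neg] at hv'0
  rw [neg_sq] at hsv'
  -- The total exponential price per forced step: `log (1/q)` for its probability, and `7θC` for the
  -- displacements of size up to `b = N C` in the phases that follow.
  set lam := Real.log (1 / q) + 7 * θ * C with hlam
  have hlam0 : 0 < lam := by
    have : 0 ≤ Real.log (1 / q) := Real.log_nonneg (by rw [le_div_iff₀ hq]; linarith)
    positivity
  -- The first bound keeps the price of about `ηA` forced steps below `κA/4`; the second makes `4b ≤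
  -- A`.
  set η := min (κ / (4 * lam)) (1 / (8 * C)) with hη
  have hη0 : 0 < η := by positivity
  have hη1 : η * lam ≤ κ / 4 := by
    calc η * lam ≤ κ / (4 * lam) * lam := by gcongr; exact min_le_left _ _
      _ = κ / 4 := by field_simp
  have hη2 : C * η ≤ 1 / 8 := by
    calc C * η ≤ C * (1 / (8 * C)) := by gcongr; exact min_le_right _ _
      _ = 1 / 8 := by field_simp
  set r := c / (4 * C) with hr
  have hr0 : 0 < r := by positivity
  have hr1 : r ≤ 1 := by
    rw [hr, div_le_one (by positivity)]; linarith
  -- Time for a descent at speed `v` from at most `A`, for the forced steps, and a reserve of length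
  -- `A` that absorbs rounding. The rest is spent holding near the bottom.
  set H := 1 / v + η + 1 with hH
  have hH0 : 0 < H := by positivity
  clear_value lam η r H
  refine ⟨H, hH0, ?_⟩
  filter_upwards [eventually_ge_atTop 1, eventually_ge_atTop (8 * C),
    eventually_ge_atTop ((H + 1) * s / (2 * r * (C * η) ^ 2)),
    eventually_ge_atTop (8 * (s' / v) / (c * η) ^ 2), eventually_ge_atTop (2 * v / (c * η)),
    eventually_ge_atTop ((Real.log (4 / r) + lam) / (κ / 2))] with A hA1 hA2 hA3 hA4 hA5 hA6
  have hA0 : 0 < A := by linarith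
  set N := ⌈η * A⌉₊ with hN
  have hNl : η * A ≤ N := Nat.le_ceil _
  have hNu : (N : ℝ) ≤ η * A + 1 := (Nat.ceil_lt_add_one (by positivity)).le
  set k := ⌈H * A⌉₊ with hk
  have hkl : H * A ≤ k := Nat.le_ceil _
  have hku : (k : ℝ) ≤ (H + 1) * A := by
    have : (k : ℝ) ≤ H * A + 1 := (Nat.ceil_lt_add_one (by positivity)).le
    linarith
  clear_value N k
  have hN0 : (0 : ℝ) < N := lt_of_lt_of_le (by positivity) hNl
  set a : ℝ := N * c with ha
  set b : ℝ := N * C with hb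
  clear_value a b
  have ha0 : 0 < a := by rw [ha]; positivity
  have hb0 : 0 < b := by rw [hb]; positivity
  have hab : a ≤ b := by rw [ha, hb]; gcongr
  have haη : c * η * A ≤ a := by
    rw [ha, mul_assoc, mul_comm c]; gcongr
  have hbη : C * η * A ≤ b := by
    rw [hb, mul_assoc, mul_comm C]; gcongr
  have hbA : 4 * b ≤ A := by
    have h1 : b ≤ (η * A + 1) * C := by rw [hb]; gcongr
    have h2 : C * η * A ≤ 1 / 8 * A := by gcongr
    linarith
  have hrb : r * (2 * b) = a / 2 := by
    rw [hr, hb, ha]; field_simp; ring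
  have hholdn : ∀ n ≤ k, (n : ℝ) * s ≤ r / 2 * (2 * b) ^ 2 := by
    intro n hn
    have h2 : (n : ℝ) ≤ (H + 1) * A := le_trans (by exact_mod_cast hn) hku
    have h3 : (H + 1) * s ≤ A * (2 * r * (C * η) ^ 2) := (div_le_iff₀ (by positivity)).1 hA3
    calc (n : ℝ) * s ≤ (H + 1) * A * s := by gcongr
      _ = (H + 1) * s * A := by ring
      _ ≤ A * (2 * r * (C * η) ^ 2) * A := by gcongr
      _ = r / 2 * (2 * (C * η * A)) ^ 2 := by ring
      _ ≤ r / 2 * (2 * b) ^ 2 := by gcongr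
  have hhold : ∀ n ≤ k, ∀ y, a / 2 ≤ y → y ≤ 2 * b →
      ENNReal.ofReal (m ^ n * Real.exp (-(4 * θ * b)) * (r / 2)) ≤ stripSurvival μ A n y :=
    fun n hn y hy1 hy2 => hold_le_stripSurvival h h0.le h1.le hz hs hsv hb0 hbA hr0 n
      (hholdn n hn) (by rw [hrb]; exact hy1) hy2
  -- All losses together: forced steps, wrong tilt, and the constant factor `r / 4`. The constants
  -- are absorbed in `κA/2` for large `A`.
  have hloss : Real.exp (-(κ * A)) ≤
      q ^ N * ((r / 4) * Real.exp (-((θ - t) * A) - 7 * θ * b)) := by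
    have e1 : q ^ N = Real.exp (-(N * Real.log (1 / q))) := by
      rw [one_div, Real.log_inv, mul_neg, neg_neg, ← Real.log_pow, Real.exp_log (by positivity)]
    have e2 : r / 4 = Real.exp (-Real.log (4 / r)) := by
      rw [← Real.log_inv, Real.exp_log (by positivity), inv_div]
    rw [e1, e2, ← Real.exp_add, ← Real.exp_add, Real.exp_le_exp]
    have h2 : Real.log (4 / r) + lam ≤ A * (κ / 2) := (div_le_iff₀ (by positivity)).1 hA6
    have h3 : N * lam ≤ (η * A + 1) * lam := by gcongr
    have h4 : N * lam = N * Real.log (1 / q) + 7 * θ * b := by rw [hlam, hb]; ring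
    have h5 : (θ - t) * A ≤ κ / 4 * A := by gcongr
    have h6 : η * lam * A ≤ κ / 4 * A := by gcongr
    linarith
  constructor
  · intro x hx0 hxA
    have hNk : N ≤ k := by
      have h4 : (N : ℝ) ≤ k := by
        refine le_trans ?_ hkl
        have : 0 ≤ 1 / v * A := by positivity
        have h5 : H * A = 1 / v * A + η * A + A := by rw [hH]; ring
        linarith
      exact_mod_cast h4
    -- From the interior: descend with tilt `t`, then hold with tilt `θ` until time `k`. Replacing
    -- the larger factor `mgf id μ t` by `m` is harmless in a lower bound.
    have hstep : ∀ y, a ≤ y → y ≤ A - a → x - b ≤ y → ENNReal.ofReal (m ^ k *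
        ((r / 4) * Real.exp (θ * x - (θ - t) * A - 7 * θ * b))) ≤ stripSurvival μ A (k - N) y := by
      intro y hy1 hy2 hy3
      set n := ⌊(y - a) / v⌋₊ with hn
      have hnA : (n : ℝ) ≤ 1 / v * A := by
        refine (Nat.floor_le (div_nonneg (by linarith) hv'0.le)).trans ?_
        rw [one_div, inv_mul_eq_div]
        gcongr
        linarith
      have hnk : N + n ≤ k := by
        have : (N : ℝ) + n ≤ k := by
          refine le_trans ?_ hkl
          have h5 : H * A = 1 / v * A + η * A + A := by rw [hH]; ring
          linarith
        exact_mod_cast this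
      have hd := descend_le_stripSurvival h ht0 ht1 hv'0 hv' hs' hsv' (A := A) ha0
        (by
          have h3 := (div_le_iff₀ (by positivity)).1 hA5
          linarith)
        (β := m ^ (k - N - n) * Real.exp (-(4 * θ * b)) * (r / 2)) (by positivity) (k - N - n)
        hy1 hy2
        (by
          have h3 := (div_le_iff₀ (by positivity)).1 hA4
          calc A / v * s' = 8 * (s' / v) * A / 8 := by ring
            _ ≤ A * (c * η) ^ 2 * A / 8 := by gcongr
            _ = 1 / 2 * (c * η * A / 2) ^ 2 := by ring
            _ ≤ 1 / 2 * (a / 2) ^ 2 := by gcongr)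
        (fun z hz1 hz2 => hhold _ (by omega) z hz1 (by linarith))
      rw [← hn, show n + (k - N - n) = k - N by omega] at hd
      refine le_trans (ENNReal.ofReal_le_ofReal ?_) hd
      have e1 : m ^ k ≤ m ^ (k - N - n) * mgf id μ t ^ n := by
        calc m ^ k ≤ m ^ (k - N - n + n) := pow_le_pow_of_le_one hm0.le hlt.le (by omega)
          _ = m ^ (k - N - n) * m ^ n := pow_add _ _ _
          _ ≤ _ := by gcongr
      have e2 : Real.exp (θ * x - (θ - t) * A - 7 * θ * b) ≤
          Real.exp (-(4 * θ * b)) * Real.exp (t * (y - 2 * a)) := by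
        rw [← Real.exp_add, Real.exp_le_exp]
        have h2 : t * (x - 3 * b) ≤ t * (y - 2 * a) :=
          mul_le_mul_of_nonneg_left (by linarith) ht0
        have h3 : (θ - t) * x ≤ (θ - t) * A := by
          apply mul_le_mul_of_nonneg_left hxA.le; linarith
        have h4 : t * (3 * b) ≤ θ * (3 * b) := by gcongr
        linarith
      calc m ^ k * ((r / 4) * Real.exp (θ * x - (θ - t) * A - 7 * θ * b))
          ≤ (m ^ (k - N - n) * mgf id μ t ^ n) * ((r / 4) * (Real.exp (-(4 * θ * b)) *
            Real.exp (t * (y - 2 * a)))) := by gcongr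
        _ = _ := by ring
    have hfin : m ^ k * Real.exp (θ * x - κ * A) ≤
        q ^ N * (m ^ k * ((r / 4) * Real.exp (θ * x - (θ - t) * A - 7 * θ * b))) := by
      rw [show θ * x - κ * A = θ * x + -(κ * A) by ring, Real.exp_add,
        show θ * x - (θ - t) * A - 7 * θ * b = θ * x + (-((θ - t) * A) - 7 * θ * b) by ring,
        Real.exp_add]
      calc m ^ k * (Real.exp (θ * x) * Real.exp (-(κ * A)))
          ≤ m ^ k * (Real.exp (θ * x) *
            (q ^ N * ((r / 4) * Real.exp (-((θ - t) * A) - 7 * θ * b)))) := by gcongr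
        _ = _ := by ring
    refine (ENNReal.ofReal_le_ofReal hfin).trans ?_
    obtain ⟨j, hj⟩ : ∃ j, k = N + j := ⟨k - N, by omega⟩
    have hj' : k - N = j := by omega
    rw [hj'] at hstep
    nth_rw 2 [hj]
    -- `N` steps away from the nearer boundary bring the walk into `[a, A - a]`.
    rcases le_total x (A / 2) with hxh | hxh
    · refine mul_pow_le_stripSurvival_of_mass_pos hc hq.le (by positivity) hqp j N x hx0
        (by rw [← hb]; linarith) fun y hy1 hy2 => hstep y ?_ ?_ ?_ <;>
        rw [← ha] at hy1 <;> rw [← hb] at hy2 <;> linarith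
    · refine mul_pow_le_stripSurvival_of_mass_neg hc hq.le (by positivity) hqn j N x hxA
        (by rw [← hb]; linarith) fun y hy1 hy2 => hstep y ?_ ?_ ?_ <;>
        rw [← hb] at hy1 <;> rw [← ha] at hy2 <;> linarith
  · intro n hn
    have hloss' : Real.exp (-(κ * A)) ≤ q ^ N * (Real.exp (-(4 * θ * b)) * (r / 2)) := by
      refine hloss.trans ?_
      have e1 : Real.exp (-((θ - t) * A) - 7 * θ * b) ≤ Real.exp (-(4 * θ * b)) := by
        rw [Real.exp_le_exp]
        have : 0 ≤ (θ - t) * A := mul_nonneg (by linarith) hA0.le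
        have : 0 ≤ θ * b := by positivity
        linarith
      have e2 : r / 4 * Real.exp (-((θ - t) * A) - 7 * θ * b) ≤
          r / 2 * Real.exp (-(4 * θ * b)) := by
        gcongr
        linarith
      rw [mul_comm (Real.exp _) (r / 2)]
      gcongr
    have hm1 : ∀ j, m ^ j ≤ 1 := fun j => pow_le_one₀ hm0.le hlt.le
    -- For short times the forced upward steps alone give survival; for longer times they are
    -- followed by holding.
    rcases le_total n N with hnN | hnN
    · have := mul_pow_le_stripSurvival_of_mass_pos (A := A) (β := 1) hc hq.le zero_le_one hqp 0 n 0
        le_rfl (by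
          have : (n : ℝ) * C ≤ b := by rw [hb]; gcongr
          linarith) (fun y _ _ => by simp [stripSurvival])
      refine le_trans (ENNReal.ofReal_le_ofReal ?_) this
      have e1 : Real.exp (-(4 * θ * b)) ≤ 1 := by
        rw [Real.exp_le_one_iff]
        have : 0 ≤ θ * b := by positivity
        linarith
      calc m ^ n * Real.exp (-(κ * A)) ≤ 1 * Real.exp (-(κ * A)) := by gcongr; exact hm1 n
        _ ≤ q ^ N * (Real.exp (-(4 * θ * b)) * (r / 2)) := by rw [one_mul]; exact hloss'
        _ ≤ q ^ N * (1 * 1) := by gcongr; linarith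
        _ = q ^ N := by ring
        _ ≤ q ^ n := pow_le_pow_of_le_one hq.le hq1 hnN
        _ = q ^ n * 1 := by ring
    · obtain ⟨j, rfl⟩ := Nat.exists_eq_add_of_le hnN
      refine le_trans (ENNReal.ofReal_le_ofReal ?_) (mul_pow_le_stripSurvival_of_mass_pos (A := A)
        (β := m ^ j * Real.exp (-(4 * θ * b)) * (r / 2)) hc hq.le (by positivity) hqp j N 0 le_rfl
        (by rw [← hb]; linarith) fun y hy1 hy2 => hhold j (by omega) y ?_ ?_)
      · have e1 : m ^ (N + j) ≤ m ^ j := pow_le_pow_of_le_one hm0.le hlt.le (by omega)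
        calc m ^ (N + j) * Real.exp (-(κ * A))
            ≤ m ^ j * (q ^ N * (Real.exp (-(4 * θ * b)) * (r / 2))) := by gcongr
          _ = _ := by ring
      · rw [← ha] at hy1; linarith
      · rw [← hb] at hy2; linarith

end Phases


/-! ### The round robin statistic while no affected unit is sampled -/

section Idle

variable {L : ℕ} [NeZero L]

/-- One transition of the round robin statistic with increment `z`. -/
noncomputable def roundRobinStep (s : ℝ × Fin L) (z : ℝ) : ℝ × Fin L :=
  (max s.1 0 + z, if max s.1 0 + z ≤ 0 then s.2 + 1 else s.2)

lemma measurable_roundRobinStep :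
    Measurable fun p : (ℝ × Fin L) × ℝ => roundRobinStep p.1 p.2 := by
  have h1 : Measurable fun p : (ℝ × Fin L) × ℝ => max p.1.1 0 + p.2 := by fun_prop
  refine h1.prodMk (Measurable.ite (measurableSet_le h1 measurable_const) ?_ (by fun_prop))
  exact (Measurable.of_discrete (f := fun u : Fin L => u + 1)).comp (by fun_prop)

open Classical in
/-- The transition operator of the round robin statistic, killed when an affected unit is to be
sampled or an alarm is raised. -/
noncomputable def idleOp (μ : Measure ℝ) (A : ℝ) (𝒰 : Set (Fin L)) (f : ℝ × Fin L → ℝ≥0∞) :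
    ℝ × Fin L → ℝ≥0∞ := fun s =>
  if s.2 ∈ 𝒰 then 0 else
    ∫⁻ z, (if (roundRobinStep s z).1 < A then f (roundRobinStep s z) else 0) ∂μ

variable {μ : Measure ℝ} {A : ℝ} {𝒰 : Set (Fin L)}

lemma measurable_ite_lt_comp_roundRobinStep {f : ℝ × Fin L → ℝ≥0∞} (hf : Measurable f) :
    Measurable fun p : (ℝ × Fin L) × ℝ =>
      if (roundRobinStep p.1 p.2).1 < A then f (roundRobinStep p.1 p.2) else 0 :=
  Measurable.ite (measurableSet_lt (measurable_fst.comp measurable_roundRobinStep)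
    measurable_const) (hf.comp measurable_roundRobinStep) measurable_const

lemma measurable_idleOp [SFinite μ] {f : ℝ × Fin L → ℝ≥0∞} (hf : Measurable f) :
    Measurable (idleOp μ A 𝒰 f) := by
  classical
  refine Measurable.ite (measurable_snd (MeasurableSet.of_discrete (s := 𝒰))) measurable_const ?_
  exact (measurable_ite_lt_comp_roundRobinStep hf).lintegral_prod_right'

lemma measurable_iterate_idleOp [SFinite μ] {f : ℝ × Fin L → ℝ≥0∞} (hf : Measurable f) (n : ℕ) :
    Measurable ((idleOp μ A 𝒰)^[n] f) := by
  induction n with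
  | zero => exact hf
  | succ n ih => rw [Function.iterate_succ']; exact measurable_idleOp ih

lemma idleOp_mono {f g : ℝ × Fin L → ℝ≥0∞} (hfg : ∀ s, s.1 < A → f s ≤ g s) (s : ℝ × Fin L) :
    idleOp μ A 𝒰 f s ≤ idleOp μ A 𝒰 g s := by
  unfold idleOp
  split_ifs
  · exact le_rfl
  · refine lintegral_mono fun z => ?_
    split_ifs with h
    · exact hfg _ h
    · exact le_rfl

lemma iterate_idleOp_mono {f g : ℝ × Fin L → ℝ≥0∞} (hfg : ∀ s, s.1 < A → f s ≤ g s) (n : ℕ) :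
    ∀ s, s.1 < A → (idleOp μ A 𝒰)^[n] f s ≤ (idleOp μ A 𝒰)^[n] g s := by
  induction n with
  | zero => exact hfg
  | succ n ih =>
    intro s _
    rw [Function.iterate_succ', Function.comp, Function.comp]
    exact idleOp_mono ih s

lemma idleOp_const_mul {c : ℝ≥0∞} (hc : c ≠ ⊤) (f : ℝ × Fin L → ℝ≥0∞) :
    idleOp μ A 𝒰 (fun s => c * f s) = fun s => c * idleOp μ A 𝒰 f s := by
  ext s
  unfold idleOp
  split_ifs
  · simp
  · rw [← lintegral_const_mul' _ _ hc]
    congr 1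
    ext z
    split_ifs <;> simp

lemma iterate_idleOp_const_mul {c : ℝ≥0∞} (hc : c ≠ ⊤) (f : ℝ × Fin L → ℝ≥0∞) (n : ℕ) :
    (idleOp μ A 𝒰)^[n] (fun s => c * f s) = fun s => c * (idleOp μ A 𝒰)^[n] f s := by
  induction n with
  | zero => rfl
  | succ n ih =>
    rw [Function.iterate_succ', Function.comp, ih, idleOp_const_mul hc, Function.comp]

lemma idleOp_add [SFinite μ] {f : ℝ × Fin L → ℝ≥0∞} (hf : Measurable f)
    (g : ℝ × Fin L → ℝ≥0∞) :
    idleOp μ A 𝒰 (fun s => f s + g s) = fun s => idleOp μ A 𝒰 f s + idleOp μ A 𝒰 g s := by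
  ext s
  unfold idleOp
  split_ifs
  · simp
  · rw [← lintegral_add_left]
    · congr 1
      ext z
      split_ifs <;> simp
    · exact (measurable_ite_lt_comp_roundRobinStep hf).comp measurable_prodMk_left

lemma iterate_idleOp_add [SFinite μ] {f : ℝ × Fin L → ℝ≥0∞} (hf : Measurable f)
    (g : ℝ × Fin L → ℝ≥0∞) (n : ℕ) :
    (idleOp μ A 𝒰)^[n] (fun s => f s + g s) =
      fun s => (idleOp μ A 𝒰)^[n] f s + (idleOp μ A 𝒰)^[n] g s := by
  induction n with
  | zero => rfl
  | succ n ih =>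
    rw [Function.iterate_succ', Function.comp, ih, idleOp_add (measurable_iterate_idleOp hf n)]
    rfl

/-- While the walk stays strictly between `0` and `A` the unit does not change, so neither cause of
killing can occur. -/
lemma stripSurvival_le_iterate_idleOp (n : ℕ) : ∀ s : ℝ × Fin L, s.2 ∉ 𝒰 →
    stripSurvival μ A n (max s.1 0) ≤ (idleOp μ A 𝒰)^[n] (fun _ => 1) s := by
  induction n with
  | zero => intro s _; exact le_rfl
  | succ n ih =>
    intro s hs
    rw [Function.iterate_succ', Function.comp, idleOp, if_neg hs, stripSurvival]
    refine lintegral_mono fun z => ?_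
    split_ifs with h1 h2 h2
    · refine le_trans ?_ (ih (roundRobinStep s z) ?_)
      · simp [roundRobinStep, max_eq_left h1.1.le]
      · simpa [roundRobinStep, not_le.2 h1.1] using hs
    · exact absurd h1.2 h2
    · exact zero_le
    · exact zero_le

/-- The cyclic distance to an affected unit decreases. -/
lemma exists_distance {𝒰 : Set (Fin L)} (h𝒰 : 𝒰.Nonempty) :
    ∃ d : Fin L → ℕ, (∀ u, d u ≤ L) ∧ ∀ u, u ∉ 𝒰 → d (u + 1) < d u := by
  obtain ⟨v, hv⟩ := h𝒰
  refine ⟨fun u => (v - u : Fin L).val, fun u => (v - u).isLt.le, fun u hu => ?_⟩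
  have hne : v - u ≠ 0 := by
    intro h0
    exact hu (by rwa [← sub_eq_zero.1 h0])
  have : v - (u + 1) = (v - u) - 1 := by abel
  simp only [this]
  have hpos : 0 < (v - u).val := Nat.pos_of_ne_zero fun h0 => hne (Fin.ext (by simpa using h0))
  have hlt := (v - u).isLt
  have h1 : (1 : Fin L).val = 1 := by
    rw [Fin.val_one']
    exact Nat.mod_eq_of_lt (by omega)
  have hle : (1 : Fin L) ≤ v - u := by
    rw [Fin.le_def, h1]; exact hpos
  rw [Fin.sub_val_of_le hle, h1]
  omega

/-- A Lyapunov function for the killed chain. If the statistic stays positive, the exponential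
contributes the factor `mgf id μ θ`. If it becomes nonpositive, the unit advances, the distance `d`
drops and `C ^ d` loses a factor `C`. A large `C` thus makes the growth rate arbitrarily close to
the minimum of the moment generating function. -/
lemma iterate_idleOp_exp_le (h : IsLLRLaw μ) {θ C : ℝ} (h0 : 0 ≤ θ) (h1 : θ ≤ 1) (hC : 1 ≤ C)
    {d : Fin L → ℕ} (hd : ∀ u, u ∉ 𝒰 → d (u + 1) < d u) (n : ℕ) : ∀ s, s.1 < A →
    (idleOp μ A 𝒰)^[n] (fun s => ENNReal.ofReal (C ^ d s.2 * Real.exp (θ * max s.1 0))) s ≤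
      ENNReal.ofReal ((mgf id μ θ + 1 / C) ^ n) *
        ENNReal.ofReal (C ^ d s.2 * Real.exp (θ * max s.1 0)) := by
  have hp := h.prob
  have hM := (h.mgf_pos θ h0 h1).le
  have hC0 : 0 < C := by linarith
  have hone : ∀ s : ℝ × Fin L,
      idleOp μ A 𝒰 (fun s => ENNReal.ofReal (C ^ d s.2 * Real.exp (θ * max s.1 0))) s ≤
      ENNReal.ofReal (mgf id μ θ + 1 / C) *
        ENNReal.ofReal (C ^ d s.2 * Real.exp (θ * max s.1 0)) := by
    intro s
    unfold idleOp
    split_ifs with hs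
    · exact zero_le
    set b := max s.1 0 with hb
    have hb0 : 0 ≤ b := le_max_right _ _
    have hdC : C ^ d (s.2 + 1) ≤ C ^ d s.2 / C := by
      rw [le_div_iff₀ hC0, ← pow_succ]
      exact pow_le_pow_right₀ hC (hd _ hs)
    have hi := h.integrable_exp_mul h0 h1
    have hint : Integrable (fun z => C ^ d s.2 * Real.exp (θ * b) * Real.exp (θ * z) +
        C ^ d s.2 / C) μ := (hi.const_mul _).add (integrable_const _)
    calc _ ≤ ∫⁻ z, ENNReal.ofReal (C ^ d s.2 * Real.exp (θ * b) * Real.exp (θ * z) +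
            C ^ d s.2 / C) ∂μ := by
          refine lintegral_mono fun z => ?_
          split_ifs with hA
          · refine ENNReal.ofReal_le_ofReal ?_
            simp only [roundRobinStep, ← hb]
            rw [mul_assoc, ← Real.exp_add, ← mul_add]
            rcases le_or_gt (b + z) 0 with hz | hz
            · rw [if_pos hz, max_eq_right hz, mul_zero, Real.exp_zero, mul_one]
              have : 0 ≤ C ^ d s.2 * Real.exp (θ * (b + z)) := by positivity
              linarith
            · rw [if_neg (not_le.2 hz), max_eq_left hz.le]
              have : 0 ≤ C ^ d s.2 / C := by positivity
              linarith
          · exact zero_le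
      _ = ENNReal.ofReal (C ^ d s.2 * Real.exp (θ * b) * mgf id μ θ + C ^ d s.2 / C) := by
          rw [← ofReal_integral_eq_lintegral_ofReal hint
            (Eventually.of_forall fun z => by positivity), integral_add (hi.const_mul _)
            (integrable_const _), integral_const_mul]
          simp [mgf]
      _ ≤ _ := by
          rw [← ENNReal.ofReal_mul (by positivity)]
          refine ENNReal.ofReal_le_ofReal ?_
          have : 1 ≤ Real.exp (θ * b) := Real.one_le_exp (by positivity)
          have h2 : C ^ d s.2 / C * 1 ≤ C ^ d s.2 / C * Real.exp (θ * b) := by gcongr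
          calc _ ≤ C ^ d s.2 * Real.exp (θ * b) * mgf id μ θ +
                C ^ d s.2 / C * Real.exp (θ * b) := by linarith
            _ = _ := by ring
  induction n with
  | zero => intro s _; simp
  | succ n ih =>
    intro s hs
    rw [Function.iterate_succ', Function.comp]
    refine (idleOp_mono ih s).trans ?_
    rw [idleOp_const_mul ENNReal.ofReal_ne_top]
    refine (mul_le_mul_right (hone s) _).trans ?_
    rw [← mul_assoc, ← ENNReal.ofReal_mul (by positivity), pow_succ]

/-- Conditionally on the absence of an alarm and of affected units, the statistic is small compared
to the threshold. -/
theorem eventually_iterate_idleOp_le (h : IsLLRLaw μ) {ε : ℝ} (hε : 0 < ε) (L : ℕ) [NeZero L] :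
    ∀ᶠ A in atTop, ∀ 𝒰 : Set (Fin L), 𝒰.Nonempty → ∀ (n : ℕ) (s : ℝ × Fin L), s.1 ≤ 0 →
      (idleOp μ A 𝒰)^[n] (fun s => if s.1 < A then ENNReal.ofReal s.1 else 0) s ≤
        ENNReal.ofReal (ε * A) * (idleOp μ A 𝒰)^[n] (fun _ => 1) s := by
  have hp := h.prob
  obtain ⟨θ, h0, h1, hlt, hz, hmin, hneg⟩ := h.exists_minimizer
  obtain ⟨H, hH, hev⟩ := exists_le_stripSurvival h h0 h1 hz hmin hlt hneg
    (κ := θ * ε / 8) (by positivity)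
  have hm0 := h.mgf_pos θ h0.le h1.le
  set m := mgf id μ θ with hm
  -- Chosen so that replacing `m` by `m + 1 / C` over `k ≈ HA` steps costs at most `θεA/8` in the
  -- exponent, up to a constant.
  set C : ℝ := max 1 (H / m / (θ * ε / 8)) with hC
  have hC1 : 1 ≤ C := le_max_left _ _
  have hC0 : 0 < C := by linarith
  have hC2 : H / (C * m) ≤ θ * ε / 8 := by
    have := (div_le_iff₀ (by positivity)).1 (le_max_right 1 (H / m / (θ * ε / 8)))
    rw [← hC, div_le_iff₀ hm0] at this
    rw [div_le_iff₀ (by positivity)]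
    linarith
  have hlim : ∀ᶠ A in atTop, C ^ L * Real.exp (1 / (C * m)) * Real.exp (-(θ * ε / 4 * A)) ≤
      ε / 2 := by
    have h2 : Tendsto (fun A : ℝ => C ^ L * Real.exp (1 / (C * m)) *
        Real.exp (-(θ * ε / 4 * A))) atTop (𝓝 (C ^ L * Real.exp (1 / (C * m)) * 0)) := by
      refine Tendsto.const_mul _ (Real.tendsto_exp_neg_atTop_nhds_zero.comp ?_)
      exact tendsto_id.const_mul_atTop (by positivity)
    rw [mul_zero] at h2
    exact h2.eventually (ge_mem_nhds (by positivity))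
  filter_upwards [hev, hlim, eventually_gt_atTop 0] with A ⟨hev1, hev2⟩ hlim hA0
  intro 𝒰 h𝒰
  obtain ⟨d, hdL, hd⟩ := exists_distance h𝒰
  set k := ⌈H * A⌉₊ with hk
  have hk1 : 1 ≤ k := Nat.one_le_iff_ne_zero.2 (Nat.ceil_pos.2 (by positivity)).ne'
  have hku : (k : ℝ) ≤ H * A + 1 := (Nat.ceil_lt_add_one (by positivity)).le
  set hi : ℝ × Fin L → ℝ≥0∞ := fun s => if ε / 2 * A ≤ s.1 then 1 else 0 with hhi
  -- Of the gain `θεA/2` from a high end point, `θεA/8` pays for `C` and `θεA/8` for the survival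
  -- bound. The remaining `θεA/4` beats the constants for large `A`.
  have hratio : ∀ n ≤ k, ∀ b : ℝ, ∀ j ≤ L,
      Real.exp (-(θ * (ε / 2 * A))) * ((m + 1 / C) ^ n * (C ^ j * Real.exp (θ * b))) ≤
      ε / 2 * (m ^ n * Real.exp (θ * b - θ * ε / 8 * A)) := by
    intro n hn b j hj
    have e1 : (m + 1 / C) ^ n ≤ m ^ n * Real.exp (1 / (C * m) + θ * ε / 8 * A) := by
      have : m + 1 / C = m * (1 / (C * m) + 1) := by field_simp; ring
      rw [this, mul_pow]
      gcongr
      calc (1 / (C * m) + 1) ^ n ≤ Real.exp (1 / (C * m)) ^ n := by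
            gcongr; exact Real.add_one_le_exp _
        _ = Real.exp (n * (1 / (C * m))) := by rw [Real.exp_nat_mul]
        _ ≤ _ := by
            rw [Real.exp_le_exp]
            have hnk : (n : ℝ) ≤ H * A + 1 := le_trans (by exact_mod_cast hn) hku
            calc n * (1 / (C * m)) ≤ (H * A + 1) * (1 / (C * m)) := by gcongr
              _ = 1 / (C * m) + H / (C * m) * A := by ring
              _ ≤ _ := by gcongr
    have e2 : C ^ j ≤ C ^ L := pow_le_pow_right₀ hC1 hj
    calc _ ≤ Real.exp (-(θ * (ε / 2 * A))) * (m ^ n * Real.exp (1 / (C * m) + θ * ε / 8 * A) *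
          (C ^ L * Real.exp (θ * b))) := by gcongr
      _ = C ^ L * Real.exp (1 / (C * m)) * Real.exp (-(θ * ε / 4 * A)) *
          (m ^ n * Real.exp (θ * b - θ * ε / 8 * A)) := by
          rw [show θ * b - θ * ε / 8 * A = θ * b + -(θ * ε / 8 * A) by ring,
            show -(θ * (ε / 2 * A)) = -(θ * ε / 4 * A) + (-(θ * ε / 8 * A) + -(θ * ε / 8 * A)) by
              ring, Real.exp_add, Real.exp_add, Real.exp_add, Real.exp_add, Real.exp_neg (θ * ε / 8 * A)]
          field_simp
      _ ≤ _ := by gcongr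
  have hup : ∀ n s, s.1 < A → (idleOp μ A 𝒰)^[n] hi s ≤ ENNReal.ofReal
      (Real.exp (-(θ * (ε / 2 * A))) * ((m + 1 / C) ^ n *
        (C ^ d s.2 * Real.exp (θ * max s.1 0)))) := by
    intro n s hs
    refine (iterate_idleOp_mono (g := fun s => ENNReal.ofReal (Real.exp (-(θ * (ε / 2 * A)))) *
      ENNReal.ofReal (C ^ d s.2 * Real.exp (θ * max s.1 0))) (fun s _ => ?_) n s hs).trans ?_
    · simp only [hhi]
      split_ifs with hs
      · rw [← ENNReal.ofReal_mul (by positivity), ENNReal.one_le_ofReal, mul_left_comm,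
          ← Real.exp_add]
        have : 0 ≤ -(θ * (ε / 2 * A)) + θ * max s.1 0 := by
          have : θ * (ε / 2 * A) ≤ θ * max s.1 0 := by
            gcongr
            exact hs.trans (le_max_left _ _)
          linarith
        calc (1 : ℝ) = 1 * 1 := by ring
          _ ≤ _ := by
            gcongr
            · exact one_le_pow₀ hC1
            · exact Real.one_le_exp this
      · exact zero_le
    · rw [iterate_idleOp_const_mul ENNReal.ofReal_ne_top]
      refine (mul_le_mul_right (iterate_idleOp_exp_le h h0.le h1.le hC1 hd n s hs) _).trans ?_
      rw [← ENNReal.ofReal_mul (by positivity), ← ENNReal.ofReal_mul (by positivity)]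
  have hfin : ∀ n ≤ k, ∀ s : ℝ × Fin L, s.1 < A → s.2 ∉ 𝒰 →
      ENNReal.ofReal (m ^ n * Real.exp (θ * max s.1 0 - θ * ε / 8 * A)) ≤
        stripSurvival μ A n (max s.1 0) →
      (idleOp μ A 𝒰)^[n] hi s ≤ ENNReal.ofReal (ε / 2) * (idleOp μ A 𝒰)^[n] (fun _ => 1) s := by
    intro n hn s hs hsU hl
    refine (hup n s hs).trans ?_
    refine (ENNReal.ofReal_le_ofReal (hratio n hn (max s.1 0) (d s.2) (hdL _))).trans ?_
    rw [ENNReal.ofReal_mul (by positivity)]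
    gcongr
    exact hl.trans (stripSurvival_le_iterate_idleOp n s hsU)
  have hU : ∀ n s, 1 ≤ n → s.2 ∈ 𝒰 → (idleOp μ A 𝒰)^[n] hi s = 0 := by
    intro n s hn hs
    obtain ⟨n, rfl⟩ := Nat.exists_eq_add_of_le' hn
    rw [Function.iterate_succ', Function.comp, idleOp, if_pos hs]
  have hhigh : ∀ (n : ℕ) (s : ℝ × Fin L), s.1 ≤ 0 →
      (idleOp μ A 𝒰)^[n] hi s ≤ ENNReal.ofReal (ε / 2) * (idleOp μ A 𝒰)^[n] (fun _ => 1) s := by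
    intro n s hs
    rcases le_total n k with hn | hn
    · rcases Nat.eq_zero_or_pos n with rfl | hn0
      · have : ¬ (ε / 2 * A ≤ s.1) := by
          have : 0 < ε / 2 * A := by positivity
          linarith
        simp [hhi, this]
      · by_cases hsU : s.2 ∈ 𝒰
        · rw [hU n s hn0 hsU]; exact zero_le
        · refine hfin n hn s (by linarith) hsU ?_
          rw [max_eq_right hs]
          simpa using hev2 n hn
    -- For a long stretch the comparison over the last `k` steps holds from every state below `A`.
    -- Monotonicity of the operator propagates it through the first `j` steps, so the length of the
    -- stretch does not matter.
    · obtain ⟨j, rfl⟩ := Nat.exists_eq_add_of_le' hn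
      rw [Function.iterate_add, Function.comp, Function.comp]
      refine (iterate_idleOp_mono (g := fun s => ENNReal.ofReal (ε / 2) *
        (idleOp μ A 𝒰)^[k] (fun _ => 1) s) (fun s hs => ?_) j s (by linarith)).trans ?_
      · by_cases hsU : s.2 ∈ 𝒰
        · rw [hU k s hk1 hsU]; exact zero_le
        · exact hfin k le_rfl s hs hsU (hev1 _ (le_max_right _ _) (max_lt hs hA0))
      · rw [iterate_idleOp_const_mul ENNReal.ofReal_ne_top]
  intro n s hs
  -- Below the alarm threshold the statistic is at most `εA/2` plus `A` times the indicator of being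
  -- above `εA/2`.
  have hbound : ∀ s : ℝ × Fin L, s.1 < A → (if s.1 < A then ENNReal.ofReal s.1 else 0) ≤
      ENNReal.ofReal (ε / 2 * A) * 1 + ENNReal.ofReal A * hi s := by
    intro s hs
    rw [if_pos hs]
    simp only [hhi]
    split_ifs with h2
    · refine le_add_left ?_
      rw [mul_one]
      exact ENNReal.ofReal_le_ofReal hs.le
    · refine le_add_right ?_
      rw [mul_one]
      exact ENNReal.ofReal_le_ofReal (not_le.1 h2).le
  refine (iterate_idleOp_mono hbound n s (by linarith)).trans ?_
  rw [iterate_idleOp_add (by fun_prop), iterate_idleOp_const_mul ENNReal.ofReal_ne_top,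
    iterate_idleOp_const_mul ENNReal.ofReal_ne_top]
  calc _ ≤ ENNReal.ofReal (ε / 2 * A) * (idleOp μ A 𝒰)^[n] (fun _ => 1) s + ENNReal.ofReal A *
        (ENNReal.ofReal (ε / 2) * (idleOp μ A 𝒰)^[n] (fun _ => 1) s) := by
        exact add_le_add le_rfl (mul_le_mul_right (hhigh n s hs) _)
    _ = _ := by
        rw [← mul_assoc, ← ENNReal.ofReal_mul hA0.le, ← add_mul,
          ← ENNReal.ofReal_add (by positivity) (by positivity)]
        congr 2
        ring

end Idle


/-! ### A potential for the detection delay -/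

section Potential

variable {L : ℕ} [NeZero L] {μ : Measure ℝ}

lemma one_add_lintegral_le_ofReal {ν : Measure ℝ} {f : ℝ → ℝ≥0∞} {g : ℝ → ℝ} {v : ℝ}
    (hfg : ∀ z, f z ≤ ENNReal.ofReal (g z)) (hv : 0 ≤ v)
    (hg : ∫⁻ z, ENNReal.ofReal (g z) ∂ν = ENNReal.ofReal v) :
    1 + ∫⁻ z, f z ∂ν ≤ ENNReal.ofReal (1 + v) := by
  rw [ENNReal.ofReal_add zero_le_one hv, ENNReal.ofReal_one, ← hg]
  gcongr
  exact hfg _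

lemma lintegral_expWeighted_ofReal {g : ℝ → ℝ} (hg : Measurable g) (h0 : ∀ z, 0 ≤ g z)
    (hi : Integrable (fun z => g z * Real.exp z) μ) :
    ∫⁻ z, ENNReal.ofReal (g z) ∂(expWeighted μ) =
      ENNReal.ofReal (∫ z, g z * Real.exp z ∂μ) := by
  rw [expWeighted, lintegral_withDensity_eq_lintegral_mul _ (by fun_prop) (by fun_prop),
    ofReal_integral_eq_lintegral_ofReal hi
      (Eventually.of_forall fun z => mul_nonneg (h0 z) (Real.exp_pos z).le)]
  congr 1
  ext z
  rw [Pi.mul_apply, ← ENNReal.ofReal_mul (Real.exp_pos z).le, mul_comm]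

open Classical in
/-- The law of the increment after the change when the affected units are those in `𝒰`. -/
noncomputable def postChangeIncrementLaw (μ : Measure ℝ) (𝒰 : Set (Fin L)) (u : Fin L) :
    Measure ℝ :=
  if u ∈ 𝒰 then expWeighted μ else μ

open Classical in
/-- A supersolution of the equation for the expected delay after the change. -/
theorem exists_potential (h : IsLLRLaw μ) {I : ℝ} (hI0 : 0 < I)
    (hI : I < ∫ z, z * Real.exp z ∂μ) {𝒰 : Set (Fin L)} (h𝒰 : 𝒰.Nonempty) :
    ∃ D β : ℝ, 0 ≤ D ∧ 0 ≤ β ∧ ∀ A : ℝ, 0 < A → ∃ V : ℝ × Fin L → ℝ≥0∞, Measurable V ∧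
      (∀ s, s.1 < A → 1 + ∫⁻ z, (if (roundRobinStep s z).1 < A then V (roundRobinStep s z) else 0)
        ∂(postChangeIncrementLaw μ 𝒰 s.2) ≤ V s) ∧
      ∀ s, s.1 < A → V s ≤ ENNReal.ofReal (A / I + D) +
        if s.2 ∈ 𝒰 then 0 else ENNReal.ofReal (β * s.1) := by
  have hp := h.prob
  obtain ⟨θ, h0, h1, hlt, -, -, -⟩ := h.exists_minimizer
  have hm0 := h.mgf_pos θ h0.le h1.le
  obtain ⟨c, hc, hcI⟩ := h.exists_truncation_mul_exp hI
  obtain ⟨c', hc', hcJ⟩ := h.exists_truncation_neg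
  obtain ⟨d, hdL, hd⟩ := exists_distance h𝒰
  set m := mgf id μ θ with hm
  set I' := ∫ z, min z c * Real.exp z ∂μ with hI'
  have hI'0 : 0 < I' := hI0.trans hcI
  obtain ⟨J, hJ⟩ : ∃ J, J = -∫ z, max z (-c') ∂μ := ⟨_, rfl⟩
  have hJ0 : 0 < J := by rw [hJ]; linarith
  -- A bound for the extra cost of dropping from an affected to an unaffected unit: at most `L`
  -- units must be passed, each allowing for an undershoot of at most `c'`.
  set q := L * (c' / J) with hq
  have hq0 : 0 ≤ q := by positivity
  have hm1 : 0 < 1 - m := by linarith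
  -- Under the alternative `e^{-(1-θ)z}` has mean `m < 1`, so `D₀ = (D₀ + q) m` balances the
  -- correction term: each drop costs `q` and the correction reproduces itself.
  set D₀ := q * m / (1 - m) with hD₀
  have hD₀0 : 0 ≤ D₀ := by positivity
  have hD₀eq : (D₀ + q) * m = D₀ := by rw [hD₀]; field_simp; ring
  refine ⟨c / I + D₀ + q, 1 / J, by positivity, by positivity, fun A hA => ?_⟩
  -- On an affected unit: distance to the threshold over the truncated drift, plus a correction for
  -- a possible drop that decays with the height. Elsewhere: the cost of a fresh start on an
  -- affected unit, plus the time to work off the height at speed `J` and to pass the remaining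
  -- units.
  set W : ℝ × Fin L → ℝ := fun s => if s.2 ∈ 𝒰 then
    (A + c - max s.1 0) / I' + D₀ * Real.exp (-((1 - θ) * max s.1 0))
    else (A + c) / I' + D₀ + d s.2 * (c' / J) + max s.1 0 / J with hW
  have hWm : Measurable W := by
    refine Measurable.ite (measurable_snd (MeasurableSet.of_discrete (s := 𝒰))) (by fun_prop) ?_
    have : Measurable fun s : ℝ × Fin L => (d s.2 : ℝ) :=
      (Measurable.of_discrete (f := fun u : Fin L => (d u : ℝ))).comp measurable_snd
    fun_prop
  refine ⟨fun s => ENNReal.ofReal (W s), hWm.ennreal_ofReal, ?_, ?_⟩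
  · intro s hsA
    set b := max s.1 0 with hb
    have hb0 : 0 ≤ b := le_max_right _ _
    have hbA : b < A := max_lt hsA hA
    by_cases hs : s.2 ∈ 𝒰
    · rw [postChangeIncrementLaw, if_pos hs]
      set g : ℝ → ℝ := fun z => (A + c - b - min z c) / I' +
        (D₀ + q) * Real.exp (-((1 - θ) * (b + z))) with hg
      have hg0 : ∀ z, 0 ≤ g z := by
        intro z
        have : min z c ≤ c := min_le_right _ _
        have h3 : 0 ≤ A + c - b - min z c := by linarith
        simp only [hg]
        positivity
      have hgm : Measurable g := by fun_prop
      -- A nonintegrable function would have Bochner integral `0`, which contradicts the positive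
      -- drift.
      have hmin : Integrable (fun z => min z c * Real.exp z) μ := by
        by_contra hni
        rw [hI', integral_undef hni] at hI'0
        exact lt_irrefl _ hI'0
      have hge : ∀ z, g z * Real.exp z = (A + c - b) / I' * Real.exp z -
          1 / I' * (min z c * Real.exp z) +
          (D₀ + q) * Real.exp (-((1 - θ) * b)) * Real.exp (θ * z) := by
        intro z
        have : Real.exp (-((1 - θ) * (b + z))) * Real.exp z =
            Real.exp (-((1 - θ) * b)) * Real.exp (θ * z) := by
          rw [← Real.exp_add, ← Real.exp_add]; congr 1; ring
        simp only [hg]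
        rw [add_mul, mul_assoc (D₀ + q), this]
        ring
      have hi1 := h.integrable_exp.const_mul ((A + c - b) / I')
      have hi2 := hmin.const_mul (1 / I')
      have hi3 := (h.integrable_exp_mul h0.le h1.le).const_mul
        ((D₀ + q) * Real.exp (-((1 - θ) * b)))
      have hi12 : Integrable (fun z => (A + c - b) / I' * Real.exp z -
        1 / I' * (min z c * Real.exp z)) μ := hi1.sub hi2
      have hgi : Integrable (fun z => g z * Real.exp z) μ := by
        simp_rw [hge]
        exact hi12.add hi3
      have hval : ∫ z, g z * Real.exp z ∂μ = W s - 1 := by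
        simp_rw [hge]
        rw [integral_add hi12 hi3, integral_sub hi1 hi2, integral_const_mul, integral_const_mul,
          integral_const_mul, h.integral_exp, ← hI',
          show ∫ z, Real.exp (θ * z) ∂μ = m from rfl]
        simp only [hW, if_pos hs, ← hb]
        rw [mul_right_comm, hD₀eq]
        field_simp
        ring
      have hnn : 0 ≤ W s - 1 := by
        rw [← hval]
        exact integral_nonneg fun z => mul_nonneg (hg0 z) (Real.exp_pos z).le
      refine (one_add_lintegral_le_ofReal (g := g) (v := W s - 1) (fun z => ?_) hnn ?_).trans
        (by simp)
      · split_ifs with hz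
        · refine ENNReal.ofReal_le_ofReal ?_
          have hmz : min z c ≤ z := min_le_left _ _
          simp only [roundRobinStep, ← hb, hW, hg] at hz ⊢
          rcases le_or_gt (b + z) 0 with hbz | hbz
          · have he : 1 ≤ Real.exp (-((1 - θ) * (b + z))) := by
              refine Real.one_le_exp ?_
              have := mul_nonneg_of_nonpos_of_nonpos (by linarith : -(1 - θ) ≤ 0) hbz
              linarith
            have h2 : (D₀ + q) * 1 ≤ (D₀ + q) * Real.exp (-((1 - θ) * (b + z))) := by gcongr
            have h3 : (A + c) / I' ≤ (A + c - b - min z c) / I' := by gcongr; linarith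
            rw [if_pos hbz, max_eq_right hbz]
            split_ifs with hu
            · simp only [sub_zero, mul_zero, neg_zero, Real.exp_zero, mul_one]
              linarith
            · have h4 : d (s.2 + 1) * (c' / J) ≤ q := by
                rw [hq]; gcongr; exact hdL _
              rw [zero_div]
              linarith
          · rw [if_neg (not_le.2 hbz), if_pos hs, max_eq_left hbz.le]
            have h3 : (A + c - (b + z)) / I' ≤ (A + c - b - min z c) / I' :=
              div_le_div_of_nonneg_right (by linarith) hI'0.le
            have h4 : 0 ≤ q * Real.exp (-((1 - θ) * (b + z))) := by positivity
            linarith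
        · exact zero_le
      · rw [lintegral_expWeighted_ofReal hgm hg0 hgi, hval]
    · rw [postChangeIncrementLaw, if_neg hs]
      set K := (A + c) / I' + D₀ with hK
      have hK0 : 0 ≤ K := by positivity
      set g : ℝ → ℝ := fun z => K + d s.2 * (c' / J) + (b + max z (-c')) / J with hg
      have hd1 : (d (s.2 + 1) : ℝ) + 1 ≤ d s.2 := by exact_mod_cast hd _ hs
      have hd0 : (0 : ℝ) ≤ d (s.2 + 1) := Nat.cast_nonneg _
      have hgl : ∀ z, K + d (s.2 + 1) * (c' / J) ≤ g z := by
        intro z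
        have h2 : ((d (s.2 + 1) : ℝ) + 1) * (c' / J) ≤ d s.2 * (c' / J) := by gcongr
        have h3 : (0 + -c') / J ≤ (b + max z (-c')) / J := by
          gcongr; exact le_max_right _ _
        have h4 : (0 + -c') / J = -(c' / J) := by ring
        simp only [hg]
        linarith
      have hg0 : ∀ z, 0 ≤ g z := fun z => le_trans (by positivity) (hgl z)
      have hmx : Integrable (fun z => max z (-c')) μ := by
        by_contra hni
        rw [integral_undef hni] at hcJ
        exact lt_irrefl _ hcJ
      have hge : ∀ z, g z = K + d s.2 * (c' / J) + b / J + 1 / J * max z (-c') := by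
        intro z; simp only [hg]; ring
      have hgi : Integrable g μ := by
        rw [funext hge]
        exact (integrable_const _).add (hmx.const_mul _)
      have hval : ∫ z, g z ∂μ = W s - 1 := by
        simp_rw [hge]
        rw [integral_add (integrable_const _) (hmx.const_mul _), integral_const_mul]
        simp only [integral_const, probReal_univ, one_smul, hW, if_neg hs, ← hb]
        rw [show ∫ z, max z (-c') ∂μ = -J by rw [hJ, neg_neg]]
        field_simp
        ring
      have hnn : 0 ≤ W s - 1 := by
        rw [← hval]
        exact integral_nonneg hg0
      refine (one_add_lintegral_le_ofReal (g := g) (v := W s - 1) (fun z => ?_) hnn ?_).trans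
        (by simp)
      · split_ifs with hz
        · refine ENNReal.ofReal_le_ofReal ?_
          simp only [roundRobinStep, ← hb, hW] at hz ⊢
          rcases le_or_gt (b + z) 0 with hbz | hbz
          · rw [if_pos hbz, max_eq_right hbz]
            refine le_trans ?_ (hgl z)
            have h5 : 0 ≤ d (s.2 + 1) * (c' / J) := by positivity
            split_ifs with hu
            · simp only [sub_zero, mul_zero, neg_zero, Real.exp_zero, mul_one]
              linarith
            · rw [zero_div]
              linarith
          · rw [if_neg (not_le.2 hbz), if_neg hs, max_eq_left hbz.le]
            simp only [hg]
            gcongr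
            exact le_max_left _ _
        · exact zero_le
      · rw [← ofReal_integral_eq_lintegral_ofReal hgi (Eventually.of_forall hg0), hval]
  · intro s hsA
    have hb0 : 0 ≤ max s.1 0 := le_max_right _ _
    have e1 : (A + c) / I' ≤ A / I + c / I := by
      rw [← add_div]; gcongr
    simp only [hW]
    split_ifs with hs
    · rw [add_zero]
      refine ENNReal.ofReal_le_ofReal ?_
      have e2 : (A + c - max s.1 0) / I' ≤ (A + c) / I' := by gcongr; linarith
      have e3 : Real.exp (-((1 - θ) * max s.1 0)) ≤ 1 := by
        rw [Real.exp_le_one_iff]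
        have : 0 ≤ (1 - θ) * max s.1 0 := mul_nonneg (by linarith) hb0
        linarith
      have e4 : D₀ * Real.exp (-((1 - θ) * max s.1 0)) ≤ D₀ * 1 := by gcongr
      linarith
    · have e5 : ENNReal.ofReal (1 / J * s.1) = ENNReal.ofReal (max s.1 0 / J) := by
        rcases le_total s.1 0 with h6 | h6
        · rw [max_eq_right h6, zero_div, ENNReal.ofReal_zero, ENNReal.ofReal_of_nonpos]
          exact mul_nonpos_of_nonneg_of_nonpos (by positivity) h6
        · rw [max_eq_left h6]; congr 1; ring
      rw [e5, ← ENNReal.ofReal_add (by positivity) (by positivity)]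
      refine ENNReal.ofReal_le_ofReal ?_
      have e6 : d s.2 * (c' / J) ≤ q := by rw [hq]; gcongr; exact hdL _
      linarith

end Potential


/-! ### Resampling one coordinate of a sequence of independent variables -/

section Dependence

variable {Ξ X : Type*}

/-- Replace the `n`-th observation. -/
def resample (n : ℕ) (ω : Ξ × (ℕ → X)) (y : X) : Ξ × (ℕ → X) := (ω.1, Function.update ω.2 n y)

/-- `f` is a function of the randomization and of the first `n` observations. -/
def DependsOnFirst {β : Type*} (n : ℕ) (f : Ξ × (ℕ → X) → β) : Prop :=
  ∀ ω ω' : Ξ × (ℕ → X), ω.1 = ω'.1 → (∀ i < n, ω.2 i = ω'.2 i) → f ω = f ω'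

lemma DependsOnFirst.mono {β : Type*} {n k : ℕ} (hnk : n ≤ k) {f : Ξ × (ℕ → X) → β}
    (hf : DependsOnFirst n f) : DependsOnFirst k f :=
  fun ω ω' h1 h2 => hf ω ω' h1 fun i hi => h2 i (hi.trans_le hnk)

lemma DependsOnFirst.resample_eq {β : Type*} {n k : ℕ} (hnk : n ≤ k) {f : Ξ × (ℕ → X) → β}
    (hf : DependsOnFirst n f) (ω : Ξ × (ℕ → X)) (y : X) : f (resample k ω y) = f ω :=
  hf _ _ rfl fun i hi => by
    exact Function.update_of_ne (by omega) _ _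

lemma DependsOnFirst.comp {β γ : Type*} {n : ℕ} {f : Ξ × (ℕ → X) → β} (hf : DependsOnFirst n f)
    (g : β → γ) : DependsOnFirst n (fun ω => g (f ω)) :=
  fun ω ω' h1 h2 => congrArg g (hf ω ω' h1 h2)

lemma DependsOnFirst.comp₂ {β γ δ : Type*} {n : ℕ} {f : Ξ × (ℕ → X) → β} {g : Ξ × (ℕ → X) → γ}
    (hf : DependsOnFirst n f) (hg : DependsOnFirst n g) (k : β → γ → δ) :
    DependsOnFirst n (fun ω => k (f ω) (g ω)) :=
  fun ω ω' h1 h2 => by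
    simp only [hf ω ω' h1 h2, hg ω ω' h1 h2]

end Dependence

/-! ### Integration over one resampled coordinate -/

section Resampling

variable {X : Type*} [MeasurableSpace X]

lemma isProbabilityMeasure_update {μ : ℕ → Measure X} [hμ : ∀ i, IsProbabilityMeasure (μ i)]
    (n : ℕ) (P : Measure X) [hP : IsProbabilityMeasure P] (i : ℕ) :
    IsProbabilityMeasure (Function.update μ n P i) := by
  rcases eq_or_ne i n with rfl | hi
  · rwa [Function.update_self]
  · rw [Function.update_of_ne hi]; exact hμ i

lemma measurable_update_prod (n : ℕ) :
    Measurable fun p : (ℕ → X) × X => Function.update p.1 n p.2 := by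
  refine measurable_pi_lambda _ fun i => ?_
  rcases eq_or_ne i n with rfl | hi
  · simpa using measurable_snd
  · simp only [Function.update_of_ne hi]
    exact (measurable_pi_apply i).comp measurable_fst

lemma map_update_infinitePi_prod (μ : ℕ → Measure X) [hμ : ∀ i, IsProbabilityMeasure (μ i)]
    (n : ℕ) (P : Measure X) [IsProbabilityMeasure P] :
    ((Measure.infinitePi μ).prod P).map (fun p => Function.update p.1 n p.2) =
      Measure.infinitePi (Function.update μ n P) := by
  have := isProbabilityMeasure_update (μ := μ) n P
  refine Measure.eq_infinitePi _ fun s t ht => ?_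
  rw [Measure.map_apply (measurable_update_prod n)
    (MeasurableSet.pi s.countable_toSet fun i _ => ht i)]
  by_cases hn : n ∈ s
  · have : (fun p : (ℕ → X) × X => Function.update p.1 n p.2) ⁻¹' (Set.pi s t) =
        (Set.pi (s.erase n : Finset ℕ) t) ×ˢ t n := by
      ext p
      simp only [Set.mem_preimage, Set.mem_pi, Finset.mem_coe, Set.mem_prod, Finset.mem_erase]
      constructor
      · intro hp
        refine ⟨fun i hi => by simpa [Function.update_of_ne hi.1] using hp i hi.2, ?_⟩
        simpa using hp n hn
      · rintro ⟨h1, h2⟩ i hi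
        rcases eq_or_ne i n with rfl | hne
        · simpa using h2
        · simpa [Function.update_of_ne hne] using h1 i ⟨hne, hi⟩
    rw [this, Measure.prod_prod, Measure.infinitePi_pi _ (fun i _ => ht i),
      ← Finset.prod_erase_mul _ _ hn, Function.update_self]
    congr 1
    refine Finset.prod_congr rfl fun i hi => ?_
    rw [Function.update_of_ne (Finset.ne_of_mem_erase hi)]
  · have : (fun p : (ℕ → X) × X => Function.update p.1 n p.2) ⁻¹' (Set.pi s t) =
        (Set.pi s t) ×ˢ Set.univ := by
      ext p
      simp only [Set.mem_preimage, Set.mem_pi, Finset.mem_coe, Set.mem_prod, Set.mem_univ, and_true]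
      refine forall₂_congr fun i hi => ?_
      rw [Function.update_of_ne (by rintro rfl; exact hn hi)]
    rw [this, Measure.prod_prod, measure_univ, mul_one, Measure.infinitePi_pi _ (fun i _ => ht i)]
    refine Finset.prod_congr rfl fun i hi => ?_
    rw [Function.update_of_ne (by rintro rfl; exact hn hi)]

variable {Ξ : Type*} [MeasurableSpace Ξ]

lemma measurable_resample (n : ℕ) :
    Measurable fun p : (Ξ × (ℕ → X)) × X => resample n p.1 p.2 := by
  refine (measurable_fst.comp measurable_fst).prodMk ?_
  exact (measurable_update_prod n).comp ((measurable_snd.comp measurable_fst).prodMk measurable_snd)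

lemma lintegral_update (π : Measure Ξ) [SFinite π] (μ : ℕ → Measure X)
    [∀ i, IsProbabilityMeasure (μ i)] (n : ℕ) (P : Measure X) [IsProbabilityMeasure P]
    {f : Ξ × (ℕ → X) → ℝ≥0∞} (hf : Measurable f) :
    ∫⁻ ω, f ω ∂(π.prod (Measure.infinitePi (Function.update μ n P))) =
      ∫⁻ ω, ∫⁻ y, f (resample n ω y) ∂P ∂(π.prod (Measure.infinitePi μ)) := by
  have := isProbabilityMeasure_update (μ := μ) n P
  rw [lintegral_prod _ hf.aemeasurable, lintegral_prod]
  · refine lintegral_congr fun ξ => ?_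
    rw [← map_update_infinitePi_prod, lintegral_map (f := fun x => f (ξ, x))
      (hf.comp measurable_prodMk_left) (measurable_update_prod n), lintegral_prod]
    · rfl
    · exact ((hf.comp measurable_prodMk_left).comp (measurable_update_prod n)).aemeasurable
  · exact (Measurable.lintegral_prod_right' (hf.comp (measurable_resample n))).aemeasurable

lemma lintegral_resample (π : Measure Ξ) [SFinite π] (μ : ℕ → Measure X)
    [∀ i, IsProbabilityMeasure (μ i)] (n : ℕ)
    {f : Ξ × (ℕ → X) → ℝ≥0∞} (hf : Measurable f) :
    ∫⁻ ω, f ω ∂(π.prod (Measure.infinitePi μ)) =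
      ∫⁻ ω, ∫⁻ y, f (resample n ω y) ∂(μ n) ∂(π.prod (Measure.infinitePi μ)) := by
  have := lintegral_update π μ n (μ n) hf
  rwa [Function.update_eq_self] at this

/-- The expectation of a function of the first `n` observations only depends on their laws. -/
lemma lintegral_congr_of_dependsOnFirst (π : Measure Ξ) [SFinite π] {μ μ' : ℕ → Measure X}
    [∀ i, IsProbabilityMeasure (μ i)] [∀ i, IsProbabilityMeasure (μ' i)] {n : ℕ}
    (h : ∀ i < n, μ i = μ' i) {f : Ξ × (ℕ → X) → ℝ≥0∞} (hf : Measurable f)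
    (hd : DependsOnFirst n f) :
    ∫⁻ ω, f ω ∂(π.prod (Measure.infinitePi μ)) = ∫⁻ ω, f ω ∂(π.prod (Measure.infinitePi μ')) := by
  obtain ⟨x₀⟩ : Nonempty X := nonempty_of_isProbabilityMeasure (μ 0)
  -- The coordinates from `n` on are collapsed to a point. The function does not see this, and the
  -- collapsed product laws coincide.
  set τ : ℕ → X → X := fun i x => if i < n then x else x₀ with hτ
  have hτm : ∀ i, Measurable (τ i) := by
    intro i
    simp only [hτ]
    split_ifs
    · exact measurable_id
    · exact measurable_const
  have key : ∀ ν : ℕ → Measure X, (∀ i, IsProbabilityMeasure (ν i)) →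
      ∫⁻ ω, f ω ∂(π.prod (Measure.infinitePi ν)) =
        ∫⁻ ξ, ∫⁻ x, f (ξ, x) ∂(Measure.infinitePi fun i => (ν i).map (τ i)) ∂π := by
    intro ν hν
    rw [lintegral_prod _ hf.aemeasurable]
    refine lintegral_congr fun ξ => ?_
    have hτm' : Measurable fun (x : ℕ → X) i => τ i (x i) :=
      measurable_pi_lambda _ fun i => (hτm i).comp (measurable_pi_apply i)
    rw [← Measure.infinitePi_map_pi _ (fun i => hτm i), lintegral_map (f := fun x => f (ξ, x))
      (hf.comp measurable_prodMk_left) hτm']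
    refine lintegral_congr fun x => hd _ _ rfl fun i hi => ?_
    simp [hτ, hi]
  rw [key μ inferInstance, key μ' inferInstance]
  congr 3
  ext1 ξ
  congr 2
  funext i
  by_cases hi : i < n
  · rw [h i hi]
  · have : τ i = fun _ => x₀ := by ext x; simp [hτ, hi]
    rw [this, Measure.map_const, Measure.map_const, measure_univ, measure_univ]

end Resampling


/-! ### Conditional expectations given an event -/

section Conditioning

variable {Ω : Type*} {m m0 : MeasurableSpace Ω} {P : Measure Ω} [IsProbabilityMeasure P]

/-- A bound on averages over all events of the σ-algebra bounds the conditional expectation almost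
everywhere. The normalization by `P D` cancels, so no conditional law appears in the hypothesis. -/
lemma essSup_condLExp_cond_le (hm : m ≤ m0) {D : Set Ω} {X : Ω → ℝ≥0∞}
    {c : ℝ≥0∞} (h : ∀ B, MeasurableSet[m] B → ∫⁻ ω in B ∩ D, X ω ∂P ≤ c * P (B ∩ D)) :
    essSup (condLExp m (cond P D) X) (cond P D) ≤ c := by
  by_cases hD0 : P D = 0
  · rw [cond_eq_zero_of_meas_eq_zero hD0, essSup_measure_zero]
    exact bot_le
  have := cond_isProbabilityMeasure hD0
  refine essSup_le_of_ae_le _ (ae_of_ae_trim hm ?_)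
  refine ae_le_of_forall_setLIntegral_le_of_sigmaFinite (measurable_condLExp _ _ _) fun B hB _ => ?_
  rw [setLIntegral_trim hm (measurable_condLExp _ _ _) hB, setLIntegral_condLExp hm _ _ hB,
    setLIntegral_trim hm measurable_const hB, setLIntegral_const, ProbabilityTheory.cond, Measure.restrict_smul,
    Measure.restrict_restrict (hm _ hB), lintegral_smul_measure, Measure.smul_apply,
    Measure.restrict_apply (hm _ hB), smul_eq_mul, smul_eq_mul, mul_left_comm]
  gcongr
  exact h B hB

/-- The mean of the conditional expectation is at most its essential supremum, so for lower bounds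
the conditioning σ-algebra is irrelevant. -/
lemma lintegral_le_mul_essSup_condLExp_cond (hm : m ≤ m0) {D : Set Ω} (hD0 : P D ≠ 0)
    (X : Ω → ℝ≥0∞) :
    ∫⁻ ω in D, X ω ∂P ≤ P D * essSup (condLExp m (cond P D) X) (cond P D) := by
  have := cond_isProbabilityMeasure hD0
  have h1 : ∫⁻ ω, X ω ∂(cond P D) ≤ essSup (condLExp m (cond P D) X) (cond P D) := by
    rw [← lintegral_condLExp hm]
    calc _ ≤ ∫⁻ _, essSup (condLExp m (cond P D) X) (cond P D) ∂(cond P D) :=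
          lintegral_mono_ae (ENNReal.ae_le_essSup _)
      _ = _ := by simp
  rw [ProbabilityTheory.cond, lintegral_smul_measure, smul_eq_mul] at h1
  calc ∫⁻ ω in D, X ω ∂P = P D * ((P D)⁻¹ * ∫⁻ ω in D, X ω ∂P) := by
        rw [← mul_assoc, ENNReal.mul_inv_cancel hD0 (measure_ne_top _ _), one_mul]
    _ ≤ _ := by gcongr; exact h1

end Conditioning

/-! ### The information of a policy -/

section Information

variable {Ξ : Type*} {K : ℕ}

/-- The σ-algebra of the sets that do not separate points in relation `r`. -/
@[reducible]
def unseparatedSets {Ω : Type*} (r : Ω → Ω → Prop) : MeasurableSpace Ω where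
  MeasurableSet' B := ∀ ω ω', r ω ω' → (ω ∈ B ↔ ω' ∈ B)
  measurableSet_empty := fun _ _ _ => Iff.rfl
  measurableSet_compl := fun _ h ω ω' hr => not_congr (h ω ω' hr)
  measurableSet_iUnion := fun f h ω ω' hr => by
    simp only [Set.mem_iUnion]
    exact exists_congr fun i => h i ω ω' hr

/-- The sampling rule `S` leads to the same observations until time `n`. -/
def ObsEq (S : SamplingRule Ξ K) (n : ℕ) (ω ω' : Outcome Ξ K) : Prop :=
  ω.1 = ω'.1 ∧ ∀ i < n, S i ω = S i ω' ∧ ∀ j ∈ S i ω, ω.2 i j = ω'.2 i j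

lemma ObsEq.mono {S : SamplingRule Ξ K} {n k : ℕ} (hnk : n ≤ k) {ω ω' : Outcome Ξ K}
    (h : ObsEq S k ω ω') : ObsEq S n ω ω' :=
  ⟨h.1, fun i hi => h.2 i (hi.trans_le hnk)⟩

/-- Turns measurability with respect to the history into a pointwise statement: an event of the
history cannot distinguish outcomes with the same record of observations. It suffices to check the
generators. -/
lemma history_le_unseparatedSets [MeasurableSpace Ξ] (S : SamplingRule Ξ K) (n : ℕ) :
    history S n ≤ unseparatedSets (ObsEq S n) := by
  induction n with
  | zero =>
    rintro _ ⟨B, -, rfl⟩ ω ω' h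
    simp [h.1]
  | succ n ih =>
    refine sup_le (fun B hB ω ω' h => ih B hB ω ω' (h.mono (Nat.le_succ n))) ?_
    refine MeasurableSpace.generateFrom_le ?_
    rintro _ ⟨E, -, B, -, rfl⟩ ω ω' h
    obtain ⟨h1, h2⟩ := h.2 n (Nat.lt_succ_self n)
    simp only [Set.mem_ofPred_eq, ← h1]
    refine and_congr_right fun hE => ?_
    have : E.restrict (ω.2 n) = E.restrict (ω'.2 n) := by
      ext j
      exact h2 j (hE ▸ j.2)
    rw [this]

variable [MeasurableSpace Ξ]

lemma history_mono (S : SamplingRule Ξ K) : Monotone (history S) :=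
  monotone_nat_of_le_succ fun _ => le_sup_left

lemma sampleAlgebra_le {S : SamplingRule Ξ K} {i : ℕ}
    (h : ∀ E, MeasurableSet {ω | S i ω = E}) (𝒜 : Set (Finset (Fin K))) :
    sampleAlgebra S 𝒜 i ≤ (inferInstance : MeasurableSpace (Outcome Ξ K)) := by
  refine MeasurableSpace.generateFrom_le ?_
  rintro _ ⟨E, -, B, hB, rfl⟩
  refine (h E).inter ?_
  have : Measurable fun ω : Outcome Ξ K => E.restrict (ω.2 i) :=
    (Finset.measurable_restrict E).comp ((measurable_pi_apply i).comp measurable_snd)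
  exact this hB

namespace IsPolicy

variable {m : ℕ} {S : SamplingRule Ξ K} {T : AlarmTime Ξ K} (h : IsPolicy m S T)
include h

lemma history_le (n : ℕ) : history S n ≤ (inferInstance : MeasurableSpace (Outcome Ξ K)) := by
  induction n with
  | zero => exact measurable_fst.comap_le
  | succ n ih => exact sup_le ih (sampleAlgebra_le (fun E => ih _ (h.predictable n E)) _)

lemma affectedHistory_le (F G : Measure (Fin K → ℝ)) (n : ℕ) :
    affectedHistory m F G S n ≤ (inferInstance : MeasurableSpace (Outcome Ξ K)) :=
  iSup₂_le fun i _ => sampleAlgebra_le (fun E => h.history_le i _ (h.predictable i E)) _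

lemma sample_eq {n : ℕ} {ω ω' : Outcome Ξ K} (ho : ObsEq S n ω ω') : S n ω = S n ω' :=
  ((history_le_unseparatedSets S n _ (h.predictable n (S n ω)) ω ω' ho).1 rfl).symm

lemma obsEq_of_eq {n : ℕ} {ω ω' : Outcome Ξ K} (h1 : ω.1 = ω'.1) (h2 : ∀ i < n, ω.2 i = ω'.2 i) :
    ObsEq S n ω ω' := by
  induction n with
  | zero => exact ⟨h1, fun i hi => absurd hi (Nat.not_lt_zero i)⟩
  | succ n ih =>
    have hn := ih fun i hi => h2 i (by omega)
    refine ⟨h1, fun i hi => ?_⟩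
    rcases Nat.lt_succ_iff_lt_or_eq.1 hi with hi' | rfl
    · exact hn.2 i hi'
    · exact ⟨h.sample_eq hn, fun j _ => by rw [h2 i hi]⟩

/-- A new vector enters the record only through the coordinates sampled at that time, and the
earlier sampling decisions do not see it. -/
lemma obsEq_resample {n : ℕ} {ω ω' : Outcome Ξ K} (ho : ObsEq S n ω ω') {y y' : Fin K → ℝ}
    (hy : ∀ j ∈ S n ω, y j = y' j) :
    ObsEq S (n + 1) (resample n ω y) (resample n ω' y') := by
  have hr : ∀ (ω : Outcome Ξ K) (y : Fin K → ℝ), ∀ i ≤ n, S i (resample n ω y) = S i ω := by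
    intro ω y i hi
    refine h.sample_eq (h.obsEq_of_eq rfl fun j hj => ?_)
    exact Function.update_of_ne (by omega) _ _
  refine ⟨ho.1, fun i hi => ?_⟩
  rw [hr ω y i (by omega), hr ω' y' i (by omega)]
  rcases Nat.lt_succ_iff_lt_or_eq.1 hi with hi' | rfl
  · refine ⟨(ho.2 i hi').1, fun j hj => ?_⟩
    simpa [resample, Function.update_of_ne hi'.ne] using (ho.2 i hi').2 j hj
  · refine ⟨h.sample_eq ho, fun j hj => ?_⟩
    simpa [resample] using hy j hj

lemma measurableSet_history_lt (n : ℕ) : MeasurableSet[history S n] {ω | (n : ℕ∞) < T ω} := by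
  have : {ω | (n : ℕ∞) < T ω} = (⋃ k ∈ Finset.range (n + 1), {ω | T ω = (k : ℕ)})ᶜ := by
    ext ω
    simp only [Set.mem_ofPred_eq, Set.mem_compl_iff, Set.mem_iUnion, Finset.mem_range, not_exists]
    constructor
    · intro hn k hk hT
      rw [hT] at hn
      have : n < k := by exact_mod_cast hn
      omega
    · intro hn
      by_contra hlt
      obtain ⟨k, hk⟩ := ENat.ne_top_iff_exists.1 (ne_top_of_le_ne_top (ENat.natCast_ne_top n)
        (not_lt.1 hlt))
      rw [← hk] at hlt
      refine hn k ?_ hk.symm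
      have : k ≤ n := by exact_mod_cast not_lt.1 hlt
      omega
  rw [this]
  refine MeasurableSet.compl (Finset.measurableSet_biUnion _ fun k hk => ?_)
  exact history_mono S (Nat.lt_succ_iff.1 (Finset.mem_range.1 hk)) _ (h.stopping k)

lemma measurableSet_lt (n : ℕ) : MeasurableSet {ω | (n : ℕ∞) < T ω} :=
  h.history_le n _ (h.measurableSet_history_lt n)

end IsPolicy

end Information

/-! ### A change-of-measure inequality -/

section ChangeOfMeasure

variable {Ξ : Type*} [MeasurableSpace Ξ] {K : ℕ}

/-- `ℓ` is the logarithm of the density of `Q` with respect to `P`, and has law `μ` under `P`. -/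
def HasLLRLaw {X : Type*} [MeasurableSpace X] (P Q : Measure X) (μ : Measure ℝ) (ℓ : X → ℝ) :
    Prop :=
  Measurable ℓ ∧ P.map ℓ = μ ∧ Q = P.withDensity fun x => ENNReal.ofReal (Real.exp (ℓ x))

/-- Hölder's inequality for the density `e^ℓ`, whose `a`-th moment is `mgf id μ a`. The assumption
`1 ≤ C` covers the unaffected case, where the density is one. -/
lemma lintegral_le_of_hasLLRLaw {X : Type*} [MeasurableSpace X] {P Q : Measure X}
    [IsProbabilityMeasure P] {μ : Measure ℝ} (hPQ : Q = P ∨ ∃ ℓ, HasLLRLaw P Q μ ℓ)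
    {a b : ℝ} (hab : a.HolderConjugate b) {C : ℝ} (hC1 : 1 ≤ C) (hC : mgf id μ a ≤ C)
    (hi : Integrable (fun z => Real.exp (a * z)) μ) {g : X → ℝ≥0∞} (hg : Measurable g) :
    ∫⁻ x, g x ∂Q ≤ ENNReal.ofReal C ^ (1 / a) * (∫⁻ x, g x ^ b ∂P) ^ (1 / b) := by
  have ha := hab.pos
  rcases hPQ with rfl | ⟨ℓ, hℓm, hℓ, rfl⟩
  · have := ENNReal.lintegral_mul_le_Lp_mul_Lq Q hab (f := fun _ => 1) measurable_const.aemeasurable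
      hg.aemeasurable
    simp only [Pi.mul_apply, one_mul, ENNReal.one_rpow, lintegral_one, measure_univ] at this
    refine this.trans ?_
    nth_rw 1 [← one_mul ((∫⁻ x, g x ^ b ∂Q) ^ (1 / b))]
    gcongr
    refine ENNReal.one_le_rpow ?_ (by positivity)
    simpa using hC1
  · have hem : Measurable fun x => ENNReal.ofReal (Real.exp (ℓ x)) := by fun_prop
    rw [lintegral_withDensity_eq_lintegral_mul _ hem hg]
    refine (ENNReal.lintegral_mul_le_Lp_mul_Lq P hab hem.aemeasurable hg.aemeasurable).trans ?_
    gcongr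
    calc ∫⁻ x, ENNReal.ofReal (Real.exp (ℓ x)) ^ a ∂P
        = ∫⁻ z, ENNReal.ofReal (Real.exp (a * z)) ∂μ := by
          rw [← hℓ, lintegral_map (by fun_prop) hℓm]
          refine lintegral_congr fun x => ?_
          rw [ENNReal.ofReal_rpow_of_pos (Real.exp_pos _), ← Real.exp_mul, mul_comm]
      _ = ENNReal.ofReal (mgf id μ a) := by
          rw [← ofReal_integral_eq_lintegral_ofReal hi
            (Eventually.of_forall fun z => (Real.exp_pos _).le)]
          rfl
      _ ≤ _ := ENNReal.ofReal_le_ofReal hC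

/-- An integrand that sees only the sources in `E` factors through the restriction to `E`; the other
coordinates may be set to zero. -/
lemma lintegral_le_of_localLaw {F G : Measure (Fin K → ℝ)} [IsProbabilityMeasure F]
    {E : Finset (Fin K)} {μ : Measure ℝ}
    (hFG : localLaw G E = localLaw F E ∨ ∃ ℓ, HasLLRLaw (localLaw F E) (localLaw G E) μ ℓ)
    {a b : ℝ} (hab : a.HolderConjugate b) {C : ℝ} (hC1 : 1 ≤ C) (hC : mgf id μ a ≤ C)
    (hi : Integrable (fun z => Real.exp (a * z)) μ) {g : (Fin K → ℝ) → ℝ≥0∞} (hg : Measurable g)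
    (hE : ∀ y y', (∀ j ∈ E, y j = y' j) → g y = g y') :
    ∫⁻ x, g x ∂G ≤ ENNReal.ofReal C ^ (1 / a) * (∫⁻ x, g x ^ b ∂F) ^ (1 / b) := by
  have hrm : Measurable (E.restrict : (Fin K → ℝ) → (E → ℝ)) := Finset.measurable_restrict E
  have : IsProbabilityMeasure (localLaw F E) := Measure.isProbabilityMeasure_map hrm.aemeasurable
  set e : (E → ℝ) → (Fin K → ℝ) := fun w j => if hj : j ∈ E then w ⟨j, hj⟩ else 0 with he
  have hem : Measurable e := by
    refine measurable_pi_lambda _ fun j => ?_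
    by_cases hj : j ∈ E
    · simpa [he, hj] using measurable_pi_apply (⟨j, hj⟩ : E)
    · simp [he, hj]
  have hge : ∀ x, g x = g (e (E.restrict x)) := fun x => hE _ _ fun j hj => by simp [he, hj]
  have h1 := lintegral_le_of_hasLLRLaw hFG hab hC1 hC hi (hg.comp hem)
  rw [localLaw, localLaw, lintegral_map (hg.comp hem) hrm,
    lintegral_map ((hg.comp hem).pow_const b) hrm] at h1
  simpa [← hge] using h1

variable {π : Measure Ξ} [IsProbabilityMeasure π] {F G : Measure (Fin K → ℝ)}
  [IsProbabilityMeasure F] [IsProbabilityMeasure G] {S : SamplingRule Ξ K} {T : AlarmTime Ξ K}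

/-- The probabilities of observable events before and after the change are comparable. -/
theorem lintegral_le_of_observable (hp : IsPolicy 2 S T) {μ : Measure ℝ}
    (hFG : ∀ E : Finset (Fin K), E.card = 2 →
      localLaw G E = localLaw F E ∨ ∃ ℓ, HasLLRLaw (localLaw F E) (localLaw G E) μ ℓ)
    {a b : ℝ} (hab : a.HolderConjugate b) {C : ℝ} (hC1 : 1 ≤ C) (hC : mgf id μ a ≤ C)
    (hi : Integrable (fun z => Real.exp (a * z)) μ) {ν : ℕ} {D : Set (Outcome Ξ K)}
    (hD : MeasurableSet[history S ν] D) (m : ℕ) :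
    ∀ f : Outcome Ξ K → ℝ≥0∞, Measurable f →
      (∀ ω ω', ObsEq S (ν + m) ω ω' → f ω = f ω') → (∀ ω ∉ D, f ω = 0) →
      ∫⁻ ω, f ω ∂(π.prod (Measure.infinitePi fun i => if ν ≤ i ∧ i < ν + m then G else F)) ≤
        (ENNReal.ofReal C ^ (1 / a)) ^ m * (∫⁻ ω, f ω ^ b ∂(noChangeLaw π F)) ^ (1 / b) *
          noChangeLaw π F D ^ (1 / a) := by
  have hprob : ∀ (m i : ℕ), IsProbabilityMeasure (if ν ≤ i ∧ i < ν + m then G else F) := by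
    intro m i; split_ifs <;> infer_instance
  have hDm := hp.history_le ν _ hD
  have ha := hab.pos
  have hb := hab.symm.pos
  induction m with
  | zero =>
    intro f hf _ hf0
    have h1 : (fun i => if ν ≤ i ∧ i < ν + 0 then G else F) = fun _ => F := by
      ext i; rw [if_neg (by omega)]
    rw [h1, ← noChangeLaw, pow_zero, one_mul]
    -- Hölder against the indicator of `D` produces the factor `P(D)^{1/a}`, which makes the final
    -- estimate conditional on `D`.
    have h2 := ENNReal.lintegral_mul_le_Lp_mul_Lq (noChangeLaw π F) hab.symm hf.aemeasurable
      ((measurable_const (a := (1 : ℝ≥0∞))).indicator hDm).aemeasurable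
    have h3 : ∫⁻ ω, (D.indicator (fun _ => (1 : ℝ≥0∞)) ω) ^ a ∂(noChangeLaw π F) =
        noChangeLaw π F D := by
      rw [← lintegral_indicator_one hDm]
      refine lintegral_congr fun ω => ?_
      by_cases hω : ω ∈ D <;> simp [hω, ha]
    rw [h3] at h2
    refine le_trans (lintegral_mono fun ω => ?_) h2
    by_cases hω : ω ∈ D
    · simp [hω]
    · simp [hf0 ω hω]
  | succ m ih =>
    intro f hf hfo hf0
    have h1 : (fun i => if ν ≤ i ∧ i < ν + (m + 1) then G else F) =
        Function.update (fun i => if ν ≤ i ∧ i < ν + m then G else F) (ν + m) G := by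
      ext1 i
      rcases eq_or_ne i (ν + m) with rfl | hne
      · rw [Function.update_self, if_pos (by omega)]
      · rw [Function.update_of_ne hne]
        congr 1
        exact propext (by omega)
    have := hprob m
    rw [h1, lintegral_update π _ _ G hf]
    -- The `b`-norm over the last observation under `F`. One post-change observation is traded for
    -- it at the price `C^{1/a}`, and the integral of `g ^ b` equals that of `f ^ b`, so the
    -- induction loses nothing else.
    set g : Outcome Ξ K → ℝ≥0∞ := fun ω =>
      (∫⁻ y, f (resample (ν + m) ω y) ^ b ∂F) ^ (1 / b) with hg
    have hgb : ∀ ω, g ω ^ b = ∫⁻ y, f (resample (ν + m) ω y) ^ b ∂F := by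
      intro ω
      rw [hg, ← ENNReal.rpow_mul, one_div_mul_cancel hb.ne', ENNReal.rpow_one]
    have hgm : Measurable g :=
      (Measurable.lintegral_prod_right' ((hf.comp (measurable_resample _)).pow_const b)).pow_const _
    have hstep : ∀ ω, ∫⁻ y, f (resample (ν + m) ω y) ∂G ≤ ENNReal.ofReal C ^ (1 / a) * g ω := by
      intro ω
      refine lintegral_le_of_localLaw (hFG _ (hp.size (ν + m) ω)) hab hC1 hC hi
        (hf.comp ((measurable_resample _).comp measurable_prodMk_left)) fun y y' hy => ?_
      exact hfo _ _ (hp.obsEq_resample (hp.obsEq_of_eq rfl fun _ _ => rfl) hy)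
    have hI := ih g hgm (fun ω ω' ho => by
        simp only [hg]
        congr 1
        refine lintegral_congr fun y => ?_
        rw [hfo _ _ (hp.obsEq_resample ho fun _ _ => rfl)])
      (fun ω hω => by
        have : ∀ y, f (resample (ν + m) ω y) = 0 := by
          intro y
          refine hf0 _ fun hmem => hω ?_
          refine (history_le_unseparatedSets S ν _ hD (resample (ν + m) ω y) ω
            (hp.obsEq_of_eq rfl fun i hi => ?_)).1 hmem
          exact Function.update_of_ne (by omega) _ _
        simp [hg, this, hb, ENNReal.zero_rpow_of_pos])
    have hR : ∫⁻ ω, g ω ^ b ∂(noChangeLaw π F) = ∫⁻ ω, f ω ^ b ∂(noChangeLaw π F) := by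
      simp_rw [hgb]
      exact (lintegral_resample π (fun _ => F) (ν + m) (hf.pow_const b)).symm
    rw [hR] at hI
    calc _ ≤ ∫⁻ ω, ENNReal.ofReal C ^ (1 / a) * g ω ∂(π.prod (Measure.infinitePi
          fun i => if ν ≤ i ∧ i < ν + m then G else F)) := lintegral_mono hstep
      _ = ENNReal.ofReal C ^ (1 / a) * ∫⁻ ω, g ω ∂(π.prod (Measure.infinitePi
          fun i => if ν ≤ i ∧ i < ν + m then G else F)) := lintegral_const_mul _ hgm
      _ ≤ _ := mul_le_mul_right hI _
      _ = _ := by rw [pow_succ]; ring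

end ChangeOfMeasure


/-! ### The universal lower bound for the delay -/

section LowerBound

lemma natCast_le_tsum_ite_lt (T : ℕ∞) {m : ℕ} (hm : 0 < m) :
    (T : ℝ≥0∞) ≤ ∑' j : ℕ, if ((j * m : ℕ) : ℕ∞) < T then (m : ℝ≥0∞) else 0 := by
  induction T using ENat.recTopCoe with
  | top =>
    have : (∑' j : ℕ, if ((j * m : ℕ) : ℕ∞) < ⊤ then (m : ℝ≥0∞) else 0) = ⊤ := by
      have : ∀ j : ℕ, (if ((j * m : ℕ) : ℕ∞) < ⊤ then (m : ℝ≥0∞) else 0) = m := fun j =>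
        if_pos (ENat.natCast_lt_top _)
      simp_rw [this]
      exact ENNReal.tsum_const_eq_top_of_ne_zero (by exact_mod_cast hm.ne')
    rw [this]
    exact le_top
  | coe k =>
    rcases Nat.eq_zero_or_pos k with rfl | hk
    · simp
    refine le_trans ?_ (ENNReal.sum_le_tsum (Finset.range ((k - 1) / m + 1)))
    have h1 : ∀ j ∈ Finset.range ((k - 1) / m + 1),
        (if ((j * m : ℕ) : ℕ∞) < (k : ℕ∞) then (m : ℝ≥0∞) else 0) = m := by
      intro j hj
      refine if_pos ?_
      have h2 : j * m ≤ k - 1 := (Nat.le_div_iff_mul_le hm).1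
        (Nat.lt_succ_iff.1 (Finset.mem_range.1 hj))
      exact_mod_cast (show j * m < k by omega)
    rw [Finset.sum_congr rfl h1, Finset.sum_const, Finset.card_range, nsmul_eq_mul]
    have h3 : k ≤ ((k - 1) / m + 1) * m := by
      have := Nat.lt_div_mul_add (a := k - 1) hm
      have h4 : ((k - 1) / m + 1) * m = (k - 1) / m * m + m := by ring
      omega
    exact_mod_cast h3

variable {Ξ : Type*} [MeasurableSpace Ξ] {K : ℕ} {π : Measure Ξ} [IsProbabilityMeasure π]
  {F G : Measure (Fin K → ℝ)} [IsProbabilityMeasure F] [IsProbabilityMeasure G]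

instance : IsProbabilityMeasure (noChangeLaw π F) := by
  unfold noChangeLaw; infer_instance

instance (ν : ℕ) : IsProbabilityMeasure (changeLaw π F G ν) := by
  have : ∀ i, IsProbabilityMeasure (if i < ν then F else G) := by
    intro i; split_ifs <;> infer_instance
  unfold changeLaw; infer_instance

/-- Some window of length `m` carries a small conditional false alarm probability. -/
lemma exists_window {m' : ℕ} {S : SamplingRule Ξ K} {T : AlarmTime Ξ K} (hp : IsPolicy m' S T)
    {γ : ℝ} (hγ : ENNReal.ofReal γ ≤ ∫⁻ ω, (T ω : ℝ≥0∞) ∂(noChangeLaw π F)) {m : ℕ} (hm : 0 < m)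
    (hmγ : 2 * m < γ) : ∃ ν : ℕ, noChangeLaw π F {ω | (ν : ℕ∞) < T ω} ≠ 0 ∧
      noChangeLaw π F {ω | (ν : ℕ∞) < T ω ∧ ¬ ((ν + m : ℕ) : ℕ∞) < T ω} ≤
        ENNReal.ofReal (2 * m / γ) * noChangeLaw π F {ω | (ν : ℕ∞) < T ω} := by
  -- Otherwise the survival probability over successive blocks of length `m` would shrink at least
  -- by the factor `1 - 2m/γ`, and the mean of `T` would be at most `γ/2`.
  by_contra hcon
  push Not at hcon
  set P := noChangeLaw π F with hP
  have hm0 : (0 : ℝ) < m := by exact_mod_cast hm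
  have hγ0 : 0 < γ := by linarith
  set r : ℝ := 1 - 2 * m / γ with hr
  have hr0 : 0 ≤ r := by
    rw [hr, sub_nonneg, div_le_one hγ0]; exact hmγ.le
  have hr1 : r < 1 := by
    have : 0 < 2 * m / γ := by positivity
    linarith
  have hstep : ∀ ν : ℕ, P {ω | ((ν + m : ℕ) : ℕ∞) < T ω} ≤
      ENNReal.ofReal r * P {ω | (ν : ℕ∞) < T ω} := by
    intro ν
    have hsub : {ω | ((ν + m : ℕ) : ℕ∞) < T ω} ⊆ {ω | (ν : ℕ∞) < T ω} := fun ω hω =>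
      show (ν : ℕ∞) < T ω from
        lt_of_le_of_lt (show ((ν : ℕ) : ℕ∞) ≤ ((ν + m : ℕ) : ℕ∞) from Nat.cast_le.2 (Nat.le_add_right ν m)) hω
    by_cases h0 : P {ω | (ν : ℕ∞) < T ω} = 0
    · rw [measure_mono_null hsub h0]; exact zero_le
    have h1 := (hcon ν h0).le
    have h2 : {ω | (ν : ℕ∞) < T ω ∧ T ω ≤ ((ν + m : ℕ) : ℕ∞)} =
        {ω | (ν : ℕ∞) < T ω} \ {ω | ((ν + m : ℕ) : ℕ∞) < T ω} := by
      ext ω; exact and_congr_right fun _ => not_lt.symm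
    rw [h2] at h1
    have h3 := measure_sdiff_add_inter (μ := P) {ω | (ν : ℕ∞) < T ω}
      (hp.measurableSet_lt (ν + m))
    rw [Set.inter_eq_self_of_subset_right hsub] at h3
    have h5 : ENNReal.ofReal (2 * m / γ) * P {ω | (ν : ℕ∞) < T ω} ≠ ⊤ :=
      ENNReal.mul_ne_top ENNReal.ofReal_ne_top (measure_ne_top _ _)
    have h4 : ENNReal.ofReal (2 * m / γ) * P {ω | (ν : ℕ∞) < T ω} +
        P {ω | ((ν + m : ℕ) : ℕ∞) < T ω} ≤ ENNReal.ofReal (2 * m / γ) * P {ω | (ν : ℕ∞) < T ω} +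
        ENNReal.ofReal r * P {ω | (ν : ℕ∞) < T ω} := by
      rw [← add_mul, ← ENNReal.ofReal_add (by positivity) hr0, hr, add_sub_cancel,
        ENNReal.ofReal_one, one_mul]
      exact (add_le_add h1 le_rfl).trans_eq h3
    exact (ENNReal.add_le_add_iff_left h5).1 h4
  have hpow : ∀ j : ℕ, P {ω | ((j * m : ℕ) : ℕ∞) < T ω} ≤ ENNReal.ofReal r ^ j := by
    intro j
    induction j with
    | zero => simpa using prob_le_one
    | succ j ih =>
      have := hstep (j * m)
      rw [← Nat.succ_mul] at this
      refine this.trans ?_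
      rw [pow_succ']
      gcongr
  have hfin : ∫⁻ ω, (T ω : ℝ≥0∞) ∂P ≤ ENNReal.ofReal (γ / 2) := by
    calc _ ≤ ∫⁻ ω, ∑' j : ℕ, (if ((j * m : ℕ) : ℕ∞) < T ω then (m : ℝ≥0∞) else 0) ∂P :=
          lintegral_mono fun ω => natCast_le_tsum_ite_lt _ hm
      _ = ∑' j : ℕ, m * P {ω | ((j * m : ℕ) : ℕ∞) < T ω} := by
          rw [lintegral_tsum fun j => (Measurable.ite (hp.measurableSet_lt _) measurable_const
            measurable_const).aemeasurable]
          refine tsum_congr fun j => ?_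
          rw [← lintegral_indicator_const (hp.measurableSet_lt _)]
          refine lintegral_congr fun ω => ?_
          simp [Set.indicator_apply]
      _ ≤ ∑' j : ℕ, m * ENNReal.ofReal r ^ j := by
          gcongr with j; exact hpow j
      _ = m * (1 - ENNReal.ofReal r)⁻¹ := by rw [ENNReal.tsum_mul_left, ENNReal.tsum_geometric]
      _ = ENNReal.ofReal (γ / 2) := by
          have h1 : 1 - ENNReal.ofReal r = ENNReal.ofReal (2 * m / γ) := by
            rw [← ENNReal.ofReal_one, ← ENNReal.ofReal_sub _ hr0]
            congr 1; rw [hr]; ring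
          rw [h1, ← ENNReal.ofReal_inv_of_pos (by positivity), ← ENNReal.ofReal_natCast,
            ← ENNReal.ofReal_mul hm0.le]
          congr 1
          field_simp
  have := hγ.trans hfin
  rw [ENNReal.ofReal_le_ofReal_iff (by positivity)] at this
  linarith

/-- Every policy with mean time `γ` to a false alarm has delay at least `c * log γ`, if `c` is less
than the inverse of the information number. -/
theorem eventually_le_delay {μ : Measure ℝ} (h : IsLLRLaw μ)
    (hFG : ∀ E : Finset (Fin K), E.card = 2 →
      localLaw G E = localLaw F E ∨ ∃ ℓ, HasLLRLaw (localLaw F E) (localLaw G E) μ ℓ)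
    {c : ℝ} (hc0 : 0 < c) (hc : c * ∫ z, z * Real.exp z ∂μ < 1) :
    ∀ᶠ γ in atTop, ∀ p ∈ falseAlarmClass π 2 F γ,
      ENNReal.ofReal (c * Real.log γ) ≤ delay π 2 F G p := by
  set I₀ := ∫ z, z * Real.exp z ∂μ with hI₀
  have hI₀0 : 0 < I₀ := h.integral_mul_exp_pos
  obtain ⟨c', hcc', hc'⟩ : ∃ c', c < c' ∧ c' * I₀ < 1 := by
    obtain ⟨c', h1, h2⟩ := exists_between ((lt_div_iff₀ hI₀0).2 hc)
    exact ⟨c', h1, (lt_div_iff₀ hI₀0).1 h2⟩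
  have hc'0 : 0 < c' := hc0.trans hcc'
  -- The slack between `c` and `c'` pays for the small probability of an alarm in the window; the
  -- slack between `I₀` and `I` pays for an exponent `1 + s` larger than one.
  obtain ⟨I, hI₀I, hI⟩ : ∃ I, I₀ < I ∧ c' * I < 1 := by
    obtain ⟨I, h1, h2⟩ := exists_between ((lt_div_iff₀' hc'0).2 hc')
    exact ⟨I, h1, (lt_div_iff₀' hc'0).1 h2⟩
  have hI0 : 0 < I := hI₀0.trans hI₀I
  obtain ⟨s, hs, hsI, hsi⟩ := h.exists_mgf_le hI₀I
  set η : ℝ := 1 - c / c' with hη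
  have hη0 : 0 < η := by
    rw [hη, sub_pos, div_lt_one hc'0]; exact hcc'
  -- the probability of an alarm in the window is eventually small
  have hlim : ∀ᶠ γ in atTop, (Real.exp (I * (c' * Real.log γ + 1)) * (2 * (c' * Real.log γ + 1) / γ))
      ^ (s / (1 + s)) ≤ η := by
    have h1 : Tendsto (fun x : ℝ => Real.exp (I * (c' * x + 1)) * (2 * (c' * x + 1) * Real.exp (-x)))
        atTop (𝓝 0) := by
      have h2 : Tendsto (fun x : ℝ => 2 * c' * Real.exp I * (x ^ 1 * Real.exp (-((1 - c' * I) * x)))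
          + 2 * Real.exp I * Real.exp (-((1 - c' * I) * x))) atTop
          (𝓝 (2 * c' * Real.exp I * 0 + 2 * Real.exp I * 0)) := by
        have hpos : 0 < 1 - c' * I := by linarith
        have hl : Tendsto (fun x : ℝ => (1 - c' * I) * x) atTop atTop :=
          tendsto_id.const_mul_atTop hpos
        refine Tendsto.add (Tendsto.const_mul _ ?_) (Tendsto.const_mul _
          (Real.tendsto_exp_neg_atTop_nhds_zero.comp hl))
        have h3 := ((Real.tendsto_pow_mul_exp_neg_atTop_nhds_zero 1).comp hl).const_mul
          (1 - c' * I)⁻¹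
        rw [mul_zero] at h3
        refine h3.congr fun x => ?_
        simp only [Function.comp, pow_one]
        field_simp
      simp only [mul_zero, add_zero] at h2
      refine h2.congr fun x => ?_
      rw [show -((1 - c' * I) * x) = I * (c' * x) + -x by ring, Real.exp_add,
        show I * (c' * x + 1) = I * (c' * x) + I by ring, Real.exp_add]
      ring
    have h2 := (h1.comp Real.tendsto_log_atTop).rpow_const (p := s / (1 + s))
      (Or.inr (by positivity))
    rw [Real.zero_rpow (by positivity)] at h2
    filter_upwards [h2.eventually (ge_mem_nhds hη0), eventually_gt_atTop 0] with γ hγ hγ0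
    simp only [Function.comp, Real.exp_neg, Real.exp_log hγ0] at hγ
    rwa [div_eq_mul_inv]
  have hlim2 : ∀ᶠ γ in atTop, 2 * (c' * Real.log γ + 1) < γ := by
    have h1 : Tendsto (fun x : ℝ => x ^ 1 * Real.exp (-x)) atTop (𝓝 0) :=
      Real.tendsto_pow_mul_exp_neg_atTop_nhds_zero 1
    have h2 : Tendsto (fun x : ℝ => 2 * c' * (x ^ 1 * Real.exp (-x)) + 2 * Real.exp (-x)) atTop
        (𝓝 (2 * c' * 0 + 2 * 0)) :=
      (h1.const_mul _).add (Real.tendsto_exp_neg_atTop_nhds_zero.const_mul _)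
    simp only [mul_zero, add_zero] at h2
    filter_upwards [(h2.comp Real.tendsto_log_atTop).eventually (gt_mem_nhds one_pos),
      eventually_gt_atTop 0] with γ hγ hγ0
    simp only [Function.comp, Real.exp_neg, Real.exp_log hγ0, pow_one] at hγ
    have := mul_lt_mul_of_pos_right hγ hγ0
    field_simp at this
    linarith
  filter_upwards [hlim, hlim2, eventually_gt_atTop 1] with γ hγη hγm hγ1 p hpγ
  obtain ⟨S, T⟩ := p
  obtain ⟨hp, hγT⟩ := hpγ
  have hlog : 0 < Real.log γ := Real.log_pos hγ1
  set m := ⌈c' * Real.log γ⌉₊ with hm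
  have hm0 : 0 < m := Nat.ceil_pos.2 (by positivity)
  have hml : c' * Real.log γ ≤ m := Nat.le_ceil _
  have hmu : (m : ℝ) ≤ c' * Real.log γ + 1 := (Nat.ceil_lt_add_one (by positivity)).le
  obtain ⟨ν, hν0, hν⟩ := exists_window hp hγT hm0 (by linarith)
  set D : Set (Outcome Ξ K) := {ω | (ν : ℕ∞) < T ω} with hD
  set B : Set (Outcome Ξ K) := {ω | (ν : ℕ∞) < T ω ∧ ¬ ((ν + m : ℕ) : ℕ∞) < T ω} with hB
  have hDh := hp.measurableSet_history_lt ν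
  have hBh : MeasurableSet[history S (ν + m)] B :=
    (history_mono S (Nat.le_add_right ν m) _ hDh).inter
      (hp.measurableSet_history_lt (ν + m)).compl
  have hDm := hp.measurableSet_lt ν
  have hBm := hp.history_le _ _ hBh
  have hprob1 : ∀ i, IsProbabilityMeasure (if i < ν then F else G) := by
    intro i; split_ifs <;> infer_instance
  have hprob2 : ∀ i, IsProbabilityMeasure (if ν ≤ i ∧ i < ν + m then G else F) := by
    intro i; split_ifs <;> infer_instance
  -- Whether the alarm comes after `ν` is decided by the first `ν` observations, which have law `F`
  -- in both models.
  have hDeq : changeLaw π F G ν D = noChangeLaw π F D := by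
    rw [← lintegral_indicator_one hDm, ← lintegral_indicator_one hDm]
    refine lintegral_congr_of_dependsOnFirst π (n := ν) (fun i hi => if_pos hi)
      (measurable_one.indicator hDm) fun ω ω' h1 h2 => ?_
    have := history_le_unseparatedSets S ν _ hDh _ _ (hp.obsEq_of_eq h1 h2)
    by_cases hω : ω ∈ D
    · rw [Set.indicator_of_mem hω, Set.indicator_of_mem (this.1 hω)]; rfl
    · rw [Set.indicator_of_notMem hω, Set.indicator_of_notMem (fun hh => hω (this.2 hh))]
  have hBeq : changeLaw π F G ν B = (π.prod (Measure.infinitePi fun i =>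
      if ν ≤ i ∧ i < ν + m then G else F)) B := by
    rw [← lintegral_indicator_one hBm, ← lintegral_indicator_one hBm]
    refine lintegral_congr_of_dependsOnFirst π (n := ν + m) (fun i hi => ?_)
      (measurable_one.indicator hBm) fun ω ω' h1 h2 => ?_
    · by_cases hiν : i < ν
      · rw [if_pos hiν, if_neg (by omega)]
      · rw [if_neg hiν, if_pos (by omega)]
    · have := history_le_unseparatedSets S (ν + m) _ hBh _ _ (hp.obsEq_of_eq h1 h2)
      by_cases hω : ω ∈ B
      · rw [Set.indicator_of_mem hω, Set.indicator_of_mem (this.1 hω)]; rfl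
      · rw [Set.indicator_of_notMem hω, Set.indicator_of_notMem (fun hh => hω (this.2 hh))]
  have hab : (1 + s).HolderConjugate ((1 + s) / s) := by
    rw [Real.holderConjugate_iff]
    exact ⟨by linarith, by field_simp⟩
  -- The change of measure bounds this by `(e^{Im} · 2m/γ)^{s/(1+s)}` times the probability of `D`.
  -- As `m ≤ c' log γ + 1` and `c' I < 1`, the factor is at most `η` for large `γ`.
  have hBle : changeLaw π F G ν B ≤ ENNReal.ofReal η * noChangeLaw π F D := by
    rw [hBeq, ← lintegral_indicator_one hBm]
    refine (lintegral_le_of_observable hp hFG hab (C := 1 + s * I) (by nlinarith) hsI hsi hDh m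
      (B.indicator 1) (measurable_one.indicator hBm) (fun ω ω' ho => ?_) (fun ω hω =>
        Set.indicator_of_notMem (fun hh => hω hh.1) _)).trans ?_
    · have := history_le_unseparatedSets S (ν + m) _ hBh _ _ ho
      by_cases hω : ω ∈ B
      · rw [Set.indicator_of_mem hω, Set.indicator_of_mem (this.1 hω)]; rfl
      · rw [Set.indicator_of_notMem hω, Set.indicator_of_notMem (fun hh => hω (this.2 hh))]
    · have hpw : ∫⁻ ω, (B.indicator (1 : Outcome Ξ K → ℝ≥0∞) ω) ^ ((1 + s) / s)
          ∂(noChangeLaw π F) = noChangeLaw π F B := by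
        rw [← lintegral_indicator_one hBm]
        refine lintegral_congr fun ω => ?_
        have : 0 < (1 + s) / s := by positivity
        by_cases hω : ω ∈ B <;> simp [hω, this]
      rw [hpw]
      have hq0 : 0 < 2 * m / γ := by
        have : (0 : ℝ) < m := by exact_mod_cast hm0
        positivity
      calc _ ≤ (ENNReal.ofReal (1 + s * I) ^ (1 / (1 + s))) ^ m *
            (ENNReal.ofReal (2 * m / γ) * noChangeLaw π F D) ^ (1 / ((1 + s) / s)) *
            noChangeLaw π F D ^ (1 / (1 + s)) := by gcongr
        _ = ENNReal.ofReal (((1 + s * I) ^ (1 / (1 + s))) ^ m * (2 * m / γ) ^ (s / (1 + s))) *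
            noChangeLaw π F D := by
          rw [ENNReal.mul_rpow_of_nonneg _ _ (by positivity), one_div_div,
            ENNReal.ofReal_mul (by positivity), ENNReal.ofReal_pow (by positivity),
            ENNReal.ofReal_rpow_of_pos (by positivity), ENNReal.ofReal_rpow_of_pos (by positivity)]
          rw [mul_assoc, mul_assoc, ← ENNReal.rpow_add_of_nonneg _ _ (by positivity)
            (by positivity), ← add_div, add_comm s 1, div_self (by positivity), ENNReal.rpow_one,
            mul_assoc]
        _ ≤ ENNReal.ofReal η * noChangeLaw π F D := by
          gcongr
          refine le_trans ?_ hγη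
          have e1 : ((1 + s * I) ^ (1 / (1 + s))) ^ m ≤ Real.exp (I * m) ^ (s / (1 + s)) := by
            calc ((1 + s * I) ^ (1 / (1 + s))) ^ m
                ≤ ((Real.exp (s * I)) ^ (1 / (1 + s))) ^ m := by
                  gcongr
                  linarith [Real.add_one_le_exp (s * I)]
              _ = Real.exp (I * m) ^ (s / (1 + s)) := by
                  rw [← Real.exp_mul, ← Real.exp_mul, ← Real.exp_nat_mul]
                  congr 1
                  ring
          calc _ ≤ Real.exp (I * m) ^ (s / (1 + s)) * (2 * m / γ) ^ (s / (1 + s)) := by gcongr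
            _ = (Real.exp (I * m) * (2 * m / γ)) ^ (s / (1 + s)) :=
              (Real.mul_rpow (Real.exp_pos _).le hq0.le).symm
            _ ≤ _ := by gcongr
  have hPD0 : changeLaw π F G ν D ≠ 0 := by rwa [hDeq]
  have hlow := lintegral_le_mul_essSup_condLExp_cond (P := changeLaw π F G ν)
    (hp.affectedHistory_le F G ν) hPD0 (fun ω => (T ω : ℝ≥0∞) - (ν : ℝ≥0∞))
  have hle : essSup (condLExp (affectedHistory 2 F G S ν) (ProbabilityTheory.cond
      (changeLaw π F G ν) D) (fun ω => (T ω : ℝ≥0∞) - (ν : ℝ≥0∞)))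
      (ProbabilityTheory.cond (changeLaw π F G ν) D) ≤ delay π 2 F G (S, T) :=
    le_iSup (fun ν : ℕ => essSup (condLExp (affectedHistory 2 F G S ν) (ProbabilityTheory.cond
      (changeLaw π F G ν) {ω | (ν : ℕ∞) < T ω}) (fun ω => (T ω : ℝ≥0∞) - (ν : ℝ≥0∞)))
      (ProbabilityTheory.cond (changeLaw π F G ν) {ω | (ν : ℕ∞) < T ω})) ν
  refine le_trans ?_ hle
  rw [← ENNReal.mul_le_mul_iff_right hPD0 (measure_ne_top _ _)]
  refine le_trans ?_ hlow
  have hsplit : changeLaw π F G ν D ≤ changeLaw π F G ν B +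
      changeLaw π F G ν {ω | ((ν + m : ℕ) : ℕ∞) < T ω} := by
    refine le_trans (measure_mono fun ω hω => ?_) (measure_union_le _ _)
    by_cases h1 : ((ν + m : ℕ) : ℕ∞) < T ω
    · exact Or.inr h1
    · exact Or.inl ⟨hω, h1⟩
  -- Since `1 - η = c / c'`, with at least this conditional probability the delay exceeds `m ≥ c'
  -- log γ`.
  have hC : ENNReal.ofReal (c / c') * changeLaw π F G ν D ≤
      changeLaw π F G ν {ω | ((ν + m : ℕ) : ℕ∞) < T ω} := by
    have hne : ENNReal.ofReal η * noChangeLaw π F D ≠ ⊤ :=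
      ENNReal.mul_ne_top ENNReal.ofReal_ne_top (measure_ne_top _ _)
    refine (ENNReal.add_le_add_iff_left hne).1 ?_
    rw [hDeq, ← add_mul, ← ENNReal.ofReal_add hη0.le (by positivity), hη, sub_add_cancel,
      ENNReal.ofReal_one, one_mul, ← hDeq]
    exact hsplit.trans (add_le_add (by rw [← hη, hDeq]; exact hBle) le_rfl)
  calc changeLaw π F G ν D * ENNReal.ofReal (c * Real.log γ)
      ≤ changeLaw π F G ν D * (ENNReal.ofReal (c / c') * m) := by
        gcongr
        rw [← ENNReal.ofReal_natCast, ← ENNReal.ofReal_mul (by positivity)]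
        refine ENNReal.ofReal_le_ofReal ?_
        calc c * Real.log γ = c / c' * (c' * Real.log γ) := by field_simp
          _ ≤ _ := by gcongr
    _ = m * (ENNReal.ofReal (c / c') * changeLaw π F G ν D) := by ring
    _ ≤ m * changeLaw π F G ν {ω | ((ν + m : ℕ) : ℕ∞) < T ω} := by gcongr
    _ = ∫⁻ ω in D, ({ω | ((ν + m : ℕ) : ℕ∞) < T ω}).indicator (fun _ => (m : ℝ≥0∞)) ω
          ∂(changeLaw π F G ν) := by
        rw [lintegral_indicator_const (hp.measurableSet_lt _),
          Measure.restrict_apply (hp.measurableSet_lt _), Set.inter_eq_self_of_subset_left]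
        exact fun ω hω => show (ν : ℕ∞) < T ω from
        lt_of_le_of_lt (show ((ν : ℕ) : ℕ∞) ≤ ((ν + m : ℕ) : ℕ∞) from Nat.cast_le.2 (Nat.le_add_right ν m)) hω
    _ ≤ _ := by
        refine lintegral_mono fun ω => ?_
        by_cases hω : ((ν + m : ℕ) : ℕ∞) < T ω
        · rw [Set.indicator_of_mem (by exact hω)]
          refine ENNReal.le_sub_of_add_le_left (ENNReal.natCast_ne_top ν) ?_
          have : ((ν + m : ℕ) : ℝ≥0∞) ≤ (T ω : ℝ≥0∞) := by
            rw [← ENat.toENNReal_coe]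
            exact ENat.toENNReal_mono hω.le
          exact_mod_cast this
        · rw [Set.indicator_of_notMem (by exact hω)]
          exact zero_le

end LowerBound


/-! ### The round robin statistic as a function of the path -/

section RoundRobinPath

variable {Ξ : Type*} {K : ℕ} (F : Measure (Fin K → ℝ))
  (𝒢 : Set (Measure (Fin K → ℝ))) {L : ℕ} [NeZero L] (unit : Fin L → Finset (Fin K))

lemma measurable_increment (E : Finset (Fin K)) : Measurable (increment F 𝒢 E) :=
  (measurable_llr _ _).comp (Finset.measurable_restrict E)

lemma roundRobinState_succ (x : ℕ → Fin K → ℝ) (n : ℕ) :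
    roundRobinState F 𝒢 unit x (n + 1) = roundRobinStep (roundRobinState F 𝒢 unit x n)
      (increment F 𝒢 (unit (roundRobinState F 𝒢 unit x n).2) (x n)) := rfl

lemma dependsOnFirst_roundRobinState (n : ℕ) :
    DependsOnFirst n fun ω : Outcome Ξ K => roundRobinState F 𝒢 unit ω.2 n := by
  induction n with
  | zero => exact fun _ _ _ _ => rfl
  | succ n ih =>
    intro ω ω' h1 h2
    have := ih ω ω' h1 fun i hi => h2 i (by omega)
    simp only at this
    simp only [roundRobinState_succ, this, h2 n (by omega)]

/-- The outcomes for which the round robin statistic stays below `A` until time `n`. -/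
def belowThreshold (A : ℝ) (n : ℕ) : Set (Outcome Ξ K) :=
  {ω | ∀ k ≤ n, (roundRobinState F 𝒢 unit ω.2 k).1 < A}

lemma belowThreshold_succ (A : ℝ) (n : ℕ) :
    belowThreshold (Ξ := Ξ) F 𝒢 unit A (n + 1) = belowThreshold F 𝒢 unit A n ∩
      {ω | (roundRobinState F 𝒢 unit ω.2 (n + 1)).1 < A} := by
  ext ω
  constructor
  · exact fun h => ⟨fun k hk => h k (by omega), h _ le_rfl⟩
  · rintro ⟨h1, h2⟩ k hk
    rcases Nat.le_succ_iff.1 hk with hk | rfl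
    · exact h1 k hk
    · exact h2

lemma belowThreshold_zero {A : ℝ} (hA : 0 < A) :
    belowThreshold (Ξ := Ξ) F 𝒢 unit A 0 = Set.univ := by
  ext ω
  simp only [belowThreshold, Nat.le_zero, Set.mem_ofPred_eq, forall_eq, Set.mem_univ, iff_true]
  exact hA

lemma dependsOnFirst_belowThreshold (A : ℝ) (n : ℕ) :
    DependsOnFirst n fun ω : Outcome Ξ K => ω ∈ belowThreshold F 𝒢 unit A n := by
  intro ω ω' h1 h2
  refine propext (forall₂_congr fun k hk => ?_)
  have : roundRobinState F 𝒢 unit ω.2 k = roundRobinState F 𝒢 unit ω'.2 k :=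
    (dependsOnFirst_roundRobinState F 𝒢 unit k).mono hk ω ω' h1 h2
  rw [this]

lemma lt_roundRobin_iff {A : ℝ} (hA : 0 < A) (n : ℕ) (ω : Outcome Ξ K) :
    (n : ℕ∞) < (roundRobin Ξ F 𝒢 unit A).2 ω ↔ ω ∈ belowThreshold F 𝒢 unit A n := by
  constructor
  · intro h k hk
    by_contra hc
    rcases Nat.eq_zero_or_pos k with rfl | hk0
    · exact hc hA
    have h1 : (roundRobin Ξ F 𝒢 unit A).2 ω ≤ (k : ℕ∞) := iInf₂_le k ⟨hk0, not_lt.1 hc⟩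
    exact absurd (h.trans_le (h1.trans (Nat.cast_le.2 hk))) (lt_irrefl _)
  · intro h
    refine lt_of_lt_of_le (b := ((n + 1 : ℕ) : ℕ∞)) (Nat.cast_lt.2 n.lt_succ_self) ?_
    refine le_iInf₂ fun k hk => Nat.cast_le.2 ?_
    by_contra hc
    exact absurd (h k (by omega)) (not_lt.2 hk.2)

variable [MeasurableSpace Ξ]

lemma measurable_roundRobinStep_comp {Ω : Type*} [MeasurableSpace Ω] {f : Ω → ℝ × Fin L}
    {g : Ω → ℝ} (hf : Measurable f) (hg : Measurable g) :
    Measurable fun ω => roundRobinStep (f ω) (g ω) :=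
  measurable_roundRobinStep.comp (hf.prodMk hg)

lemma measurable_comp_of_finite_index {Ω X ι : Type*} [MeasurableSpace Ω] [MeasurableSpace X]
    [MeasurableSpace ι] [Countable ι] [MeasurableSingletonClass ι] {f : ι → X → ℝ}
    (hf : ∀ u, Measurable (f u)) {u : Ω → ι} {x : Ω → X} (hu : Measurable u) (hx : Measurable x) :
    Measurable fun ω => f (u ω) (x ω) := by
  have h : Measurable fun p : ι × X => f p.1 p.2 :=
    measurable_from_prod_countable_right fun u => hf u
  exact h.comp (hu.prodMk hx)

lemma measurable_increment_comp {u : Outcome Ξ K → Fin L} (hu : Measurable u) (n : ℕ) :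
    Measurable fun ω : Outcome Ξ K => increment F 𝒢 (unit (u ω)) (ω.2 n) :=
  measurable_comp_of_finite_index (f := fun u => increment F 𝒢 (unit u))
    (fun u => measurable_increment F 𝒢 (unit u)) hu ((measurable_pi_apply n).comp measurable_snd)

lemma measurable_roundRobinState (n : ℕ) :
    Measurable fun ω : Outcome Ξ K => roundRobinState F 𝒢 unit ω.2 n := by
  induction n with
  | zero => exact measurable_const
  | succ n ih =>
    simp only [roundRobinState_succ]
    exact measurable_roundRobinStep_comp ih
      (measurable_increment_comp F 𝒢 unit (measurable_snd.comp ih) n)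

lemma measurableSet_belowThreshold (A : ℝ) (n : ℕ) :
    MeasurableSet (belowThreshold (Ξ := Ξ) F 𝒢 unit A n) := by
  have : belowThreshold (Ξ := Ξ) F 𝒢 unit A n =
      ⋂ k ∈ Set.Iic n, {ω : Outcome Ξ K | (roundRobinState F 𝒢 unit ω.2 k).1 < A} := by
    ext ω; simp [belowThreshold]
  rw [this]
  exact MeasurableSet.biInter (Set.to_countable _) fun k _ =>
    measurableSet_lt (measurable_fst.comp (measurable_roundRobinState F 𝒢 unit k))
      measurable_const

/-- The Markov property of the round robin statistic. -/
lemma lintegral_mul_increment (π : Measure Ξ) [SFinite π] {μ : ℕ → Measure (Fin K → ℝ)}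
    [∀ i, IsProbabilityMeasure (μ i)] {n : ℕ} {κ : Fin L → Measure ℝ}
    (hκ : ∀ u, (μ n).map (increment F 𝒢 (unit u)) = κ u) {f : Outcome Ξ K → ℝ≥0∞}
    (hf : Measurable f) (hd : DependsOnFirst n f) {k : ℝ × Fin L → ℝ → ℝ≥0∞}
    (hk : Measurable fun p : (ℝ × Fin L) × ℝ => k p.1 p.2) :
    ∫⁻ ω, f ω * k (roundRobinState F 𝒢 unit ω.2 n)
        (increment F 𝒢 (unit (roundRobinState F 𝒢 unit ω.2 n).2) (ω.2 n))
        ∂(π.prod (Measure.infinitePi μ)) =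
      ∫⁻ ω, f ω * ∫⁻ z, k (roundRobinState F 𝒢 unit ω.2 n) z
        ∂(κ (roundRobinState F 𝒢 unit ω.2 n).2) ∂(π.prod (Measure.infinitePi μ)) := by
  have hs := measurable_roundRobinState (Ξ := Ξ) F 𝒢 unit n
  rw [lintegral_resample π μ n]
  · refine lintegral_congr fun ω => ?_
    have h1 : ∀ y, roundRobinState F 𝒢 unit (resample n ω y).2 n =
        roundRobinState F 𝒢 unit ω.2 n :=
      fun y => (dependsOnFirst_roundRobinState (Ξ := Ξ) F 𝒢 unit n).resample_eq le_rfl ω y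
    have h2 : ∀ y, (resample n ω y).2 n = y := fun y => Function.update_self _ _ _
    simp only [h1, h2, hd.resample_eq le_rfl ω]
    have hk' : Measurable (k (roundRobinState F 𝒢 unit ω.2 n)) := hk.comp measurable_prodMk_left
    rw [lintegral_const_mul, ← hκ, lintegral_map hk' (measurable_increment F 𝒢 _)]
    exact hk'.comp (measurable_increment F 𝒢 _)
  · exact hf.mul (hk.comp (hs.prodMk
      (measurable_increment_comp F 𝒢 unit (measurable_snd.comp hs) n)))

/-! ### Round robin policies and the false alarm constraint -/

/-- The increment uses only the values of the unit being sampled; splitting according to the sampled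
set exhibits its preimages as countable unions of generators of the history. -/
lemma measurable_history_roundRobinState (A : ℝ) (n : ℕ) :
    Measurable[history (roundRobin Ξ F 𝒢 unit A).1 n]
      fun ω : Outcome Ξ K => roundRobinState F 𝒢 unit ω.2 n := by
  set S := (roundRobin Ξ F 𝒢 unit A).1 with hS
  induction n with
  | zero => exact measurable_const
  | succ n ih =>
    have h1 : Measurable[history S (n + 1)]
        fun ω : Outcome Ξ K => roundRobinState F 𝒢 unit ω.2 n :=
      fun B hB => history_mono S n.le_succ _ (ih hB)
    have h2 : Measurable[history S (n + 1)] fun ω : Outcome Ξ K =>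
        increment F 𝒢 (unit (roundRobinState F 𝒢 unit ω.2 n).2) (ω.2 n) := by
      intro B hB
      have : (fun ω : Outcome Ξ K =>
          increment F 𝒢 (unit (roundRobinState F 𝒢 unit ω.2 n).2) (ω.2 n)) ⁻¹' B =
          ⋃ E : Finset (Fin K), {ω | S n ω = E ∧ E.restrict (ω.2 n) ∈
            llr (mixtureLaw F 𝒢 E) (localLaw F E) ⁻¹' B} := by
        ext ω
        simp only [Set.mem_preimage, Set.mem_iUnion, Set.mem_ofPred_eq, exists_eq_left']
        rfl
      rw [this]
      refine MeasurableSet.iUnion fun E => ?_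
      have hle : sampleAlgebra S Set.univ n ≤ history S (n + 1) := le_sup_right
      exact hle _ (MeasurableSpace.measurableSet_generateFrom
        ⟨E, trivial, _, measurable_llr _ _ hB, rfl⟩)
    simp only [roundRobinState_succ]
    exact measurable_roundRobinStep.comp (h1.prodMk h2)

theorem isPolicy_roundRobin {m : ℕ} (hunit : ∀ u, (unit u).card = m) {A : ℝ} (hA : 0 < A) :
    IsPolicy m (roundRobin Ξ F 𝒢 unit A).1 (roundRobin Ξ F 𝒢 unit A).2 where
  size n ω := hunit _
  predictable n E :=
    (measurable_history_roundRobinState F 𝒢 unit A n) (measurable_snd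
      (MeasurableSet.of_discrete (s := {u : Fin L | unit u = E})))
  pos ω := le_iInf₂ fun k hk => by exact_mod_cast hk.1
  stopping n := by
    set S := (roundRobin Ξ F 𝒢 unit A).1 with hS
    have hbelow : ∀ k ≤ n, MeasurableSet[history S n] (belowThreshold (Ξ := Ξ) F 𝒢 unit A k) := by
      intro k hk
      have : belowThreshold (Ξ := Ξ) F 𝒢 unit A k =
          ⋂ j ∈ Set.Iic k, {ω : Outcome Ξ K | (roundRobinState F 𝒢 unit ω.2 j).1 < A} := by
        ext ω; simp [belowThreshold]
      rw [this]
      refine MeasurableSet.biInter (Set.to_countable _) fun j hj => ?_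
      refine history_mono S (le_trans hj hk) _ ?_
      exact measurable_history_roundRobinState F 𝒢 unit A j
        (measurableSet_lt measurable_fst measurable_const)
    rcases n with _ | n
    · have : {ω | (roundRobin Ξ F 𝒢 unit A).2 ω = ((0 : ℕ) : ℕ∞)} = ∅ := by
        ext ω
        simp only [Set.mem_ofPred_eq, Set.mem_empty_iff_false, iff_false]
        have := (lt_roundRobin_iff F 𝒢 unit hA 0 ω).2
          (by rw [belowThreshold_zero F 𝒢 unit hA]; trivial)
        exact this.ne'
      rw [this]
      exact @MeasurableSet.empty _ (history S 0)
    · have : {ω | (roundRobin Ξ F 𝒢 unit A).2 ω = ((n + 1 : ℕ) : ℕ∞)} =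
          belowThreshold F 𝒢 unit A n \ belowThreshold F 𝒢 unit A (n + 1) := by
        ext ω
        rw [Set.mem_sdiff, ← lt_roundRobin_iff F 𝒢 unit hA, ← lt_roundRobin_iff F 𝒢 unit hA,
          Set.mem_ofPred_eq, not_lt]
        generalize (roundRobin Ξ F 𝒢 unit A).2 ω = T
        rw [← Order.add_one_le_iff_of_not_isMax (by simp), Nat.cast_add, Nat.cast_one,
          eq_comm, le_antisymm_iff]
      rw [this]
      exact (hbelow n n.le_succ).diff (hbelow (n + 1) le_rfl)

end RoundRobinPath


/-! ### The exponential of the statistic and the mean time to a false alarm -/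

section FalseAlarm

lemma DependsOnFirst.indicator {Ξ X : Type*} {n : ℕ} {s : Set (Ξ × (ℕ → X))}
    (h : DependsOnFirst n fun ω => ω ∈ s) (c : ℝ≥0∞) :
    DependsOnFirst n (s.indicator fun _ => c) := by
  classical
  intro ω ω' h1 h2
  have : (ω ∈ s) = (ω' ∈ s) := h ω ω' h1 h2
  simp only [Set.indicator_apply, this]

lemma sum_ite_lt_le (T : ℕ∞) (n : ℕ) :
    ∑ k ∈ Finset.range n, (if (k : ℕ∞) < T then (1 : ℝ≥0∞) else 0) ≤ T := by
  induction T using ENat.recTopCoe with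
  | top => simp
  | coe t =>
    have : ∑ k ∈ Finset.range n, (if (k : ℕ∞) < (t : ℕ∞) then (1 : ℝ≥0∞) else 0) =
        (((Finset.range n).filter (· < t)).card : ℝ≥0∞) := by
      simp
    rw [this, ENat.toENNReal_coe]
    refine Nat.cast_le.2 ?_
    calc _ ≤ (Finset.range t).card := Finset.card_le_card fun k hk => by
          simpa using (Finset.mem_filter.1 hk).2
      _ = t := Finset.card_range t

variable {Ξ : Type*} [MeasurableSpace Ξ] {K : ℕ} {F : Measure (Fin K → ℝ)} [IsProbabilityMeasure F]
  {𝒢 : Set (Measure (Fin K → ℝ))} {L : ℕ} [NeZero L] {unit : Fin L → Finset (Fin K)}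
  {π : Measure Ξ} [IsProbabilityMeasure π] {μ : Measure ℝ}

lemma one_le_exp_max (y : ℝ) : Real.exp (max y 0) ≤ Real.exp y + 1 := by
  rcases le_total y 0 with h | h
  · rw [max_eq_right h, Real.exp_zero]; linarith [Real.exp_pos y]
  · rw [max_eq_left h]; linarith

/-- Before the change, `exp (max Y 0)` is the conditional mean of the exponential of the next value,
whichever unit is sampled. At an alarm that exponential is at least `exp A`. -/
lemma falseAlarm_step (hκ : ∀ u, F.map (increment F 𝒢 (unit u)) = μ)
    (hμ : ∫⁻ z, ENNReal.ofReal (Real.exp z) ∂μ = 1) (A : ℝ) (n : ℕ) :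
    ENNReal.ofReal (Real.exp A) * noChangeLaw π F
        (belowThreshold F 𝒢 unit A n \ belowThreshold F 𝒢 unit A (n + 1)) +
      ∫⁻ ω in belowThreshold F 𝒢 unit A (n + 1),
        ENNReal.ofReal (Real.exp (roundRobinState F 𝒢 unit ω.2 (n + 1)).1) ∂(noChangeLaw π F) ≤
    ∫⁻ ω in belowThreshold F 𝒢 unit A n,
        ENNReal.ofReal (Real.exp (max (roundRobinState F 𝒢 unit ω.2 n).1 0))
        ∂(noChangeLaw π F) := by
  have hm := measurableSet_belowThreshold (Ξ := Ξ) F 𝒢 unit A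
  have hsub : belowThreshold (Ξ := Ξ) F 𝒢 unit A (n + 1) ⊆ belowThreshold F 𝒢 unit A n := by
    rw [belowThreshold_succ]; exact Set.inter_subset_left
  have hY : Measurable fun ω : Outcome Ξ K =>
      ENNReal.ofReal (Real.exp (roundRobinState F 𝒢 unit ω.2 (n + 1)).1) :=
    ((measurable_fst.comp (measurable_roundRobinState F 𝒢 unit (n + 1))).exp).ennreal_ofReal
  have h1 := lintegral_mul_increment F 𝒢 unit π (μ := fun _ => F) (n := n) (κ := fun _ => μ) hκ
    (f := (belowThreshold F 𝒢 unit A n).indicator fun _ => 1)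
    (measurable_const.indicator (hm n))
    ((dependsOnFirst_belowThreshold F 𝒢 unit A n).indicator 1)
    (k := fun s z => ENNReal.ofReal (Real.exp (max s.1 0 + z))) (by fun_prop)
  have h2 : ∀ s : ℝ × Fin L, ∫⁻ z, ENNReal.ofReal (Real.exp (max s.1 0 + z)) ∂μ =
      ENNReal.ofReal (Real.exp (max s.1 0)) := by
    intro s
    simp_rw [Real.exp_add, ENNReal.ofReal_mul (Real.exp_pos _).le]
    rw [lintegral_const_mul _ (by fun_prop), hμ, mul_one]
  simp only [h2] at h1
  have h3 : ∀ g : Outcome Ξ K → ℝ≥0∞,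
      ∫⁻ ω in belowThreshold F 𝒢 unit A n, g ω ∂(noChangeLaw π F) =
      ∫⁻ ω, (belowThreshold F 𝒢 unit A n).indicator (fun _ => 1) ω * g ω
        ∂(π.prod (Measure.infinitePi fun _ => F)) := by
    intro g
    rw [← lintegral_indicator (hm n)]
    refine lintegral_congr fun ω => ?_
    by_cases hω : ω ∈ belowThreshold (Ξ := Ξ) F 𝒢 unit A n <;> simp [hω]
  rw [h3, ← h1, ← h3]
  change _ ≤ ∫⁻ ω in belowThreshold F 𝒢 unit A n,
    ENNReal.ofReal (Real.exp (roundRobinState F 𝒢 unit ω.2 (n + 1)).1) ∂(noChangeLaw π F)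
  conv_rhs => rw [← Set.sdiff_union_of_subset hsub]
  rw [lintegral_union (hm (n + 1)) Set.disjoint_sdiff_left]
  refine add_le_add ?_ le_rfl
  rw [← setLIntegral_const]
  refine setLIntegral_mono hY fun ω hω => ENNReal.ofReal_le_ofReal (Real.exp_le_exp.2 ?_)
  by_contra hc
  refine hω.2 ?_
  rw [belowThreshold_succ]
  exact ⟨hω.1, not_le.1 hc⟩

/-- As `exp (max y 0) ≤ exp y + 1`, resetting at zero adds at most the probability of no alarm so
far. Summation gives `γ P(T ≤ n + 1) ≤ ∑_{k ≤ n} P(T > k) ≤ E[T]`. -/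
theorem roundRobin_mem_falseAlarmClass {m : ℕ} (hunit : ∀ u, (unit u).card = m)
    (hκ : ∀ u, F.map (increment F 𝒢 (unit u)) = μ)
    (hμ : ∫⁻ z, ENNReal.ofReal (Real.exp z) ∂μ = 1) {γ : ℝ} (hγ : 1 < γ) :
    roundRobin Ξ F 𝒢 unit (Real.log γ) ∈ falseAlarmClass π m F γ := by
  have hA : 0 < Real.log γ := Real.log_pos hγ
  have hpol := isPolicy_roundRobin (Ξ := Ξ) F 𝒢 unit hunit hA
  refine ⟨hpol, ?_⟩
  set A := Real.log γ with hAdef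
  set P := noChangeLaw π F with hP
  set D : ℕ → Set (Outcome Ξ K) := belowThreshold F 𝒢 unit A with hD
  have hm : ∀ n, MeasurableSet (D n) := measurableSet_belowThreshold (Ξ := Ξ) F 𝒢 unit A
  have hexpA : Real.exp A = γ := Real.exp_log (by linarith)
  have hsub : ∀ n, D (n + 1) ⊆ D n := fun n => by
    rw [hD, belowThreshold_succ]; exact Set.inter_subset_left
  have hstep : ∀ n, ENNReal.ofReal γ * P (D n \ D (n + 1)) +
      ∫⁻ ω in D (n + 1), ENNReal.ofReal (Real.exp (roundRobinState F 𝒢 unit ω.2 (n + 1)).1) ∂P ≤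
      ∫⁻ ω in D n, ENNReal.ofReal (Real.exp (max (roundRobinState F 𝒢 unit ω.2 n).1 0)) ∂P := by
    intro n
    have := falseAlarm_step (π := π) hκ hμ A n
    rwa [hexpA] at this
  have hsum : ∀ n, ENNReal.ofReal γ * P (D (n + 1))ᶜ +
      ∫⁻ ω in D (n + 1), ENNReal.ofReal (Real.exp (roundRobinState F 𝒢 unit ω.2 (n + 1)).1) ∂P ≤
      ∑ k ∈ Finset.range (n + 1), P (D k) := by
    intro n
    induction n with
    | zero =>
      have h0 : D 0 = Set.univ := belowThreshold_zero F 𝒢 unit hA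
      have := hstep 0
      rw [h0, ← Set.compl_eq_univ_sdiff] at this
      refine this.trans ?_
      rw [Finset.sum_range_one, h0]
      simp [roundRobinState]
    | succ n ih =>
      rw [Finset.sum_range_succ]
      refine le_trans ?_ (add_le_add_left ih _)
      have h1 : P (D (n + 2))ᶜ ≤ P (D (n + 1))ᶜ + P (D (n + 1) \ D (n + 2)) := by
        refine le_trans (measure_mono fun ω hω => ?_) (measure_union_le _ _)
        by_cases h : ω ∈ D (n + 1)
        · exact Or.inr ⟨h, hω⟩
        · exact Or.inl h
      have h2 : ∫⁻ ω in D (n + 1),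
          ENNReal.ofReal (Real.exp (max (roundRobinState F 𝒢 unit ω.2 (n + 1)).1 0)) ∂P ≤
          ∫⁻ ω in D (n + 1),
            ENNReal.ofReal (Real.exp (roundRobinState F 𝒢 unit ω.2 (n + 1)).1) ∂P +
            P (D (n + 1)) := by
        calc _ ≤ ∫⁻ ω in D (n + 1),
              (ENNReal.ofReal (Real.exp (roundRobinState F 𝒢 unit ω.2 (n + 1)).1) + 1) ∂P := by
              refine lintegral_mono fun ω => ?_
              rw [← ENNReal.ofReal_one, ← ENNReal.ofReal_add (Real.exp_pos _).le zero_le_one]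
              exact ENNReal.ofReal_le_ofReal (one_le_exp_max _)
          _ = _ := by
              rw [lintegral_add_right _ measurable_const, setLIntegral_one]
      calc _ ≤ ENNReal.ofReal γ * (P (D (n + 1))ᶜ + P (D (n + 1) \ D (n + 2))) +
            ∫⁻ ω in D (n + 2),
              ENNReal.ofReal (Real.exp (roundRobinState F 𝒢 unit ω.2 (n + 2)).1) ∂P := by
            gcongr
        _ = ENNReal.ofReal γ * P (D (n + 1))ᶜ + (ENNReal.ofReal γ * P (D (n + 1) \ D (n + 2)) +
            ∫⁻ ω in D (n + 2),
              ENNReal.ofReal (Real.exp (roundRobinState F 𝒢 unit ω.2 (n + 2)).1) ∂P) := by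
            rw [mul_add, add_assoc]
        _ ≤ _ := by
            rw [add_assoc]
            exact add_le_add le_rfl ((hstep (n + 1)).trans h2)
  have hT : ∀ (n : ℕ) ω, (n : ℕ∞) < (roundRobin Ξ F 𝒢 unit A).2 ω ↔ ω ∈ D n :=
    fun n ω => lt_roundRobin_iff F 𝒢 unit hA n ω
  have hle : ∀ n, ENNReal.ofReal γ * P (D (n + 1))ᶜ ≤
      ∫⁻ ω, ((roundRobin Ξ F 𝒢 unit A).2 ω : ℝ≥0∞) ∂P := by
    intro n
    refine le_self_add.trans ((hsum n).trans ?_)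
    calc _ = ∫⁻ ω, ∑ k ∈ Finset.range (n + 1), (D k).indicator 1 ω ∂P := by
          rw [lintegral_finsetSum _ fun k _ => measurable_one.indicator (hm k)]
          exact Finset.sum_congr rfl fun k _ => (lintegral_indicator_one (hm k)).symm
      _ ≤ _ := by
          refine lintegral_mono fun ω => le_trans (le_of_eq ?_) (sum_ite_lt_le _ (n + 1))
          refine Finset.sum_congr rfl fun k _ => ?_
          classical
          simp only [hT, Set.indicator_apply, Pi.one_apply]
  have hmono : Monotone fun n => (D (n + 1))ᶜ :=
    monotone_nat_of_le_succ fun n => Set.compl_subset_compl.2 (hsub (n + 1))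
  have hlim : ENNReal.ofReal γ * P (⋃ n, (D (n + 1))ᶜ) ≤
      ∫⁻ ω, ((roundRobin Ξ F 𝒢 unit A).2 ω : ℝ≥0∞) ∂P := by
    rw [hmono.measure_iUnion, ENNReal.mul_iSup]
    exact iSup_le hle
  have hcompl : (⋃ n, (D (n + 1))ᶜ)ᶜ =
      {ω | ((roundRobin Ξ F 𝒢 unit A).2 ω : ℝ≥0∞) = ⊤} := by
    ext ω
    simp only [Set.mem_compl_iff, Set.mem_iUnion, not_exists, not_not, Set.mem_ofPred_eq,
      ENat.toENNReal_eq_top]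
    constructor
    · intro h
      refine ENat.eq_top_iff_forall_gt.2 fun n => (hT n ω).2 (hsub n (h n))
    · intro h n
      exact (hT _ ω).1 (by rw [h]; exact ENat.natCast_lt_top _)
  have hUm : MeasurableSet (⋃ n, (D (n + 1))ᶜ) := MeasurableSet.iUnion fun n => (hm _).compl
  -- If an alarm is almost surely raised, letting `n` grow gives the claim; otherwise the mean is
  -- infinite.
  by_cases htop : P {ω | ((roundRobin Ξ F 𝒢 unit A).2 ω : ℝ≥0∞) = ⊤} = 0
  · rw [← hcompl, prob_compl_eq_zero_iff hUm] at htop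
    rwa [htop, mul_one] at hlim
  · rw [← hcompl] at htop
    calc ENNReal.ofReal γ ≤ ⊤ := le_top
      _ = ∫⁻ ω, (⋃ n, (D (n + 1))ᶜ)ᶜ.indicator (fun _ => ⊤) ω ∂P := by
          rw [lintegral_indicator_const hUm.compl, ENNReal.top_mul htop]
      _ ≤ _ := by
          refine lintegral_mono (Set.indicator_le ?_)
          rw [hcompl]
          intro ω hω
          rw [Set.mem_ofPred_eq] at hω
          exact hω.ge

end FalseAlarm


/-! ### The delay of the round robin policy -/

section Delay

variable {Ξ : Type*} [MeasurableSpace Ξ] {K : ℕ} (F : Measure (Fin K → ℝ))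
  (𝒢 : Set (Measure (Fin K → ℝ))) {L : ℕ} [NeZero L] (unit : Fin L → Finset (Fin K))

/-- Telescoping of the supersolution inequality: each step without alarm uses up one unit of
potential. The weight `f` will be the indicator of a conditioning event. -/
lemma sum_lintegral_belowThreshold_le (π : Measure Ξ) [SFinite π] {μ : ℕ → Measure (Fin K → ℝ)}
    [∀ i, IsProbabilityMeasure (μ i)] {ν : ℕ} {κ : Fin L → Measure ℝ} [∀ u, SFinite (κ u)]
    (hκ : ∀ i, ν ≤ i → ∀ u, (μ i).map (increment F 𝒢 (unit u)) = κ u) {A : ℝ}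
    {V : ℝ × Fin L → ℝ≥0∞} (hV : Measurable V)
    (hVle : ∀ s, s.1 < A → 1 + ∫⁻ z, (if (roundRobinStep s z).1 < A then V (roundRobinStep s z)
      else 0) ∂(κ s.2) ≤ V s) {f : Outcome Ξ K → ℝ≥0∞} (hf : Measurable f)
    (hd : DependsOnFirst ν f) (N : ℕ) :
    ∑ k ∈ Finset.range N, ∫⁻ ω, f ω * (belowThreshold F 𝒢 unit A (ν + k)).indicator 1 ω
        ∂(π.prod (Measure.infinitePi μ)) +
      ∫⁻ ω, f ω * (belowThreshold F 𝒢 unit A (ν + N)).indicator 1 ω *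
        V (roundRobinState F 𝒢 unit ω.2 (ν + N)) ∂(π.prod (Measure.infinitePi μ)) ≤
      ∫⁻ ω, f ω * (belowThreshold F 𝒢 unit A ν).indicator 1 ω *
        V (roundRobinState F 𝒢 unit ω.2 ν) ∂(π.prod (Measure.infinitePi μ)) := by
  have hm := measurableSet_belowThreshold (Ξ := Ξ) F 𝒢 unit A
  have hs := measurable_roundRobinState (Ξ := Ξ) F 𝒢 unit
  induction N with
  | zero => simp
  | succ N ih =>
    refine le_trans ?_ ih
    rw [Finset.sum_range_succ, add_assoc]
    refine add_le_add le_rfl ?_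
    have hfm : Measurable fun ω => f ω * (belowThreshold F 𝒢 unit A (ν + N)).indicator 1 ω :=
      hf.mul (measurable_one.indicator (hm _))
    have hfd : DependsOnFirst (ν + N)
        fun ω => f ω * (belowThreshold F 𝒢 unit A (ν + N)).indicator 1 ω :=
      (hd.mono (Nat.le_add_right _ _)).comp₂
        ((dependsOnFirst_belowThreshold F 𝒢 unit A (ν + N)).indicator 1) (· * ·)
    have h1 := lintegral_mul_increment F 𝒢 unit π (hκ (ν + N) (Nat.le_add_right _ _)) hfm hfd
      (k := fun s z => if (roundRobinStep s z).1 < A then V (roundRobinStep s z) else 0)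
      (measurable_ite_lt_comp_roundRobinStep hV)
    have h2 : ∀ ω : Outcome Ξ K, f ω * (belowThreshold F 𝒢 unit A (ν + (N + 1))).indicator 1 ω *
        V (roundRobinState F 𝒢 unit ω.2 (ν + (N + 1))) =
        f ω * (belowThreshold F 𝒢 unit A (ν + N)).indicator 1 ω *
        (if (roundRobinStep (roundRobinState F 𝒢 unit ω.2 (ν + N)) (increment F 𝒢
          (unit (roundRobinState F 𝒢 unit ω.2 (ν + N)).2) (ω.2 (ν + N)))).1 < A then
          V (roundRobinStep (roundRobinState F 𝒢 unit ω.2 (ν + N)) (increment F 𝒢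
          (unit (roundRobinState F 𝒢 unit ω.2 (ν + N)).2) (ω.2 (ν + N)))) else 0) := by
      classical
      intro ω
      rw [← roundRobinState_succ, ← add_assoc, belowThreshold_succ]
      by_cases ha : ω ∈ belowThreshold F 𝒢 unit A (ν + N) <;>
        by_cases hb : (roundRobinState F 𝒢 unit ω.2 (ν + N + 1)).1 < A <;>
        simp [ha, hb]
    simp_rw [h2]
    rw [h1, ← lintegral_add_left hfm]
    refine lintegral_mono fun ω => ?_
    by_cases ha : ω ∈ belowThreshold F 𝒢 unit A (ν + N)
    · have := mul_le_mul_right (hVle _ (ha _ le_rfl))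
        (f ω * (belowThreshold F 𝒢 unit A (ν + N)).indicator 1 ω)
      rwa [mul_add, mul_one] at this
    · simp [ha]

/-- The outcomes for which no unit in `𝒰` is sampled at the times with index from `τ` to `ν - 1`. -/
def idleFrom (𝒰 : Set (Fin L)) (τ ν : ℕ) : Set (Outcome Ξ K) :=
  {ω | ∀ i, τ ≤ i → i < ν → (roundRobinState F 𝒢 unit ω.2 i).2 ∉ 𝒰}

/-- The outcomes for which a unit in `𝒰` has just been sampled, or nothing has been sampled. -/
def freshAt (𝒰 : Set (Fin L)) (τ : ℕ) : Set (Outcome Ξ K) :=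
  {ω | ∀ k, τ = k + 1 → (roundRobinState F 𝒢 unit ω.2 k).2 ∈ 𝒰}

variable {F 𝒢 unit}

lemma measurableSet_sampled (𝒰 : Set (Fin L)) (i : ℕ) :
    MeasurableSet {ω : Outcome Ξ K | (roundRobinState F 𝒢 unit ω.2 i).2 ∈ 𝒰} :=
  (measurable_snd.comp (measurable_roundRobinState F 𝒢 unit i))
    (MeasurableSet.of_discrete (s := 𝒰))

lemma measurableSet_idleFrom (𝒰 : Set (Fin L)) (τ ν : ℕ) :
    MeasurableSet (idleFrom (Ξ := Ξ) F 𝒢 unit 𝒰 τ ν) := by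
  have : idleFrom (Ξ := Ξ) F 𝒢 unit 𝒰 τ ν = ⋂ i ∈ {i | τ ≤ i ∧ i < ν},
      {ω : Outcome Ξ K | (roundRobinState F 𝒢 unit ω.2 i).2 ∈ 𝒰}ᶜ := by
    ext ω; simp [idleFrom]
  rw [this]
  exact MeasurableSet.biInter (Set.to_countable _) fun i _ => (measurableSet_sampled 𝒰 i).compl

lemma measurableSet_freshAt (𝒰 : Set (Fin L)) (τ : ℕ) :
    MeasurableSet (freshAt (Ξ := Ξ) F 𝒢 unit 𝒰 τ) := by
  have : freshAt (Ξ := Ξ) F 𝒢 unit 𝒰 τ = ⋂ i ∈ {i | τ = i + 1},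
      {ω : Outcome Ξ K | (roundRobinState F 𝒢 unit ω.2 i).2 ∈ 𝒰} := by
    ext ω; simp [freshAt]
  rw [this]
  exact MeasurableSet.biInter (Set.to_countable _) fun i _ => measurableSet_sampled 𝒰 i

omit [MeasurableSpace Ξ] in
lemma dependsOnFirst_sampled (i : ℕ) :
    DependsOnFirst i fun ω : Outcome Ξ K => (roundRobinState F 𝒢 unit ω.2 i).2 :=
  (dependsOnFirst_roundRobinState F 𝒢 unit i).comp Prod.snd

omit [MeasurableSpace Ξ] in
lemma dependsOnFirst_idleFrom (𝒰 : Set (Fin L)) (τ ν : ℕ) :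
    DependsOnFirst ν fun ω : Outcome Ξ K => ω ∈ idleFrom F 𝒢 unit 𝒰 τ ν := by
  intro ω ω' h1 h2
  refine propext (forall₃_congr fun i _ hi => ?_)
  have : (roundRobinState F 𝒢 unit ω.2 i).2 = (roundRobinState F 𝒢 unit ω'.2 i).2 :=
    (dependsOnFirst_sampled i).mono hi.le ω ω' h1 h2
  rw [this]

omit [MeasurableSpace Ξ] in
lemma dependsOnFirst_freshAt (𝒰 : Set (Fin L)) (τ : ℕ) :
    DependsOnFirst τ fun ω : Outcome Ξ K => ω ∈ freshAt F 𝒢 unit 𝒰 τ := by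
  intro ω ω' h1 h2
  refine propext (forall₂_congr fun i hi => ?_)
  have : (roundRobinState F 𝒢 unit ω.2 i).2 = (roundRobinState F 𝒢 unit ω'.2 i).2 :=
    (dependsOnFirst_sampled i).mono (by omega) ω ω' h1 h2
  rw [this]

omit [MeasurableSpace Ξ] in
lemma idleFrom_succ (𝒰 : Set (Fin L)) {τ ν : ℕ} (h : τ ≤ ν) :
    idleFrom (Ξ := Ξ) F 𝒢 unit 𝒰 τ (ν + 1) = idleFrom F 𝒢 unit 𝒰 τ ν ∩
      {ω | (roundRobinState F 𝒢 unit ω.2 ν).2 ∉ 𝒰} := by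
  ext ω
  constructor
  · exact fun hω => ⟨fun i h1 h2 => hω i h1 (by omega), hω ν h (by omega)⟩
  · rintro ⟨h1, h2⟩ i hi hi'
    rcases Nat.lt_succ_iff_lt_or_eq.1 hi' with hi' | rfl
    · exact h1 i hi hi'
    · exact h2

/-- Before the change all units have the same increment law `μ`, so an idle stretch without alarm
evolves by powers of one killed operator. The weight `f` carries the information from before the
stretch. -/
lemma lintegral_mul_idle (π : Measure Ξ) [SFinite π] {μs : ℕ → Measure (Fin K → ℝ)}
    [∀ i, IsProbabilityMeasure (μs i)] {ν : ℕ} {μ : Measure ℝ} [SFinite μ]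
    (hμ : ∀ i, i < ν → ∀ u, (μs i).map (increment F 𝒢 (unit u)) = μ) (A : ℝ) (𝒰 : Set (Fin L))
    {τ : ℕ} {f : Outcome Ξ K → ℝ≥0∞} (hf : Measurable f) (hd : DependsOnFirst τ f) (n : ℕ)
    (hn : τ + n ≤ ν) : ∀ g : ℝ × Fin L → ℝ≥0∞, Measurable g →
    ∫⁻ ω, f ω * (idleFrom F 𝒢 unit 𝒰 τ (τ + n) ∩ belowThreshold F 𝒢 unit A (τ + n)).indicator 1 ω *
        g (roundRobinState F 𝒢 unit ω.2 (τ + n)) ∂(π.prod (Measure.infinitePi μs)) =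
      ∫⁻ ω, f ω * (belowThreshold F 𝒢 unit A τ).indicator 1 ω *
        (idleOp μ A 𝒰)^[n] g (roundRobinState F 𝒢 unit ω.2 τ)
        ∂(π.prod (Measure.infinitePi μs)) := by
  classical
  induction n with
  | zero =>
    intro g hg
    have : idleFrom (Ξ := Ξ) F 𝒢 unit 𝒰 τ (τ + 0) = Set.univ :=
      Set.eq_univ_of_forall fun ω i h1 h2 => absurd h2 (by omega)
    rw [add_zero] at this
    simp [this]
  | succ n ih =>
    intro g hg
    rw [Function.iterate_succ_apply, ← ih (by omega) _ (measurable_idleOp hg)]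
    set W := idleFrom (Ξ := Ξ) F 𝒢 unit 𝒰 τ (τ + n) ∩ belowThreshold F 𝒢 unit A (τ + n) with hW
    have hWm : MeasurableSet W := (measurableSet_idleFrom _ _ _).inter
      (measurableSet_belowThreshold F 𝒢 unit A _)
    have hWd : DependsOnFirst (τ + n) fun ω => ω ∈ W :=
      (dependsOnFirst_idleFrom 𝒰 τ (τ + n)).comp₂
        (dependsOnFirst_belowThreshold F 𝒢 unit A (τ + n)) And
    have hg' := measurable_ite_lt_comp_roundRobinStep (A := A) hg
    have h1 := lintegral_mul_increment F 𝒢 unit π (hμ (τ + n) (by omega))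
      (hf.mul (measurable_one.indicator hWm))
      ((hd.mono (Nat.le_add_right τ n)).comp₂ (hWd.indicator 1) (· * ·))
      (k := fun s z => if s.2 ∈ 𝒰 then 0 else
        if (roundRobinStep s z).1 < A then g (roundRobinStep s z) else 0)
      (Measurable.ite ((measurable_snd.comp measurable_fst)
        (MeasurableSet.of_discrete (s := 𝒰))) measurable_const hg')
    have h3 : ∀ s : ℝ × Fin L, ∫⁻ z, (if s.2 ∈ 𝒰 then 0 else
        if (roundRobinStep s z).1 < A then g (roundRobinStep s z) else 0) ∂μ =
        idleOp μ A 𝒰 g s := by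
      intro s
      unfold idleOp
      split_ifs
      · simp
      · rfl
    simp only [h3] at h1
    refine Eq.trans (lintegral_congr fun ω => ?_) h1
    rw [← roundRobinState_succ, ← add_assoc, belowThreshold_succ,
      idleFrom_succ 𝒰 (Nat.le_add_right τ n)]
    by_cases ha : ω ∈ W
    · have ha' := ha
      rw [hW] at ha'
      by_cases hu : (roundRobinState F 𝒢 unit ω.2 (τ + n)).2 ∈ 𝒰 <;>
        by_cases hb : (roundRobinState F 𝒢 unit ω.2 (τ + n + 1)).1 < A <;>
        simp [ha, ha'.1, ha'.2, hb, hu]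
    · have : ω ∉ idleFrom F 𝒢 unit 𝒰 τ (τ + n) ∩
          {ω | (roundRobinState F 𝒢 unit ω.2 (τ + n)).2 ∉ 𝒰} ∩
          (belowThreshold F 𝒢 unit A (τ + n) ∩
            {ω | (roundRobinState F 𝒢 unit ω.2 (τ + n + 1)).1 < A}) :=
        fun h => ha ⟨h.1.1, h.2.1⟩
      simp only [Pi.mul_apply, Set.indicator_of_notMem ha, Set.indicator_of_notMem this, mul_zero, zero_mul]

omit [MeasurableSpace Ξ] in
-- The witness is one more than the index of the last sampling of a unit in `𝒰` before `ν`, or `0`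
-- if there is none.
lemma exists_mem_freshAt_inter_idleFrom (𝒰 : Set (Fin L)) (ω : Outcome Ξ K) (ν : ℕ) :
    ∃ τ ≤ ν, ω ∈ freshAt F 𝒢 unit 𝒰 τ ∩ idleFrom F 𝒢 unit 𝒰 τ ν := by
  induction ν with
  | zero => exact ⟨0, le_rfl, fun k hk => by omega, fun i _ hi => by omega⟩
  | succ ν ih =>
    by_cases hu : (roundRobinState F 𝒢 unit ω.2 ν).2 ∈ 𝒰
    · refine ⟨ν + 1, le_rfl, fun k hk => ?_, fun i h1 h2 => by omega⟩
      obtain rfl : ν = k := by omega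
      exact hu
    · obtain ⟨τ, hτ, h1, h2⟩ := ih
      refine ⟨τ, by omega, h1, ?_⟩
      rw [idleFrom_succ 𝒰 hτ]
      exact ⟨h2, hu⟩

omit [MeasurableSpace Ξ] in
lemma disjoint_freshAt_inter_idleFrom (𝒰 : Set (Fin L)) {τ τ' ν : ℕ} (h : τ < τ') (hν : τ' ≤ ν) :
    Disjoint (freshAt (Ξ := Ξ) F 𝒢 unit 𝒰 τ ∩ idleFrom F 𝒢 unit 𝒰 τ ν)
      (freshAt F 𝒢 unit 𝒰 τ' ∩ idleFrom F 𝒢 unit 𝒰 τ' ν) := by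
  refine Set.disjoint_left.2 fun ω h1 h2 => ?_
  obtain ⟨k, rfl⟩ : ∃ k, τ' = k + 1 := ⟨τ' - 1, by omega⟩
  exact h1.2 k (by omega) (by omega) (h2.1 k rfl)

omit [MeasurableSpace Ξ] in
-- The policy leaves a unit only after a nonpositive statistic. Thus every idle stretch starts from
-- the bottom, whatever was seen on the affected units.
lemma roundRobinState_nonpos_of_freshAt {𝒰 : Set (Fin L)} {τ : ℕ} {ω : Outcome Ξ K}
    (h : ω ∈ freshAt F 𝒢 unit 𝒰 τ) (hu : (roundRobinState F 𝒢 unit ω.2 τ).2 ∉ 𝒰) :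
    (roundRobinState F 𝒢 unit ω.2 τ).1 ≤ 0 := by
  rcases τ with _ | k
  · exact le_rfl
  · by_contra hc
    refine hu ?_
    have : (roundRobinState F 𝒢 unit ω.2 (k + 1)).2 = (roundRobinState F 𝒢 unit ω.2 k).2 :=
      if_neg hc
    rw [this]
    exact h k rfl

/-- The sets that agree on `Λ` with a measurable set depending on the first `τ` observations. -/
def locallyDependsOnFirst (τ : ℕ) (Λ : Set (Outcome Ξ K)) : MeasurableSpace (Outcome Ξ K) where
  MeasurableSet' B := ∃ B', MeasurableSet B' ∧ (DependsOnFirst τ fun ω => ω ∈ B') ∧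
    ∀ ω ∈ Λ, ω ∈ B ↔ ω ∈ B'
  measurableSet_empty := ⟨∅, MeasurableSet.empty, fun _ _ _ _ => rfl, fun _ _ => Iff.rfl⟩
  measurableSet_compl := by
    rintro B ⟨B', h1, h2, h3⟩
    exact ⟨B'ᶜ, h1.compl, h2.comp Not, fun ω hω => not_congr (h3 ω hω)⟩
  measurableSet_iUnion := by
    intro B hB
    choose B' h1 h2 h3 using hB
    refine ⟨⋃ i, B' i, MeasurableSet.iUnion h1, fun ω ω' ha hb => ?_, fun ω hω => ?_⟩
    · simp only [Set.mem_iUnion]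
      exact propext (exists_congr fun i => (h2 i ω ω' ha hb).to_iff)
    · simp only [Set.mem_iUnion]
      exact exists_congr fun i => h3 i ω hω

/-- On an idle stretch the generators with index at least `τ` describe samplings that do not occur,
so they agree with the empty set there. -/
lemma affectedHistory_roundRobin_le (m : ℕ) (G : Measure (Fin K → ℝ)) (A : ℝ) (τ ν : ℕ) :
    affectedHistory m F G (roundRobin Ξ F 𝒢 unit A).1 ν ≤
      locallyDependsOnFirst τ (idleFrom F 𝒢 unit {u | unit u ∈ affected m F G} τ ν) := by
  refine iSup₂_le fun i hi => MeasurableSpace.generateFrom_le ?_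
  rintro _ ⟨E, hE, C, hC, rfl⟩
  by_cases hτ : i < τ
  · refine ⟨_, ?_, ?_, fun _ _ => Iff.rfl⟩
    · refine (measurableSet_sampled (F := F) (𝒢 := 𝒢) (unit := unit) {u | unit u = E} i).inter ?_
      have : Measurable fun ω : Outcome Ξ K => E.restrict (ω.2 i) :=
        (Finset.measurable_restrict E).comp ((measurable_pi_apply i).comp measurable_snd)
      exact this hC
    · intro ω ω' h1 h2
      have : (roundRobinState F 𝒢 unit ω.2 i).2 = (roundRobinState F 𝒢 unit ω'.2 i).2 :=
        (dependsOnFirst_sampled i).mono hτ.le ω ω' h1 h2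
      simp only [roundRobin, Set.mem_ofPred_eq, this, h2 i hτ]
  · refine ⟨∅, MeasurableSet.empty, fun _ _ _ _ => rfl, fun ω hω => ?_⟩
    simp only [Set.mem_empty_iff_false, iff_false]
    rintro ⟨h1, -⟩
    refine hω i (not_lt.1 hτ) hi ?_
    change unit _ ∈ affected m F G
    change unit _ = E at h1
    rwa [h1]

lemma dependsOnFirst_of_affectedHistory {m : ℕ} {G : Measure (Fin K → ℝ)} {A : ℝ} {ν : ℕ}
    {B : Set (Outcome Ξ K)}
    (hB : MeasurableSet[affectedHistory m F G (roundRobin Ξ F 𝒢 unit A).1 ν] B) :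
    MeasurableSet B ∧ DependsOnFirst ν fun ω => ω ∈ B := by
  obtain ⟨B', h1, h2, h3⟩ := affectedHistory_roundRobin_le m G A ν ν B hB
  have : B = B' := by
    ext ω
    exact h3 ω fun i hi hi' => absurd hi' (by omega)
  rw [this]
  exact ⟨h1, h2⟩

open Classical in
-- The event `B` is split at the last sampling of an affected unit. On each piece `B` agrees with an
-- event decided by time `τ`, so conditioning on it reveals nothing about the idle stretch that
-- follows. The stretch starts from a nonpositive statistic, so the ratio bound `hc` applies piece
-- by piece.
theorem setLIntegral_excess_le (π : Measure Ξ) [SFinite π] {μs : ℕ → Measure (Fin K → ℝ)}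
    [∀ i, IsProbabilityMeasure (μs i)] {ν : ℕ} {μ : Measure ℝ} [SFinite μ]
    (hμ : ∀ i, i < ν → ∀ u, (μs i).map (increment F 𝒢 (unit u)) = μ) {A : ℝ} {m : ℕ}
    {G : Measure (Fin K → ℝ)} {c : ℝ≥0∞}
    (hc : ∀ (n : ℕ) (s : ℝ × Fin L), s.1 ≤ 0 →
      (idleOp μ A {u | unit u ∈ affected m F G})^[n]
        (fun s => if s.1 < A then ENNReal.ofReal s.1 else 0) s ≤
        c * (idleOp μ A {u | unit u ∈ affected m F G})^[n] (fun _ => 1) s)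
    {B : Set (Outcome Ξ K)}
    (hB : MeasurableSet[affectedHistory m F G (roundRobin Ξ F 𝒢 unit A).1 ν] B) :
    ∫⁻ ω in B ∩ belowThreshold F 𝒢 unit A ν,
      (if unit (roundRobinState F 𝒢 unit ω.2 ν).2 ∈ affected m F G then 0
        else ENNReal.ofReal (roundRobinState F 𝒢 unit ω.2 ν).1)
        ∂(π.prod (Measure.infinitePi μs)) ≤
      c * (π.prod (Measure.infinitePi μs)) (B ∩ belowThreshold F 𝒢 unit A ν) := by
  set P := π.prod (Measure.infinitePi μs) with hP
  set 𝒰 : Set (Fin L) := {u | unit u ∈ affected m F G} with h𝒰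
  set Λ : ℕ → Set (Outcome Ξ K) := fun τ =>
    freshAt F 𝒢 unit 𝒰 τ ∩ idleFrom F 𝒢 unit 𝒰 τ ν with hΛ
  set D : Set (Outcome Ξ K) := belowThreshold F 𝒢 unit A ν with hD
  set g : ℝ × Fin L → ℝ≥0∞ := fun s => if s.2 ∈ 𝒰 then 0 else ENNReal.ofReal s.1 with hg
  have hgm : Measurable g := Measurable.ite
    (measurable_snd (MeasurableSet.of_discrete (s := 𝒰))) measurable_const
    measurable_fst.ennreal_ofReal
  have hs := measurable_roundRobinState (Ξ := Ξ) F 𝒢 unit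
  have hDm : MeasurableSet D := measurableSet_belowThreshold F 𝒢 unit A ν
  have hΛm : ∀ τ, MeasurableSet (Λ τ) := fun τ =>
    (measurableSet_freshAt 𝒰 τ).inter (measurableSet_idleFrom 𝒰 τ ν)
  have hBm := (dependsOnFirst_of_affectedHistory hB).1
  have hpart : B ∩ D = ⋃ τ ∈ Finset.range (ν + 1), B ∩ D ∩ Λ τ := by
    ext ω
    simp only [Set.mem_iUnion, Finset.mem_range, exists_prop]
    constructor
    · intro h
      obtain ⟨τ, hτ, h'⟩ := exists_mem_freshAt_inter_idleFrom (F := F) (𝒢 := 𝒢) (unit := unit) 𝒰 ω ν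
      exact ⟨τ, by omega, h, h'⟩
    · rintro ⟨τ, -, h, -⟩
      exact h
  have hdisj : Set.PairwiseDisjoint (↑(Finset.range (ν + 1))) fun τ => B ∩ D ∩ Λ τ := by
    intro τ hτ τ' hτ' hne
    have h1 : τ < ν + 1 := by simpa using hτ
    have h2 : τ' < ν + 1 := by simpa using hτ'
    refine Disjoint.mono Set.inter_subset_right Set.inter_subset_right ?_
    rcases lt_or_gt_of_ne hne with h | h
    · exact disjoint_freshAt_inter_idleFrom 𝒰 h (by omega)
    · exact (disjoint_freshAt_inter_idleFrom 𝒰 h (by omega)).symm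
  have hmeas : ∀ τ ∈ Finset.range (ν + 1), MeasurableSet (B ∩ D ∩ Λ τ) := fun τ _ =>
    (hBm.inter hDm).inter (hΛm τ)
  have hpiece : ∀ τ, τ ≤ ν → ∫⁻ ω in B ∩ D ∩ Λ τ, g (roundRobinState F 𝒢 unit ω.2 ν) ∂P ≤
      c * P (B ∩ D ∩ Λ τ) := by
    intro τ hτ
    obtain ⟨n, rfl⟩ := Nat.exists_eq_add_of_le hτ
    obtain ⟨B', hB'm, hB'd, hB'⟩ := affectedHistory_roundRobin_le m G A τ (τ + n) B hB
    set f : Outcome Ξ K → ℝ≥0∞ := (B' ∩ freshAt F 𝒢 unit 𝒰 τ).indicator fun _ => 1 with hf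
    have hfm : Measurable f := measurable_const.indicator (hB'm.inter (measurableSet_freshAt 𝒰 τ))
    have hfd : DependsOnFirst τ f :=
      DependsOnFirst.indicator (hB'd.comp₂ (dependsOnFirst_freshAt 𝒰 τ) And) 1
    have hkey : ∀ q : ℝ × Fin L → ℝ≥0∞, Measurable q →
        ∫⁻ ω in B ∩ D ∩ Λ τ, q (roundRobinState F 𝒢 unit ω.2 (τ + n)) ∂P =
        ∫⁻ ω, f ω * (belowThreshold F 𝒢 unit A τ).indicator 1 ω *
          (idleOp μ A 𝒰)^[n] q (roundRobinState F 𝒢 unit ω.2 τ) ∂P := by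
      intro q hq
      rw [hP, ← lintegral_mul_idle π hμ A 𝒰 hfm hfd n le_rfl q hq,
        ← lintegral_indicator (hmeas τ (by simp))]
      refine lintegral_congr fun ω => ?_
      by_cases hi : ω ∈ idleFrom F 𝒢 unit 𝒰 τ (τ + n)
      · have hBB : ω ∈ B ↔ ω ∈ B' := hB' ω hi
        by_cases h1 : ω ∈ B' <;> by_cases h2 : ω ∈ freshAt F 𝒢 unit 𝒰 τ <;>
          by_cases h3 : ω ∈ belowThreshold F 𝒢 unit A (τ + n) <;>
          simp [hf, hΛ, hD, hBB, h1, h2, h3, hi]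
      · simp [hΛ, hi]
    have h1 : P (B ∩ D ∩ Λ τ) = ∫⁻ ω, f ω * (belowThreshold F 𝒢 unit A τ).indicator 1 ω *
          (idleOp μ A 𝒰)^[n] (fun _ => 1) (roundRobinState F 𝒢 unit ω.2 τ) ∂P := by
      rw [← hkey _ measurable_const, setLIntegral_one]
    have hmm : Measurable fun ω => f ω * (belowThreshold F 𝒢 unit A τ).indicator 1 ω *
          (idleOp μ A 𝒰)^[n] (fun _ => 1) (roundRobinState F 𝒢 unit ω.2 τ) :=
      (hfm.mul (measurable_one.indicator (measurableSet_belowThreshold F 𝒢 unit A τ))).mul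
        ((measurable_iterate_idleOp measurable_const n).comp (hs τ))
    rw [hkey g hgm, h1, ← lintegral_const_mul _ hmm]
    refine lintegral_mono fun ω => ?_
    by_cases hb : ω ∈ belowThreshold F 𝒢 unit A τ
    swap
    · simp [hb]
    by_cases hfr : ω ∈ freshAt F 𝒢 unit 𝒰 τ
    swap
    · simp [hf, hfr]
    rw [mul_left_comm]
    refine mul_le_mul_right ?_ _
    -- If an affected unit is due at `τ`, the left side vanishes: for `n = 0` by definition of `g`,
    -- for `n > 0` because the operator kills the path.
    by_cases hu : (roundRobinState F 𝒢 unit ω.2 τ).2 ∈ 𝒰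
    · refine le_trans (le_of_eq ?_) zero_le
      rcases n with _ | n
      · exact if_pos hu
      · rw [Function.iterate_succ_apply']
        exact if_pos hu
    · refine le_trans (iterate_idleOp_mono (fun s hs' => ?_) n _ (hb τ le_rfl))
        (hc n _ (roundRobinState_nonpos_of_freshAt hfr hu))
      simp only [hg, if_pos hs']
      split_ifs <;> simp
  change ∫⁻ ω in B ∩ D, g (roundRobinState F 𝒢 unit ω.2 ν) ∂P ≤ _
  rw [hpart, lintegral_biUnion_finset hdisj hmeas, measure_biUnion_finset hdisj hmeas,
    Finset.mul_sum]
  exact Finset.sum_le_sum fun τ hτ => hpiece τ (by simpa [Nat.lt_succ_iff] using hτ)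

lemma toENNReal_sub_le_tsum (T : ℕ∞) (ν : ℕ) :
    (T : ℝ≥0∞) - (ν : ℝ≥0∞) ≤ ∑' k : ℕ, if ((ν + k : ℕ) : ℕ∞) < T then (1 : ℝ≥0∞) else 0 := by
  have h := natCast_le_tsum_ite_lt (T - ν) one_pos
  rw [ENat.toENNReal_sub, ENat.toENNReal_coe] at h
  refine h.trans (le_of_eq (tsum_congr fun k => ?_))
  have : (((k * 1 : ℕ) : ℕ∞) < T - ν) ↔ ((ν + k : ℕ) : ℕ∞) < T := by
    rw [lt_tsub_iff_left, mul_one, Nat.cast_add]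
  simp only [this, Nat.cast_one]

/-- Conditionally on the affected history and on no alarm, the mean remaining time is at most the
mean potential at `ν`: `A / I + C` plus `β` times the excess on unaffected units, and the excess is
at most `ε A` in mean. -/
theorem eventually_delay_roundRobin_le (π : Measure Ξ) [IsProbabilityMeasure π]
    {G : Measure (Fin K → ℝ)} [IsProbabilityMeasure F] [IsProbabilityMeasure G] {μ : Measure ℝ}
    (h : IsLLRLaw μ) {m : ℕ} (hunit : ∀ u, (unit u).card = m)
    (hF : ∀ u, F.map (increment F 𝒢 (unit u)) = μ)
    (hG : ∀ u, G.map (increment F 𝒢 (unit u)) =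
      postChangeIncrementLaw μ {u | unit u ∈ affected m F G} u)
    (hne : {u | unit u ∈ affected m F G}.Nonempty) {c : ℝ}
    (hc : 1 < c * ∫ z, z * Real.exp z ∂μ) :
    ∀ᶠ A in atTop, delay π m F G (roundRobin Ξ F 𝒢 unit A) ≤ ENNReal.ofReal (c * A) := by
  classical
  have hprob := h.prob
  have hIpos := h.integral_mul_exp_pos
  set I₀ := ∫ z, z * Real.exp z ∂μ with hI₀
  set 𝒰 : Set (Fin L) := {u | unit u ∈ affected m F G} with h𝒰
  have hc0 : 0 < c := by
    by_contra hc'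
    have := mul_nonpos_of_nonpos_of_nonneg (not_lt.1 hc') hIpos.le
    linarith
  obtain ⟨I, hI1, hI2⟩ : ∃ I, 1 / c < I ∧ I < I₀ := exists_between (by
    rw [div_lt_iff₀ hc0, mul_comm]; exact hc)
  have hI0 : 0 < I := lt_trans (by positivity) hI1
  obtain ⟨C, β, hC, hβ, hV⟩ := exists_potential h hI0 hI2 hne
  have hgap : 0 < c - 1 / I := by
    rw [sub_pos, div_lt_comm₀ hI0 hc0] ; exact hI1
  -- Half of the gap `c - 1/I` absorbs `β ε`, the other half the constant `C` once `A` is large.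
  set ε : ℝ := (c - 1 / I) / 2 / (β + 1) with hε
  have hε0 : 0 < ε := by positivity
  filter_upwards [eventually_iterate_idleOp_le h hε0 L, eventually_gt_atTop 0,
    eventually_ge_atTop (C / ((c - 1 / I) / 2))] with A hidle hA hAC
  obtain ⟨V, hVm, hVstep, hVle⟩ := hV A hA
  have hpol := isPolicy_roundRobin (Ξ := Ξ) F 𝒢 unit hunit hA
  have hT : ∀ (n : ℕ), {ω | (n : ℕ∞) < (roundRobin Ξ F 𝒢 unit A).2 ω} =
      belowThreshold F 𝒢 unit A n := fun n => Set.ext (lt_roundRobin_iff F 𝒢 unit hA n)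
  refine iSup_le fun ν => essSup_condLExp_cond_le (hpol.affectedHistory_le F G ν) fun B hB => ?_
  rw [hT]
  set D : ℕ → Set (Outcome Ξ K) := belowThreshold F 𝒢 unit A with hD
  have hDm : ∀ n, MeasurableSet (D n) := measurableSet_belowThreshold F 𝒢 unit A
  have hs := measurable_roundRobinState (Ξ := Ξ) F 𝒢 unit
  obtain ⟨hBm, hBd⟩ := dependsOnFirst_of_affectedHistory hB
  set μs : ℕ → Measure (Fin K → ℝ) := fun i => if i < ν then F else G with hμs
  have hμsp : ∀ i, IsProbabilityMeasure (μs i) := by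
    intro i; simp only [hμs]; split_ifs <;> infer_instance
  set P := changeLaw π F G ν with hP
  have hP' : P = π.prod (Measure.infinitePi μs) := rfl
  set κ := postChangeIncrementLaw μ 𝒰 with hκ
  have hκp : ∀ u, SFinite (κ u) := fun u => by
    rw [← hG]; infer_instance
  have hpre : ∀ i, i < ν → ∀ u, (μs i).map (increment F 𝒢 (unit u)) = μ := by
    intro i hi u; simp only [hμs, if_pos hi, hF]
  have hpost : ∀ i, ν ≤ i → ∀ u, (μs i).map (increment F 𝒢 (unit u)) = κ u := by
    intro i hi u; simp only [hμs, if_neg (not_lt.2 hi), hG]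
  have hexc := setLIntegral_excess_le π hpre (m := m) (G := G) (hidle 𝒰 hne) hB
  have hBf : Measurable (B.indicator fun _ => (1 : ℝ≥0∞)) := measurable_const.indicator hBm
  have hsum : ∀ N, ∑ k ∈ Finset.range N, P (B ∩ D (ν + k)) ≤
      ∫⁻ ω in B ∩ D ν, V (roundRobinState F 𝒢 unit ω.2 ν) ∂P := by
    intro N
    have := le_self_add.trans (sum_lintegral_belowThreshold_le F 𝒢 unit π hpost hVm hVstep hBf
      (hBd.indicator 1) N)
    rw [← hP'] at this
    refine le_trans (le_of_eq (Finset.sum_congr rfl fun k _ => ?_)) (this.trans (le_of_eq ?_))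
    · rw [← lintegral_indicator_one (hBm.inter (hDm _))]
      refine lintegral_congr fun ω => ?_
      by_cases h1 : ω ∈ B <;> by_cases h2 : ω ∈ D (ν + k) <;> simp [h1, h2, ← hD]
    · rw [← lintegral_indicator (hBm.inter (hDm _))]
      refine lintegral_congr fun ω => ?_
      by_cases h1 : ω ∈ B <;> by_cases h2 : ω ∈ D ν <;> simp [h1, h2, ← hD]
  calc ∫⁻ ω in B ∩ D ν, (((roundRobin Ξ F 𝒢 unit A).2 ω : ℝ≥0∞) - (ν : ℝ≥0∞)) ∂P
      ≤ ∫⁻ ω in B ∩ D ν, ∑' k : ℕ, (D (ν + k)).indicator 1 ω ∂P := by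
        refine lintegral_mono fun ω => (toENNReal_sub_le_tsum _ ν).trans (le_of_eq ?_)
        refine tsum_congr fun k => ?_
        rw [Set.indicator_apply, ← hT]
        simp only [Set.mem_ofPred_eq, Pi.one_apply]
    _ = ∑' k : ℕ, P (B ∩ D (ν + k)) := by
        rw [lintegral_tsum fun k => (measurable_one.indicator (hDm _)).aemeasurable]
        refine tsum_congr fun k => ?_
        rw [lintegral_indicator_one (hDm _), Measure.restrict_apply (hDm _)]
        congr 1
        ext ω
        constructor
        · exact fun hω => ⟨hω.2.1, hω.1⟩
        · exact fun hω => ⟨hω.2, hω.1, fun i hi => hω.2 i (by omega)⟩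
    _ ≤ ∫⁻ ω in B ∩ D ν, V (roundRobinState F 𝒢 unit ω.2 ν) ∂P :=
        ENNReal.tsum_le_of_sum_range_le hsum
    _ ≤ ∫⁻ ω in B ∩ D ν, (ENNReal.ofReal (A / I + C) + ENNReal.ofReal β *
          (if unit (roundRobinState F 𝒢 unit ω.2 ν).2 ∈ affected m F G then 0
            else ENNReal.ofReal (roundRobinState F 𝒢 unit ω.2 ν).1)) ∂P := by
        refine setLIntegral_mono' (hBm.inter (hDm _)) fun ω hω => ?_
        refine (hVle _ (hω.2 ν le_rfl)).trans (add_le_add le_rfl (le_of_eq ?_))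
        by_cases hu : unit (roundRobinState F 𝒢 unit ω.2 ν).2 ∈ affected m F G
        · rw [if_pos hu, mul_zero]; exact if_pos hu
        · rw [if_neg hu, ← ENNReal.ofReal_mul hβ]; exact if_neg hu
    _ = ENNReal.ofReal (A / I + C) * P (B ∩ D ν) + ENNReal.ofReal β *
          ∫⁻ ω in B ∩ D ν, (if unit (roundRobinState F 𝒢 unit ω.2 ν).2 ∈ affected m F G then 0
            else ENNReal.ofReal (roundRobinState F 𝒢 unit ω.2 ν).1) ∂P := by
        rw [lintegral_add_left measurable_const, setLIntegral_const,
          lintegral_const_mul' _ _ ENNReal.ofReal_ne_top]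
    _ ≤ ENNReal.ofReal (A / I + C) * P (B ∩ D ν) + ENNReal.ofReal β *
          (ENNReal.ofReal (ε * A) * P (B ∩ D ν)) := by
        exact add_le_add le_rfl (mul_le_mul_right hexc _)
    _ = ENNReal.ofReal (A / I + C + β * (ε * A)) * P (B ∩ D ν) := by
        rw [← mul_assoc, ← add_mul, ← ENNReal.ofReal_mul hβ, ← ENNReal.ofReal_add
          (by positivity) (by positivity)]
    _ ≤ ENNReal.ofReal (c * A) * P (B ∩ D ν) := by
        refine mul_le_mul_left (ENNReal.ofReal_le_ofReal ?_) _
        have h1 : β * ε ≤ (c - 1 / I) / 2 := by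
          have : β * ε = (c - 1 / I) / 2 * (β / (β + 1)) := by rw [hε]; field_simp
          rw [this]
          refine mul_le_of_le_one_right (by positivity) ?_
          rw [div_le_one (by positivity)]
          linarith
        have h2 : C ≤ (c - 1 / I) / 2 * A := by
          rwa [div_le_iff₀ (by positivity), mul_comm] at hAC
        have h3 := mul_le_mul_of_nonneg_right h1 hA.le
        have h4 : A / I = 1 / I * A := by ring
        rw [h4]
        linarith

end Delay


/-! ### Laws of log-likelihood ratios -/

namespace HasLLRLaw

variable {X : Type*} [MeasurableSpace X] {P Q : Measure X} {μ : Measure ℝ} {ℓ : X → ℝ}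

lemma map_equiv {Y : Type*} [MeasurableSpace Y] (h : HasLLRLaw P Q μ ℓ) (e : X ≃ᵐ Y) :
    HasLLRLaw (P.map e) (Q.map e) μ (ℓ ∘ e.symm) := by
  obtain ⟨hm, hl, hQ⟩ := h
  refine ⟨hm.comp e.symm.measurable, ?_, ?_⟩
  · rw [Measure.map_map (hm.comp e.symm.measurable) e.measurable, ← hl]
    congr 1
    ext x
    simp
  · ext s hs
    rw [e.map_apply, hQ, withDensity_apply _ (e.measurable hs), withDensity_apply _ hs,
      setLIntegral_map hs (hm.comp e.symm.measurable).exp.ennreal_ofReal e.measurable]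
    simp

lemma llr_ae_eq [SigmaFinite P] (h : HasLLRLaw P Q μ ℓ) : llr Q P =ᵐ[P] ℓ := by
  have := Measure.rnDeriv_withDensity P (h.1.exp.ennreal_ofReal)
  rw [← h.2.2] at this
  filter_upwards [this] with x hx
  rw [llr, hx, ENNReal.toReal_ofReal (Real.exp_pos _).le, Real.log_exp]

lemma map_llr [SigmaFinite P] (h : HasLLRLaw P Q μ ℓ) : P.map (llr Q P) = μ := by
  rw [Measure.map_congr h.llr_ae_eq, h.2.1]

lemma map_llr_of_alternative [SigmaFinite P] (h : HasLLRLaw P Q μ ℓ) :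
    Q.map (llr Q P) = expWeighted μ := by
  have hac : Q ≪ P := by
    rw [h.2.2]; exact withDensity_absolutelyContinuous _ _
  rw [Measure.map_congr (hac.ae_le h.llr_ae_eq)]
  obtain ⟨hm, hl, hQ⟩ := h
  ext s hs
  rw [Measure.map_apply hm hs, hQ, withDensity_apply _ (hm hs), expWeighted,
    withDensity_apply _ hs, ← hl, setLIntegral_map hs (by fun_prop) hm]

lemma ne [IsProbabilityMeasure P] (h : HasLLRLaw P Q μ ℓ) (hμ : μ ≠ Measure.dirac 0) : Q ≠ P := by
  rintro rfl
  refine hμ ?_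
  have h0 : ℓ =ᵐ[Q] fun _ => 0 := by
    filter_upwards [h.llr_ae_eq, Measure.rnDeriv_self Q] with x h1 h2
    rw [← h1, llr, h2]
    simp
  rw [← h.2.1, Measure.map_congr h0, Measure.map_const]
  simp

end HasLLRLaw

lemma mixtureLaw_eq_of_postChangeLaws_eq {K : ℕ} {F : Measure (Fin K → ℝ)}
    {𝒢 : Set (Measure (Fin K → ℝ))} {E : Finset (Fin K)} {Q : Measure (E → ℝ)}
    (h : postChangeLaws F 𝒢 E = {Q}) : mixtureLaw F 𝒢 E = Q := by
  rw [mixtureLaw, h]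
  ext s hs
  rw [Measure.smul_apply, Measure.sum_apply _ hs, tsum_fintype, Fintype.sum_unique]
  simp

/-! ### Asymptotic optimality when every pair has the same log-likelihood ratio law -/

/-- The ratio is at least one because the policy itself competes in the infimum. The constants `s /
I` and `1 / (s I)` bound it by `s²`, for every `s > 1`. -/
lemma tendsto_div_iInf_of_bounds {α : Type*} {S : ℝ → Set α} {d : α → ℝ≥0∞} {p : ℝ → α}
    {I : ℝ} (hI : 0 < I) (hp : ∀ γ, 1 < γ → p γ ∈ S γ)
    (hlow : ∀ c, 0 < c → c * I < 1 → ∀ᶠ γ in atTop, ∀ q ∈ S γ, ENNReal.ofReal (c * Real.log γ) ≤ d q)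
    (hup : ∀ c, 1 < c * I → ∀ᶠ γ in atTop, d (p γ) ≤ ENNReal.ofReal (c * Real.log γ)) :
    Tendsto (fun γ => d (p γ) / ⨅ q ∈ S γ, d q) atTop (𝓝 1) := by
  have hratio : ∀ s : ℝ, 1 < s → ∀ᶠ γ in atTop,
      1 ≤ d (p γ) / (⨅ q ∈ S γ, d q) ∧
        d (p γ) / (⨅ q ∈ S γ, d q) ≤ ENNReal.ofReal (s ^ 2) := by
    intro s hs
    have hs0 : 0 < s := by linarith
    filter_upwards [hlow (1 / (s * I)) (by positivity) (by
        rw [div_mul_eq_mul_div, div_lt_one (by positivity)]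
        nlinarith), hup (s / I) (by rw [div_mul_cancel₀ _ hI.ne']; exact hs),
      eventually_gt_atTop 1] with γ h1 h2 hγ
    have hlog : 0 < Real.log γ := Real.log_pos hγ
    set g := ⨅ q ∈ S γ, d q with hg
    have hg1 : ENNReal.ofReal (1 / (s * I) * Real.log γ) ≤ g := le_iInf₂ h1
    have hgd : g ≤ d (p γ) := iInf₂_le (p γ) (hp γ hγ)
    have hpos : 0 < ENNReal.ofReal (1 / (s * I) * Real.log γ) :=
      ENNReal.ofReal_pos.2 (by positivity)
    have hg0 : g ≠ 0 := (hpos.trans_le hg1).ne'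
    have hgt : g ≠ ⊤ := ((hgd.trans h2).trans_lt ENNReal.ofReal_lt_top).ne
    constructor
    · rw [ENNReal.le_div_iff_mul_le (Or.inl hg0) (Or.inl hgt), one_mul]
      exact hgd
    · rw [ENNReal.div_le_iff hg0 hgt]
      calc d (p γ) ≤ ENNReal.ofReal (s / I * Real.log γ) := h2
        _ = ENNReal.ofReal (s ^ 2) * ENNReal.ofReal (1 / (s * I) * Real.log γ) := by
            rw [← ENNReal.ofReal_mul (by positivity)]
            congr 1
            field_simp
        _ ≤ _ := by gcongr
  refine tendsto_order.2 ⟨fun a ha => ?_, fun b hb => ?_⟩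
  · filter_upwards [hratio 2 (by norm_num)] with γ hγ
    exact ha.trans_le hγ.1
  · have hcont : Tendsto (fun s : ℝ => ENNReal.ofReal (s ^ 2)) (𝓝[>] 1) (𝓝 1) := by
      have : Tendsto (fun s : ℝ => ENNReal.ofReal (s ^ 2)) (𝓝 1) (𝓝 (ENNReal.ofReal (1 ^ 2))) :=
        (ENNReal.continuous_ofReal.comp (continuous_pow 2)).tendsto 1
      rw [one_pow, ENNReal.ofReal_one] at this
      exact this.mono_left nhdsWithin_le_nhds
    obtain ⟨s, hsb, hs⟩ := ((hcont.eventually (gt_mem_nhds hb)).and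
      self_mem_nhdsWithin).exists
    filter_upwards [hratio s hs] with γ hγ
    exact hγ.2.trans_lt hsb

/-- The same law `μ` for all pairs makes the information number in the lower bound, over arbitrary
pairs, equal to the one reached on the listed units. One affected unit in the list is enough. -/
theorem asymptoticallyOptimal_roundRobin {Ξ : Type*} [MeasurableSpace Ξ] (π : Measure Ξ)
    [IsProbabilityMeasure π] {K L : ℕ} [NeZero L] {F G : Measure (Fin K → ℝ)}
    [IsProbabilityMeasure F] [IsProbabilityMeasure G] {𝒢 : Set (Measure (Fin K → ℝ))}
    {unit : Fin L → Finset (Fin K)} {μ : Measure ℝ} (hμ : IsLLRLaw μ)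
    (hunit : ∀ u, (unit u).card = 2)
    (hmix : ∀ E : Finset (Fin K), E.card = 2 →
      ∃ ℓ, HasLLRLaw (localLaw F E) (mixtureLaw F 𝒢 E) μ ℓ)
    (hG : ∀ E : Finset (Fin K), E.card = 2 →
      localLaw G E = localLaw F E ∨ localLaw G E = mixtureLaw F 𝒢 E)
    (hne : ∃ u, unit u ∈ affected 2 F G) :
    AsymptoticallyOptimal π 2 F G (fun γ => roundRobin Ξ F 𝒢 unit (Real.log γ)) := by
  have hloc : ∀ E : Finset (Fin K), IsProbabilityMeasure (localLaw F E) := fun E =>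
    Measure.isProbabilityMeasure_map (Finset.measurable_restrict E).aemeasurable
  have hinc : ∀ (P : Measure (Fin K → ℝ)) (E : Finset (Fin K)), P.map (increment F 𝒢 E) =
      (localLaw P E).map (llr (mixtureLaw F 𝒢 E) (localLaw F E)) := by
    intro P E
    exact (Measure.map_map (measurable_llr _ _) (Finset.measurable_restrict E)).symm
  have hF : ∀ u, F.map (increment F 𝒢 (unit u)) = μ := by
    intro u
    obtain ⟨ℓ, hℓ⟩ := hmix _ (hunit u)
    rw [hinc, hℓ.map_llr]
  have hG' : ∀ u, G.map (increment F 𝒢 (unit u)) =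
      postChangeIncrementLaw μ {u | unit u ∈ affected 2 F G} u := by
    intro u
    obtain ⟨ℓ, hℓ⟩ := hmix _ (hunit u)
    rw [hinc, postChangeIncrementLaw]
    split_ifs with hu
    · rw [(hG _ (hunit u)).resolve_left hu.2, hℓ.map_llr_of_alternative]
    · have : localLaw G (unit u) = localLaw F (unit u) := by
        by_contra hcon
        exact hu ⟨hunit u, hcon⟩
      rw [this, hℓ.map_llr]
  have hexp : ∫⁻ z, ENNReal.ofReal (Real.exp z) ∂μ = 1 := by
    rw [← ofReal_integral_eq_lintegral_ofReal hμ.integrable_exp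
      (ae_of_all _ fun z => (Real.exp_pos z).le), hμ.integral_exp, ENNReal.ofReal_one]
  have hclass : ∀ γ : ℝ, 1 < γ →
      roundRobin Ξ F 𝒢 unit (Real.log γ) ∈ falseAlarmClass π 2 F γ := fun γ hγ =>
    roundRobin_mem_falseAlarmClass hunit hF hexp hγ
  refine ⟨hclass, tendsto_div_iInf_of_bounds hμ.integral_mul_exp_pos hclass ?_ ?_⟩
  · intro c hc0 hc
    refine eventually_le_delay hμ (fun E hE => ?_) hc0 hc
    obtain ⟨ℓ, hℓ⟩ := hmix E hE
    rcases hG E hE with h | h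
    · exact Or.inl h
    · exact Or.inr ⟨ℓ, h ▸ hℓ⟩
  · intro c hc
    exact Real.tendsto_log_atTop.eventually
      (eventually_delay_roundRobin_le π hμ hunit hF hG' hne hc)


/-! ### The law of a pair of correlated Gaussian sources -/

section GaussianPair

/-- The log-likelihood ratio of two centered normal laws with variances `w` and `v`. -/
noncomputable def gaussianLogRatio (v w u : ℝ) : ℝ :=
  Real.log √(v / w) + u ^ 2 / 2 * (1 / v - 1 / w)

lemma measurable_gaussianLogRatio (v w : ℝ) : Measurable (gaussianLogRatio v w) := by
  unfold gaussianLogRatio; fun_prop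

lemma gaussianReal_eq_withDensity {v w : ℝ} (hv : 0 < v) (hw : 0 < w) :
    gaussianReal 0 w.toNNReal = (gaussianReal 0 v.toNNReal).withDensity
      fun u => ENNReal.ofReal (Real.exp (gaussianLogRatio v w u)) := by
  rw [gaussianReal_of_var_ne_zero _ (Real.toNNReal_pos.2 hv).ne',
    gaussianReal_of_var_ne_zero _ (Real.toNNReal_pos.2 hw).ne',
    ← withDensity_mul _ (measurable_gaussianPDF _ _)
      (measurable_gaussianLogRatio v w).exp.ennreal_ofReal]
  congr 1
  ext u
  rw [Pi.mul_apply, gaussianPDF, gaussianPDF, ← ENNReal.ofReal_mul (gaussianPDFReal_nonneg _ _ _)]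
  congr 1
  have hs : 0 < √(v / w) := Real.sqrt_pos.2 (by positivity)
  have hsq : (√(2 * Real.pi * w))⁻¹ = (√(2 * Real.pi * v))⁻¹ * √(v / w) := by
    rw [Real.sqrt_div hv.le, Real.sqrt_mul Real.two_pi_pos.le w,
      Real.sqrt_mul Real.two_pi_pos.le v]
    have h2 : √(2 * Real.pi) ≠ 0 := (Real.sqrt_pos.2 Real.two_pi_pos).ne'
    generalize √(2 * Real.pi) = q at h2 ⊢
    have := (Real.sqrt_pos.2 hv).ne'
    have := (Real.sqrt_pos.2 hw).ne'
    field_simp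
  rw [gaussianPDFReal, gaussianPDFReal, gaussianLogRatio, Real.exp_add, Real.exp_log hs,
    Real.coe_toNNReal _ hv.le, Real.coe_toNNReal _ hw.le, hsq, sub_zero]
  have : -u ^ 2 / (2 * w) = -u ^ 2 / (2 * v) + u ^ 2 / 2 * (1 / v - 1 / w) := by
    field_simp; ring
  rw [this, Real.exp_add]
  ring

lemma integrable_exp_mul_gaussianLogRatio {v w t : ℝ} (hv : 0 < v)
    (ht : t * (1 / v - 1 / w) < 1 / v) :
    Integrable (fun u => Real.exp (t * gaussianLogRatio v w u)) (gaussianReal 0 v.toNNReal) := by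
  -- The `t`-th power of the likelihood ratio is a constant times the density of a centred normal
  -- law of variance `q` relative to variance `v`; the hypothesis on `t` says that `q` is positive.
  set q : ℝ := 1 / (1 / v - t * (1 / v - 1 / w)) with hq
  have hq0 : 0 < q := by
    have : 0 < 1 / v - t * (1 / v - 1 / w) := by linarith
    positivity
  have h1 : Integrable (fun u => Real.exp (gaussianLogRatio v q u))
      (gaussianReal 0 v.toNNReal) := by
    refine ⟨(measurable_gaussianLogRatio v q).exp.aestronglyMeasurable, ?_⟩
    rw [hasFiniteIntegral_iff_ofReal (ae_of_all _ fun u => (Real.exp_pos _).le)]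
    have := measure_univ (μ := gaussianReal 0 q.toNNReal)
    rw [gaussianReal_eq_withDensity hv hq0, withDensity_apply _ MeasurableSet.univ,
      Measure.restrict_univ] at this
    rw [this]
    exact ENNReal.one_lt_top
  refine (h1.const_mul (Real.exp (t * Real.log √(v / w) - Real.log √(v / q)))).congr
    (ae_of_all _ fun u => ?_)
  simp only [gaussianLogRatio]
  rw [← Real.exp_add]
  congr 1
  have : 1 / q = 1 / v - t * (1 / v - 1 / w) := by rw [hq, one_div_one_div]
  rw [this]
  ring

/-- The law of the sum and the difference of two standard normal variables with correlation `r`. -/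
noncomputable def sumDiffLaw (r : ℝ) : Measure (ℝ × ℝ) :=
  (gaussianReal 0 (2 * (1 + r)).toNNReal).prod (gaussianReal 0 (2 * (1 - r)).toNNReal)

instance (r : ℝ) : IsProbabilityMeasure (sumDiffLaw r) := by
  unfold sumDiffLaw; infer_instance

lemma sumDiffLaw_zero : sumDiffLaw 0 =
    (gaussianReal 0 (2 : ℝ).toNNReal).prod (gaussianReal 0 (2 : ℝ).toNNReal) := by
  simp [sumDiffLaw]

/-- The log-likelihood ratio of `sumDiffLaw r` and `sumDiffLaw 0`. -/
noncomputable def sumDiffLogRatio (r : ℝ) (z : ℝ × ℝ) : ℝ :=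
  gaussianLogRatio 2 (2 * (1 + r)) z.1 + gaussianLogRatio 2 (2 * (1 - r)) z.2

/-- The law of the log-likelihood ratio of two sources with correlation `r`. -/
noncomputable def pairLLRLaw (r : ℝ) : Measure ℝ := (sumDiffLaw 0).map (sumDiffLogRatio r)

variable {ρ : ℝ}

lemma measurable_sumDiffLogRatio (r : ℝ) : Measurable (sumDiffLogRatio r) :=
  ((measurable_gaussianLogRatio _ _).comp measurable_fst).add
    ((measurable_gaussianLogRatio _ _).comp measurable_snd)

lemma hasLLRLaw_sumDiffLaw (h0 : 0 < ρ) (h1 : ρ < 1) :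
    HasLLRLaw (sumDiffLaw 0) (sumDiffLaw ρ) (pairLLRLaw ρ) (sumDiffLogRatio ρ) := by
  refine ⟨measurable_sumDiffLogRatio ρ, rfl, ?_⟩
  rw [sumDiffLaw_zero, sumDiffLaw, gaussianReal_eq_withDensity (v := 2) (w := 2 * (1 + ρ))
    (by norm_num) (by linarith), gaussianReal_eq_withDensity (v := 2) (w := 2 * (1 - ρ))
    (by norm_num) (by linarith), prod_withDensity
      (measurable_gaussianLogRatio _ _).exp.ennreal_ofReal
      (measurable_gaussianLogRatio _ _).exp.ennreal_ofReal]
  congr 1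
  ext z
  rw [sumDiffLogRatio, Real.exp_add, ENNReal.ofReal_mul (Real.exp_pos _).le]

lemma integrable_exp_mul_sumDiffLogRatio {t : ℝ} (h0 : 0 < ρ) (h1 : ρ < 1)
    (ht0 : -((1 - ρ) / ρ) < t) (ht1 : t < (1 + ρ) / ρ) :
    Integrable (fun z => Real.exp (t * sumDiffLogRatio ρ z)) (sumDiffLaw 0) := by
  rw [sumDiffLaw_zero]
  have ha := integrable_exp_mul_gaussianLogRatio (v := 2) (w := 2 * (1 + ρ)) (t := t)
    (by norm_num) (by
      have : (1 : ℝ) / 2 - 1 / (2 * (1 + ρ)) = ρ / (2 * (1 + ρ)) := by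
        field_simp; ring
      rw [this, ← mul_div_assoc, div_lt_div_iff₀ (by linarith) (by norm_num)]
      rw [lt_div_iff₀ h0] at ht1
      linarith)
  have hb := integrable_exp_mul_gaussianLogRatio (v := 2) (w := 2 * (1 - ρ)) (t := t)
    (by norm_num) (by
      have h1' : (0 : ℝ) < 1 - ρ := by linarith
      have : (1 : ℝ) / 2 - 1 / (2 * (1 - ρ)) = -ρ / (2 * (1 - ρ)) := by
        field_simp; ring
      rw [this, ← mul_div_assoc, div_lt_div_iff₀ (by linarith) (by norm_num)]
      rw [neg_lt, lt_div_iff₀ h0] at ht0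
      linarith)
  refine (ha.mul_prod hb).congr (ae_of_all _ fun z => ?_)
  simp only [sumDiffLogRatio]
  rw [← Real.exp_add, ← mul_add]

lemma isLLRLaw_pairLLRLaw (h0 : 0 < ρ) (h1 : ρ < 1) : IsLLRLaw (pairLLRLaw ρ) := by
  have hm := measurable_sumDiffLogRatio ρ
  have hsub : Set.Ioo (-((1 - ρ) / ρ)) ((1 + ρ) / ρ) ⊆
      integrableExpSet id (pairLLRLaw ρ) := by
    intro t ht
    rw [integrableExpSet, Set.mem_ofPred_eq, pairLLRLaw,
      integrable_map_measure (by fun_prop) hm.aemeasurable]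
    exact integrable_exp_mul_sumDiffLogRatio h0 h1 ht.1 ht.2
  have hint := interior_maximal hsub isOpen_Ioo
  have hpos : 0 < (1 - ρ) / ρ := div_pos (by linarith) h0
  have hone : 1 < (1 + ρ) / ρ := by rw [lt_div_iff₀ h0]; linarith
  have hllr := hasLLRLaw_sumDiffLaw h0 h1
  refine ⟨Measure.isProbabilityMeasure_map hm.aemeasurable, ?_, hint ⟨by linarith, by linarith⟩,
    hint ⟨by linarith, hone⟩, ?_⟩
  · rw [pairLLRLaw, integral_map hm.aemeasurable (by fun_prop),
      integral_eq_lintegral_of_nonneg_ae (ae_of_all _ fun z => (Real.exp_pos _).le)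
        hm.exp.aestronglyMeasurable]
    have := measure_univ (μ := sumDiffLaw ρ)
    rw [hllr.2.2, withDensity_apply _ MeasurableSet.univ, Measure.restrict_univ] at this
    rw [this, ENNReal.toReal_one]
  -- A vanishing log-likelihood ratio would identify the laws for correlations `ρ` and `0`, but the
  -- variances of the sum are `2 (1 + ρ)` and `2`.
  · intro hd
    have hz : sumDiffLogRatio ρ =ᵐ[sumDiffLaw 0] fun _ => 0 := by
      have : ∀ᵐ z ∂(pairLLRLaw ρ), z = 0 := by
        rw [hd, ae_dirac_eq]
        exact Filter.eventually_pure.2 rfl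
      exact ae_of_ae_map hm.aemeasurable this
    have heq : sumDiffLaw ρ = sumDiffLaw 0 := by
      rw [hllr.2.2]
      refine Eq.trans (withDensity_congr_ae (g := 1) ?_) withDensity_one
      filter_upwards [hz] with z hz
      rw [hz]
      simp
    have hfst := congrArg (fun P => (P.map Prod.fst)) heq
    simp only [sumDiffLaw, Measure.map_fst_prod, measure_univ, one_smul] at hfst
    have hvar := congrArg (fun P => Var[id; P]) hfst
    simp only [variance_id_gaussianReal] at hvar
    rw [Real.coe_toNNReal _ (by linarith), Real.coe_toNNReal _ (by norm_num)] at hvar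
    linarith

/-! ### Local laws of pairs -/

variable {K : ℕ} {R : Matrix (Fin K) (Fin K) ℝ}

/-- The sum and the difference of jointly Gaussian variables with equal variances are uncorrelated,
hence independent. In these coordinates the law of a pair becomes a product. -/
lemma map_ofLp_gaussian_sum_diff (hR : R.PosSemidef) {i j : Fin K} (hi : R i i = 1)
    (hj : R j j = 1) :
    (gaussianLaw R).map (fun x => (x i + x j, x i - x j)) = sumDiffLaw (R i j) := by
  set P := multivariateGaussian 0 R with hP
  have hmem : ∀ k, MemLp (fun x : EuclideanSpace ℝ (Fin K) => x k) 2 P := fun k =>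
    ((IsGaussian.hasGaussianLaw_id (μ := P)).map_fun (EuclideanSpace.proj k)).memLp_two
  have hgauss : HasGaussianLaw
      (fun x : EuclideanSpace ℝ (Fin K) => (x i + x j, x i - x j)) P :=
    (IsGaussian.hasGaussianLaw_id (μ := P)).map_fun
      (((EuclideanSpace.proj i + EuclideanSpace.proj j : EuclideanSpace ℝ (Fin K) →L[ℝ] ℝ)).prod
        (EuclideanSpace.proj i - EuclideanSpace.proj j))
  have hint : ∀ k, ∫ x : EuclideanSpace ℝ (Fin K), x k ∂P = 0 := by
    intro k
    have := (EuclideanSpace.proj k : EuclideanSpace ℝ (Fin K) →L[ℝ] ℝ).integral_comp_comm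
      (IsGaussian.integrable_fun_id (μ := P))
    rw [integral_id_multivariateGaussian, map_zero] at this
    exact this
  have hcov := fun k l => covariance_eval_multivariateGaussian (μ := 0) hR k l
  have hvar := fun k => variance_eval_multivariateGaussian (μ := 0) hR k
  have hind : IndepFun (fun x : EuclideanSpace ℝ (Fin K) => x i + x j) (fun x => x i - x j) P := by
    refine hgauss.indepFun_of_covariance_eq_zero ?_
    change cov[(fun x : EuclideanSpace ℝ (Fin K) => x i) + fun x => x j,
      (fun x => x i) - fun x => x j; P] = 0
    rw [covariance_add_left (hmem i) (hmem j) ((hmem i).sub (hmem j)),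
      covariance_sub_right (hmem i) (hmem i) (hmem j),
      covariance_sub_right (hmem j) (hmem i) (hmem j), hcov, hcov, hcov,
      hcov, hi, hj, show R j i = R i j from hR.isHermitian.apply i j]
    ring
  have hmap : (gaussianLaw R).map (fun x => (x i + x j, x i - x j)) =
      P.map (fun x : EuclideanSpace ℝ (Fin K) => (x i + x j, x i - x j)) := by
    rw [gaussianLaw, Measure.map_map (by fun_prop) (by fun_prop)]
    rfl
  have hintk : ∀ k, Integrable (fun x : EuclideanSpace ℝ (Fin K) => x k) P := fun k =>
    (hmem k).integrable (by norm_num)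
  rw [hmap, hind.map_prod_eq_prod_map_map hgauss.fst.aemeasurable hgauss.snd.aemeasurable,
    hgauss.fst.map_eq_gaussianReal, hgauss.snd.map_eq_gaussianReal,
    integral_add (hintk i) (hintk j), integral_sub (hintk i) (hintk j), hint, hint,
    variance_fun_add (hmem i) (hmem j), variance_fun_sub (hmem i) (hmem j), hvar, hvar, hcov,
    hi, hj, add_zero, sub_zero, sumDiffLaw]
  congr 3 <;> ring

/-- Two values are recovered from their sum and their difference. -/
noncomputable def sumDiffEquiv {i j : Fin K} (hij : i ≠ j) :
    ℝ × ℝ ≃ᵐ (({i, j} : Finset (Fin K)) → ℝ) where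
  toFun z k := if (k : Fin K) = i then (z.1 + z.2) / 2 else (z.1 - z.2) / 2
  invFun x := (x ⟨i, by simp⟩ + x ⟨j, by simp⟩, x ⟨i, by simp⟩ - x ⟨j, by simp⟩)
  left_inv z := by
    simp only [hij.symm, if_true, if_false]
    ext <;> simp <;> ring
  right_inv x := by
    ext ⟨k, hk⟩
    rcases Finset.mem_insert.1 hk with rfl | hk'
    · simp
    · obtain rfl := Finset.mem_singleton.1 hk'
      simp [hij.symm]
  measurable_toFun := by
    refine measurable_pi_lambda _ fun k => ?_
    change Measurable fun z : ℝ × ℝ => if (k : Fin K) = i then (z.1 + z.2) / 2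
      else (z.1 - z.2) / 2
    split_ifs <;> fun_prop
  measurable_invFun := by
    change Measurable fun x : (({i, j} : Finset (Fin K)) → ℝ) =>
      (x ⟨i, by simp⟩ + x ⟨j, by simp⟩, x ⟨i, by simp⟩ - x ⟨j, by simp⟩)
    fun_prop

lemma localLaw_gaussianLaw_pair (hR : R.PosSemidef) {i j : Fin K} (hij : i ≠ j) (hi : R i i = 1)
    (hj : R j j = 1) :
    localLaw (gaussianLaw R) {i, j} = (sumDiffLaw (R i j)).map (sumDiffEquiv hij) := by
  rw [← map_ofLp_gaussian_sum_diff hR hi hj, Measure.map_map (sumDiffEquiv hij).measurable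
    (by fun_prop), localLaw]
  congr 1
  ext x k
  exact (congrFun ((sumDiffEquiv hij).right_inv (Finset.restrict {i, j} x)) k).symm

end GaussianPair


/-! ### Optimality for correlated Gaussian sources -/

section Gaussian

variable {K : ℕ} {ρ : ℝ}

instance (R : Matrix (Fin K) (Fin K) ℝ) : IsProbabilityMeasure (gaussianLaw R) :=
  Measure.isProbabilityMeasure_map (by fun_prop)

/-- The matrix with unit diagonal and all other entries equal to `ρ`. -/
def equicorrelation (K : ℕ) (ρ : ℝ) : Matrix (Fin K) (Fin K) ℝ :=
  Matrix.of fun i j => if i = j then 1 else ρ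

/-- It is `(1 - ρ)` times the identity plus `ρ` times the all-ones matrix. -/
lemma posSemidef_equicorrelation (h0 : 0 ≤ ρ) (h1 : ρ ≤ 1) :
    (equicorrelation K ρ).PosSemidef := by
  have h : equicorrelation K ρ = (1 - ρ) • (1 : Matrix (Fin K) (Fin K) ℝ) +
      ρ • Matrix.vecMulVec (fun _ => (1 : ℝ)) (star fun _ => (1 : ℝ)) := by
    ext i j
    by_cases hij : i = j <;> simp [equicorrelation, Matrix.vecMulVec_apply, hij]
  rw [h]
  exact (Matrix.PosSemidef.one.smul (sub_nonneg.2 h1)).add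
    ((Matrix.posSemidef_vecMulVec_self_star _).smul h0)

lemma equicorrelation_mem_correlationMatrices (hK : 2 ≤ K) (h0 : 0 < ρ) (h1 : ρ < 1) :
    equicorrelation K ρ ∈ correlationMatrices K {ρ} := by
  refine ⟨posSemidef_equicorrelation h0.le h1.le, fun i => by simp [equicorrelation],
    fun i j hij => by simp [equicorrelation, hij.ne], fun h => ?_⟩
  have := congrFun (congrFun h ⟨0, by omega⟩) ⟨1, by omega⟩
  simp [equicorrelation] at this
  exact h0.ne' this

lemma consecutiveGaussianFamily_subset : consecutiveGaussianFamily K ρ ⊆ gaussianFamily K {ρ} :=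
  Set.image_mono fun _ h => h.1

/-- A single member of both families that affects every pair, so no pair has an empty set of
plausible post-change laws. -/
lemma gaussianLaw_equicorrelation_mem (hK : 2 ≤ K) (h0 : 0 < ρ) (h1 : ρ < 1) :
    gaussianLaw (equicorrelation K ρ) ∈ consecutiveGaussianFamily K ρ :=
  ⟨_, ⟨equicorrelation_mem_correlationMatrices hK h0 h1, ⟨0, by omega⟩, ⟨1, by omega⟩, rfl,
    by simp [equicorrelation]⟩, rfl⟩

lemma localLaw_one_pair {i j : Fin K} (hij : i ≠ j) :
    localLaw (gaussianLaw (1 : Matrix (Fin K) (Fin K) ℝ)) {i, j} =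
      (sumDiffLaw 0).map (sumDiffEquiv hij) := by
  rw [localLaw_gaussianLaw_pair Matrix.PosSemidef.one hij (by simp) (by simp),
    Matrix.one_apply_ne hij]

lemma exists_lt_eq_pair {E : Finset (Fin K)} (hE : E.card = 2) :
    ∃ i j : Fin K, i < j ∧ E = {i, j} := by
  obtain ⟨i, j, hij, rfl⟩ := Finset.card_eq_two.1 hE
  rcases lt_or_gt_of_ne hij with h | h
  · exact ⟨i, j, h, rfl⟩
  · exact ⟨j, i, h, Finset.pair_comm i j⟩

lemma hasLLRLaw_localLaw_pair (h0 : 0 < ρ) (h1 : ρ < 1) {i j : Fin K} (hij : i ≠ j) :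
    HasLLRLaw (localLaw (gaussianLaw (1 : Matrix (Fin K) (Fin K) ℝ)) {i, j})
      ((sumDiffLaw ρ).map (sumDiffEquiv hij)) (pairLLRLaw ρ)
      (sumDiffLogRatio ρ ∘ (sumDiffEquiv hij).symm) := by
  rw [localLaw_one_pair hij]
  exact (hasLLRLaw_sumDiffLaw h0 h1).map_equiv _

lemma localLaw_pair_ne (h0 : 0 < ρ) (h1 : ρ < 1) {i j : Fin K} (hij : i ≠ j) :
    (sumDiffLaw ρ).map (sumDiffEquiv hij) ≠
      localLaw (gaussianLaw (1 : Matrix (Fin K) (Fin K) ℝ)) {i, j} := by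
  have : IsProbabilityMeasure (localLaw (gaussianLaw (1 : Matrix (Fin K) (Fin K) ℝ)) {i, j}) :=
    Measure.isProbabilityMeasure_map (Finset.measurable_restrict _).aemeasurable
  exact (hasLLRLaw_localLaw_pair h0 h1 hij).ne (isLLRLaw_pairLLRLaw h0 h1).nondegenerate

lemma localLaw_pair_of_mem {R : Matrix (Fin K) (Fin K) ℝ} (hR : R ∈ correlationMatrices K {ρ})
    {i j : Fin K} (hij : i < j) :
    (R i j = 0 ∧ localLaw (gaussianLaw R) {i, j} = localLaw (gaussianLaw 1) {i, j}) ∨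
      (R i j = ρ ∧ localLaw (gaussianLaw R) {i, j} =
        (sumDiffLaw ρ).map (sumDiffEquiv hij.ne)) := by
  have hloc := localLaw_gaussianLaw_pair hR.1 hij.ne (hR.2.1 i) (hR.2.1 j)
  rcases hR.2.2.1 i j hij with h | h
  · rw [Set.mem_singleton_iff] at h
    exact Or.inr ⟨h, by rw [hloc, h]⟩
  · rw [Set.mem_singleton_iff] at h
    exact Or.inl ⟨h, by rw [hloc, h, localLaw_one_pair hij.ne]⟩

/-- Every affected pair has correlation exactly `ρ`, so the mixture has one component; the
equicorrelated law shows that it does occur, also in the consecutive family. -/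
lemma mixtureLaw_pair (hK : 2 ≤ K) (h0 : 0 < ρ) (h1 : ρ < 1) {𝒢 : Set (Measure (Fin K → ℝ))}
    (h𝒢 : 𝒢 ⊆ gaussianFamily K {ρ}) (h𝒢' : consecutiveGaussianFamily K ρ ⊆ 𝒢) {i j : Fin K}
    (hij : i < j) :
    mixtureLaw (gaussianLaw 1) 𝒢 {i, j} = (sumDiffLaw ρ).map (sumDiffEquiv hij.ne) := by
  refine mixtureLaw_eq_of_postChangeLaws_eq (Set.eq_singleton_iff_unique_mem.2 ⟨?_, ?_⟩)
  · refine ⟨_, h𝒢' (gaussianLaw_equicorrelation_mem hK h0 h1), ?_, localLaw_pair_ne h0 h1 hij.ne⟩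
    rcases localLaw_pair_of_mem (equicorrelation_mem_correlationMatrices hK h0 h1) hij with h | h
    · exact absurd (h.1.symm.trans (by simp [equicorrelation, hij.ne])) h0.ne
    · exact h.2
  · rintro _ ⟨G, hG, rfl, hne⟩
    obtain ⟨R, hR, rfl⟩ := h𝒢 hG
    rcases localLaw_pair_of_mem hR hij with h | h
    · exact absurd h.2 hne
    · exact h.2

theorem asymptoticallyOptimal_gaussian {Ξ : Type*} [MeasurableSpace Ξ] (π : Measure Ξ)
    [IsProbabilityMeasure π] (hK : 2 ≤ K) (h0 : 0 < ρ) (h1 : ρ < 1)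
    {𝒢 : Set (Measure (Fin K → ℝ))} (h𝒢 : 𝒢 ⊆ gaussianFamily K {ρ})
    (h𝒢' : consecutiveGaussianFamily K ρ ⊆ 𝒢) {L : ℕ} [NeZero L] {unit : Fin L → Finset (Fin K)}
    (hunit : ∀ u, (unit u).card = 2) {R : Matrix (Fin K) (Fin K) ℝ}
    (hR : R ∈ correlationMatrices K {ρ})
    (hne : ∃ u, ∃ i j : Fin K, i < j ∧ unit u = {i, j} ∧ R i j = ρ) :
    AsymptoticallyOptimal π 2 (gaussianLaw 1) (gaussianLaw R)
      (fun γ => roundRobin Ξ (gaussianLaw 1) 𝒢 unit (Real.log γ)) := by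
  refine asymptoticallyOptimal_roundRobin π (isLLRLaw_pairLLRLaw h0 h1) hunit
    (fun E hE => ?_) (fun E hE => ?_) ?_
  · obtain ⟨i, j, hij, rfl⟩ := exists_lt_eq_pair hE
    rw [mixtureLaw_pair hK h0 h1 h𝒢 h𝒢' hij]
    exact ⟨_, hasLLRLaw_localLaw_pair h0 h1 hij.ne⟩
  · obtain ⟨i, j, hij, rfl⟩ := exists_lt_eq_pair hE
    rw [mixtureLaw_pair hK h0 h1 h𝒢 h𝒢' hij]
    exact (localLaw_pair_of_mem hR hij).imp And.right And.right
  · obtain ⟨u, i, j, hij, hu, hRij⟩ := hne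
    refine ⟨u, hunit u, ?_⟩
    rw [hu]
    rcases localLaw_pair_of_mem hR hij with h | h
    · exact absurd (h.1.symm.trans hRij) h0.ne
    · rw [h.2]
      exact localLaw_pair_ne h0 h1 hij.ne

/-- By symmetry and the unit diagonal, a matrix without an entry `ρ` above the diagonal would be the
identity. -/
lemma exists_lt_apply_eq {R : Matrix (Fin K) (Fin K) ℝ} (hR : R ∈ correlationMatrices K {ρ}) :
    ∃ i j : Fin K, i < j ∧ R i j = ρ := by
  by_contra hcon
  push Not at hcon
  have hlt : ∀ i j : Fin K, i < j → R i j = 0 := fun i j hij =>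
    (hR.2.2.1 i j hij).resolve_left (hcon i j hij)
  refine hR.2.2.2 (Matrix.ext fun i j => ?_)
  rcases lt_trichotomy i j with h | rfl | h
  · rw [hlt i j h, Matrix.one_apply_ne h.ne]
  · rw [hR.2.1 i, Matrix.one_apply_eq]
  · have := hR.1.isHermitian.apply i j
    rw [hlt j i h, star_zero] at this
    rw [← this, Matrix.one_apply_ne h.ne']

lemma exists_unit_eq_of_enumerates_subsetsOfSize {L : ℕ} {unit : Fin L → Finset (Fin K)}
    (h : Enumerates unit (subsetsOfSize K 2)) {i j : Fin K} (hij : i < j) :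
    ∃ u, unit u = {i, j} := by
  have : ({i, j} : Finset (Fin K)) ∈ Set.range unit := by
    rw [h.2]; exact Finset.card_pair hij.ne
  exact this

lemma card_unit_of_enumerates_subsetsOfSize {L : ℕ} {unit : Fin L → Finset (Fin K)}
    (h : Enumerates unit (subsetsOfSize K 2)) (u : Fin L) : (unit u).card = 2 := by
  have : unit u ∈ subsetsOfSize K 2 := h.2 ▸ Set.mem_range_self u
  exact this

lemma card_unit_of_enumerates_consecutivePairs {L : ℕ} {unit : Fin L → Finset (Fin K)}
    (h : Enumerates unit (consecutivePairs K)) (u : Fin L) : (unit u).card = 2 := by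
  have : unit u ∈ consecutivePairs K := h.2 ▸ Set.mem_range_self u
  obtain ⟨i, j, hij, hu⟩ := this
  rw [hu]
  exact Finset.card_pair fun h => by rw [h] at hij; omega

end Gaussian

end ActiveDetection

/-! ### The two families: every law affects some listed unit -/

theorem proposition4 {Ξ : Type*} [MeasurableSpace Ξ] (π : Measure Ξ) [IsProbabilityMeasure π]
    (K : ℕ) (hK : 2 ≤ K) (ρ : ℝ) (hρ₀ : 0 < ρ) (hρ₁ : ρ < 1) :
    (∀ (L : ℕ) [NeZero L] (unit : Fin L → Finset (Fin K)),
      ActiveDetection.Enumerates unit (ActiveDetection.subsetsOfSize K 2) →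
      ∀ G ∈ ActiveDetection.gaussianFamily K {ρ},
        ActiveDetection.AsymptoticallyOptimal π 2 (ActiveDetection.gaussianLaw 1) G
          (fun γ => ActiveDetection.roundRobin Ξ (ActiveDetection.gaussianLaw 1)
            (ActiveDetection.gaussianFamily K {ρ}) unit (Real.log γ))) ∧
    (∀ (L : ℕ) [NeZero L] (unit : Fin L → Finset (Fin K)),
      (ActiveDetection.Enumerates unit (ActiveDetection.subsetsOfSize K 2) ∨
        ActiveDetection.Enumerates unit (ActiveDetection.consecutivePairs K)) →
      ∀ G ∈ ActiveDetection.consecutiveGaussianFamily K ρ,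
        ActiveDetection.AsymptoticallyOptimal π 2 (ActiveDetection.gaussianLaw 1) G
          (fun γ => ActiveDetection.roundRobin Ξ (ActiveDetection.gaussianLaw 1)
            (ActiveDetection.consecutiveGaussianFamily K ρ) unit (Real.log γ))) := by
  open ActiveDetection in
  constructor
  · rintro L _ unit hU _ ⟨R, hR, rfl⟩
    obtain ⟨i, j, hij, hRij⟩ := exists_lt_apply_eq hR
    obtain ⟨u, hu⟩ := exists_unit_eq_of_enumerates_subsetsOfSize hU hij
    exact asymptoticallyOptimal_gaussian π hK hρ₀ hρ₁ subset_rfl consecutiveGaussianFamily_subset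
      (card_unit_of_enumerates_subsetsOfSize hU) hR ⟨u, i, j, hij, hu, hRij⟩
  · rintro L _ unit hU _ ⟨R, ⟨hR, i, j, hij, hRij⟩, rfl⟩
    have hlt : i < j := by rw [Fin.lt_def]; omega
    rcases hU with hU | hU
    · obtain ⟨u, hu⟩ := exists_unit_eq_of_enumerates_subsetsOfSize hU hlt
      exact asymptoticallyOptimal_gaussian π hK hρ₀ hρ₁ consecutiveGaussianFamily_subset subset_rfl
        (card_unit_of_enumerates_subsetsOfSize hU) hR ⟨u, i, j, hlt, hu, hRij⟩
    · obtain ⟨u, hu⟩ : ({i, j} : Finset (Fin K)) ∈ Set.range unit := by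
        rw [hU.2]; exact ⟨i, j, hij, rfl⟩
      exact asymptoticallyOptimal_gaussian π hK hρ₀ hρ₁ consecutiveGaussianFamily_subset subset_rfl
        (card_unit_of_enumerates_consecutivePairs hU) hR ⟨u, i, j, hlt, hu, hRij⟩
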